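/- Let $n$ and $\alpha$ be positive integers with $\alpha<n$. Let $G(n,\alpha)$ be the disjoint union of $\alpha$ cliques of orders $\lceil n/\alpha\rceil$ and $\lfloor n/\alpha\rfloor$ with $n$ vertices in total, that is, the complement of the Turán graph of order $n$ and clique number $\alpha$. Let $F(n,\alpha)$ be the graph that arises from $G(n,\alpha)$ by choosing a vertex $x_0$ in a clique of order $\lceil n/\alpha\rceil$ and one vertex in each of the other $\alpha-1$ cliques, and joining $x_0$ to each of these $\alpha-1$ chosen vertices (up to isomorphism, the choices do not matter). If $n/\alpha\ge 2$, let $\mathcal F(n,\alpha)=\{F(n,\alpha)\}$ unless $(n,\alpha)=(5,2)$, and let $\mathcal F(5,2)=\{F(5,2),C_5\}$, where $C_5$ is the cycle of order $5$. If $n/\alpha<2$, let $\mathcal F(n,\alpha)$ be the set of all connected graphs $H$ that have a vertex $x_0$ such that $H-x_0$ is isomorphic to $G(n-1,\alpha)$. Let $$g(n,\alpha)=\left\lfloor\frac n\alpha\right\rfloor^{\alpha-(n\bmod\alpha)}\left\lceil\frac n\alpha\right\rceil^{n\bmod\alpha}$$ and $$f(n,\alpha)=g(n-1,\alpha)+\left(\left\lfloor\frac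 n\alpha\right\rfloor-1\right)^{\alpha-(n\bmod\alpha)}\left(\left\lceil\frac n\alpha\right\rceil-1\right)^{(n\bmod\alpha)-1}.$$ **Theorem.** If $G$ is a finite simple connected graph of order $n$ and independence number $\alpha$ with $\alpha<n$, then the number of maximum independent sets of $G$ (independent sets of cardinality $\alpha$) is at most $f(n,\alpha)$, with equality if and only if $G$ is isomorphic to a graph in $\mathcal F(n,\alpha)$. -/

import Mathlib

open SimpleGraph

/-- The number of maximum independent sets of a finite graph, that is, of independent sets
whose cardinality is the independence number. -/
noncomputable def numMaxIndepSets {V : Type*} [Fintype V] (G : SimpleGraph V) : ℕ :=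
  {s : Finset V | G.IsMaximumIndepSet s}.ncard

/-- `G(n, a)`: the complement of the Turán graph of order `n` and clique number `a`, that is, the
disjoint union of `a` cliques of orders `⌈n / a⌉` and `⌊n / a⌋`. The cliques are the residue
classes modulo `a` in `{0, …, n - 1}`. -/
def balancedCliques (n a : ℕ) : SimpleGraph (Fin n) := (turanGraph n a)ᶜ

/-- `F(n, a)`: the graph `G(n, a)` with the vertex `0` (which lies in a clique of the largest order
`⌈n / a⌉`) joined to the vertices `1, …, a - 1`, one in each of the other cliques. -/
def linkedCliques (n a : ℕ) : SimpleGraph (Fin n) :=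
  balancedCliques n a ⊔
    SimpleGraph.fromRel (fun v w : Fin n => (v : ℕ) = 0 ∧ 1 ≤ (w : ℕ) ∧ (w : ℕ) < a)

/-- The family of extremal graphs, with vertex set `{0, …, n - 1}`. -/
noncomputable def extremalFamily (n a : ℕ) : Set (SimpleGraph (Fin n)) :=
  if (2 : ℚ) ≤ (n : ℚ) / (a : ℚ) then
    if n = 5 ∧ a = 2 then {linkedCliques n a, cycleGraph n} else {linkedCliques n a}
  else
    {G | G.Connected ∧
      ∃ x₀ : Fin n, Nonempty (G.induce ({x₀}ᶜ : Set (Fin n)) ≃g balancedCliques (n - 1) a)}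

/-- `g(n, a) = ⌊n / a⌋ ^ (a - (n mod a)) * ⌈n / a⌉ ^ (n mod a)`. -/
def gCount (n a : ℕ) : ℕ :=
  ⌊(n : ℚ) / (a : ℚ)⌋₊ ^ (a - n % a) * ⌈(n : ℚ) / (a : ℚ)⌉₊ ^ (n % a)

/-- `f(n, a) = g(n - 1, a) + (⌊n / a⌋ - 1) ^ (a - (n mod a)) * (⌈n / a⌉ - 1) ^ ((n mod a) - 1)`.
The last exponent is an integer, which equals `-1` if `a` divides `n`; for `0 < a < n` the base
`⌈n / a⌉ - 1` is positive. -/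
def fCount (n a : ℕ) : ℚ :=
  (gCount (n - 1) a : ℚ) +
    ((⌊(n : ℚ) / (a : ℚ)⌋₊ : ℚ) - 1) ^ (a - n % a) *
      ((⌈(n : ℚ) / (a : ℚ)⌉₊ : ℚ) - 1) ^ (((n % a : ℕ) : ℤ) - 1)

/-! All counting takes place inside a vertex set `S` of a fixed type, so that subgraphs are subsets.
The number `(indepSets G S a).card` is studied under `IndepLE G S a`, which permits a smaller
independence number because the count is then 0.

Upper bound. Zykov's theorem (`card_indepSets_le`) bounds the count for arbitrary graphs by
`balancedProd`. For connected graphs the proof is an induction on `S`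
(`card_indepSets_le_connBound`). A vertex in no maximum independent set can be deleted, and Zykov's
bound for the rest suffices. At a cut vertex `y` the graph splits into a connected part and a part
containing `y` whose independence numbers add up (`exists_cutSplit`). The inductive bounds for both
parts and Zykov's bounds for the parts without a vertex combine to the count of two stars of cliques
joined at their centres, and a single balanced star does at least as well (`connBound_glue`). If
there is no cut vertex, take a vertex `x` in the largest number of maximum independent sets and turn
a neighbour `y` into a true twin of `x`. The count does not drop, the independence number does not
grow, and the graph stays connected because it is connected without `y`. Fewer neighbours of `x` are
now non-twins, so the process ends in a complete graph unless one of the other two cases occurs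
before.

Equality. In those two cases some vertex `w` leaves a disjoint union of cliques (`HasCentre`). If
`w` lies in no maximum independent set, then `reducedProd` is 0, which means `n < 2 * a`, and the
cliques are balanced. Otherwise `w` completes one of the cliques, and comparison with
`starProd_le_and` yields `F(n, a)`. In an extremal graph without cut vertex, no twin operation can
raise the count, so all vertices lie in equally many maximum independent sets and every twin
operation preserves extremality. If the operation creates a cut vertex, the new graph is `F(n, a)`,
and counting sets through neighbours of `y` in the old graph leaves only the five-cycle
(`isPentagon_of_twinGraph`). If it creates none, induction makes the new graph a five-cycle, which
is absurd because a five-cycle has no adjacent twins. -/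

/-! ### Balanced products and stars of cliques. -/

/-- The product of `a` natural numbers with sum `n` that are as equal as possible. -/
def balancedProd (n a : ℕ) : ℕ := (n / a) ^ (a - n % a) * (n / a + 1) ^ (n % a)

/-- The product of the orders minus one of the cliques of `G(n, a)` other than a largest one. -/
def reducedProd (n a : ℕ) : ℕ :=
  ((n - 1) / a - 1) ^ (a - 1 - (n - 1) % a) * ((n - 1) / a) ^ ((n - 1) % a)

/-- The value of `f(n, a)` as a natural number. -/
def connBound (n a : ℕ) : ℕ := balancedProd (n - 1) a + reducedProd n a

/-- The number of maximum independent sets of a clique of order `k + 1` with one vertex linked to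
one vertex in each of some further cliques whose orders are listed in `m`. -/
def starProd (k : ℕ) (m : Multiset ℕ) : ℕ := k * m.prod + (m.map (· - 1)).prod

lemma exists_eq_replicate_add {m : Multiset ℕ} {k : ℕ} (h : ∀ x ∈ m, x = k ∨ x = k + 1) :
    ∃ u r, m = Multiset.replicate u k + Multiset.replicate r (k + 1) := by
  induction m using Multiset.induction with
  | empty => exact ⟨0, 0, by simp⟩
  | cons x m ih =>
    obtain ⟨u, r, hm⟩ := ih fun y hy => h y (Multiset.mem_cons_of_mem hy)
    rcases h x (Multiset.mem_cons_self x m) with rfl | rfl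
    · exact ⟨u + 1, r, by rw [hm, Multiset.replicate_succ, Multiset.cons_add]⟩
    · exact ⟨u, r + 1, by rw [hm, Multiset.replicate_succ, Multiset.add_cons]⟩

lemma balancedProd_mul_add {k u r : ℕ} (hu : 0 < u) :
    balancedProd (k * (u + r) + r) (u + r) = k ^ u * (k + 1) ^ r := by
  have h1 : (k * (u + r) + r) / (u + r) = k := by
    rw [mul_comm, Nat.mul_add_div (by omega), Nat.div_eq_of_lt (by omega), add_zero]
  have h2 : (k * (u + r) + r) % (u + r) = r := by
    rw [mul_comm, Nat.mul_add_mod, Nat.mod_eq_of_lt (by omega)]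
  rw [balancedProd, h1, h2, Nat.add_sub_cancel]

lemma prod_eq_balancedProd {m : Multiset ℕ} {k : ℕ} (h : ∀ x ∈ m, x = k ∨ x = k + 1) :
    m.prod = balancedProd m.sum m.card := by
  obtain ⟨u, r, rfl⟩ := exists_eq_replicate_add h
  rcases Nat.eq_zero_or_pos u with rfl | hu
  · rcases Nat.eq_zero_or_pos r with rfl | hr
    · simp [balancedProd]
    · have := balancedProd_mul_add (k := k + 1) (u := r) (r := 0) hr
      simp only [add_zero, pow_zero, mul_one] at this
      simp [mul_comm r, this]
  · have := balancedProd_mul_add (k := k) (r := r) hu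
    have e : u * k + r * (k + 1) = k * (u + r) + r := by ring
    simp [e, this]

lemma balancedProd_pos {n a : ℕ} (h : a ≤ n) : 0 < balancedProd n a := by
  rcases Nat.eq_zero_or_pos a with rfl | ha
  · simp [balancedProd]
  · exact Nat.mul_pos (pow_pos (Nat.div_pos h ha) _) (pow_pos (Nat.succ_pos _) _)

/-- Moving a unit from a larger entry `y + 2 + d` to a smaller entry `y` gains `d + 1` times the
product of the other entries and lowers the sum of squares, which is the induction measure. The gain
may vanish when the product is 0, hence the positivity in the equality clause. -/
lemma prod_le_balancedProd_and (M : ℕ) : ∀ m : Multiset ℕ, (m.map (· ^ 2)).sum ≤ M →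
    m.prod ≤ balancedProd m.sum m.card ∧
      (0 < m.prod → m.prod = balancedProd m.sum m.card → ∀ x ∈ m, ∀ y ∈ m, x ≤ y + 1) := by
  induction M using Nat.strong_induction_on with
  | _ M ih =>
  intro m hM
  by_cases hbal : ∀ x ∈ m, ∀ y ∈ m, x ≤ y + 1
  · refine ⟨le_of_eq ?_, fun _ _ => hbal⟩
    rcases m.empty_or_exists_mem with rfl | hne
    · exact prod_eq_balancedProd (k := 0) (by simp)
    · have hex : ∃ k, k ∈ m := hne
      have hmin := Nat.find_spec hex
      refine prod_eq_balancedProd (k := Nat.find hex) fun x hx => ?_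
      have h1 := hbal x hx _ hmin
      have h2 := Nat.find_min' hex hx
      omega
  · push Not at hbal
    obtain ⟨x, hx, y, hy, hxy⟩ := hbal
    obtain ⟨m₁, rfl⟩ := Multiset.exists_cons_of_mem hx
    have hy' : y ∈ m₁ := by
      rcases Multiset.mem_cons.1 hy with h | h
      · omega
      · exact h
    obtain ⟨m₂, rfl⟩ := Multiset.exists_cons_of_mem hy'
    obtain ⟨d, rfl⟩ : ∃ d, x = y + 2 + d := ⟨x - y - 2, by omega⟩
    have hlt : (((y + 1 + d) ::ₘ (y + 1) ::ₘ m₂).map (· ^ 2)).sum <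
        (((y + 2 + d) ::ₘ y ::ₘ m₂).map (· ^ 2)).sum := by
      simp only [Multiset.map_cons, Multiset.sum_cons]
      nlinarith
    obtain ⟨h1, -⟩ := ih _ (hlt.trans_le hM) _ le_rfl
    have hs : ((y + 1 + d) ::ₘ (y + 1) ::ₘ m₂).sum = ((y + 2 + d) ::ₘ y ::ₘ m₂).sum := by
      simp only [Multiset.sum_cons]; ring
    rw [hs] at h1
    simp only [Multiset.card_cons, Multiset.prod_cons] at h1 ⊢
    have key : (y + 1 + d) * ((y + 1) * m₂.prod) =
        (y + 2 + d) * (y * m₂.prod) + (d + 1) * m₂.prod := by ring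
    refine ⟨by nlinarith [Nat.zero_le ((d + 1) * m₂.prod)], fun hpos heq => ?_⟩
    have : 0 < m₂.prod := by
      by_contra h
      rw [Nat.le_zero.1 (not_lt.1 h)] at hpos
      simp at hpos
    nlinarith [Nat.mul_pos (Nat.succ_pos d) this]

lemma prod_le_balancedProd (m : Multiset ℕ) : m.prod ≤ balancedProd m.sum m.card :=
  (prod_le_balancedProd_and _ m le_rfl).1

lemma le_add_one_of_prod_eq {m : Multiset ℕ} (h : m.prod = balancedProd m.sum m.card)
    (hm : m.card ≤ m.sum) {x y : ℕ} (hx : x ∈ m) (hy : y ∈ m) : x ≤ y + 1 :=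
  (prod_le_balancedProd_and _ m le_rfl).2 (h ▸ balancedProd_pos hm) h x hx y hy

lemma exists_eq_balancedProd {n a : ℕ} (h : 0 < a) :
    ∃ m : Multiset ℕ, m.card = a ∧ m.sum = n ∧ m.prod = balancedProd n a := by
  have hr := Nat.mod_lt n h
  have hsum : (Multiset.replicate (a - n % a) (n / a) +
      Multiset.replicate (n % a) (n / a + 1)).sum = n := by
    have e : (a - n % a) * (n / a) + n % a * (n / a + 1) =
        (a - n % a + n % a) * (n / a) + n % a := by ring
    simp only [Multiset.sum_add, Multiset.sum_replicate, smul_eq_mul]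
    rw [e, Nat.sub_add_cancel hr.le, Nat.div_add_mod]
  refine ⟨_, ?_, hsum, ?_⟩
  · simp only [Multiset.card_add, Multiset.card_replicate]; omega
  · simp [balancedProd]

/-- Append the factor `s` to a balanced family and rebalance: the arithmetic of the induction step
in Zykov's bound. -/
lemma mul_balancedProd_le (s n a : ℕ) (h : 0 < a ∨ n = 0) :
    s * balancedProd n a ≤ balancedProd (s + n) (a + 1) := by
  rcases Nat.eq_zero_or_pos a with rfl | ha
  · obtain rfl : n = 0 := by omega
    simp [balancedProd, Nat.mod_one]
  · obtain ⟨m, rfl, rfl, hm⟩ := exists_eq_balancedProd (n := n) ha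
    simpa [hm] using prod_le_balancedProd (s ::ₘ m)

/-- Removing one vertex from the centre clique leaves only orders `k` and `k + 1`, so the first
summand is a balanced product with quotient `k`, and the second is `reducedProd`. -/
lemma starProd_eq_connBound {k : ℕ} {m : Multiset ℕ} (h : ∀ x ∈ m, x = k ∨ x = k + 1) :
    starProd k m = connBound (k + 1 + m.sum) (m.card + 1) := by
  obtain ⟨u, r, rfl⟩ := exists_eq_replicate_add h
  have e : k + 1 + (Multiset.replicate u k + Multiset.replicate r (k + 1)).sum - 1 =
      k * (u + 1 + r) + r := by
    simp only [Multiset.sum_add, Multiset.sum_replicate, smul_eq_mul]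
    have : k + 1 + (u * k + r * (k + 1)) = k * (u + 1 + r) + r + 1 := by ring
    omega
  have h1 : (k * (u + 1 + r) + r) / (u + 1 + r) = k := by
    rw [mul_comm, Nat.mul_add_div (by omega), Nat.div_eq_of_lt (by omega), add_zero]
  have h2 : (k * (u + 1 + r) + r) % (u + 1 + r) = r := by
    rw [mul_comm, Nat.mul_add_mod, Nat.mod_eq_of_lt (by omega)]
  have hc : (Multiset.replicate u k + Multiset.replicate r (k + 1)).card + 1 = u + 1 + r := by
    simp; omega
  have hd : u + 1 + r - 1 - r = u := by omega
  rw [connBound, reducedProd, e, hc, balancedProd_mul_add (by omega), h1, h2, starProd, hd]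
  simp [pow_succ]
  ring

/-- The centre clique, of order `k + 1`, is a largest one here. If some order `y` lies below `k`, a
vertex moves to that clique: from another clique of order `k + 1` if there is one, otherwise from
the centre, which then remains a largest clique. Either move strictly increases the count, since all
orders are at least 2 and the products involved are positive, and it lowers the sum of squared
orders. -/
lemma starProd_le_and_of_le (M : ℕ) : ∀ (k : ℕ) (m : Multiset ℕ),
    (m.map (· ^ 2)).sum + (k + 1) ^ 2 ≤ M → (∀ x ∈ m, 2 ≤ x) → (∀ x ∈ m, x ≤ k + 1) →
    starProd k m ≤ connBound (k + 1 + m.sum) (m.card + 1) ∧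
      (starProd k m = connBound (k + 1 + m.sum) (m.card + 1) → ∀ x ∈ m, k ≤ x) := by
  induction M using Nat.strong_induction_on with
  | _ M ih =>
  intro k m hM h2 hk
  by_cases hbal : ∀ x ∈ m, k ≤ x
  · refine ⟨(starProd_eq_connBound fun x hx => ?_).le, fun _ => hbal⟩
    have := hbal x hx
    have := hk x hx
    omega
  push Not at hbal
  obtain ⟨y, hy, hyk⟩ := hbal
  obtain ⟨d, rfl⟩ : ∃ d, k = y + 1 + d := ⟨k - y - 1, by omega⟩
  by_cases htop : y + 1 + d + 1 ∈ m
  · obtain ⟨m₁, rfl⟩ := Multiset.exists_cons_of_mem htop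
    have hy' : y ∈ m₁ := by
      rcases Multiset.mem_cons.1 hy with h | h
      · omega
      · exact h
    obtain ⟨m₂, rfl⟩ := Multiset.exists_cons_of_mem hy'
    have hlt : (((y + 1 + d) ::ₘ (y + 1) ::ₘ m₂).map (· ^ 2)).sum <
        (((y + 1 + d + 1) ::ₘ y ::ₘ m₂).map (· ^ 2)).sum := by
      simp only [Multiset.map_cons, Multiset.sum_cons]
      nlinarith
    simp only [Multiset.mem_cons, forall_eq_or_imp] at h2 hk
    obtain ⟨h1, -⟩ := ih _ ((Nat.add_lt_add_right hlt _).trans_le hM) (y + 1 + d)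
      ((y + 1 + d) ::ₘ (y + 1) ::ₘ m₂) le_rfl
      (by simp only [Multiset.mem_cons, forall_eq_or_imp]
          exact ⟨by omega, by omega, h2.2.2⟩)
      (by simp only [Multiset.mem_cons, forall_eq_or_imp]
          exact ⟨by omega, by omega, hk.2.2⟩)
    have hs : ((y + 1 + d) ::ₘ (y + 1) ::ₘ m₂).sum = ((y + 1 + d + 1) ::ₘ y ::ₘ m₂).sum := by
      simp only [Multiset.sum_cons]; ring
    have hpos : 0 < m₂.prod := by
      rw [Nat.pos_iff_ne_zero, Ne, Multiset.prod_eq_zero_iff]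
      intro h0
      have := h2.2.2 0 h0
      omega
    obtain ⟨z, rfl⟩ : ∃ z, y = z + 1 := ⟨y - 1, by omega⟩
    have hlt' : starProd (z + 1 + 1 + d) ((z + 1 + 1 + d + 1) ::ₘ (z + 1) ::ₘ m₂) <
        starProd (z + 1 + 1 + d) ((z + 1 + 1 + d) ::ₘ (z + 1 + 1) ::ₘ m₂) := by
      simp only [starProd, Multiset.map_cons, Multiset.prod_cons, Nat.add_sub_cancel]
      have e1 : z + 1 + 1 + d - 1 = z + 1 + d := by omega
      rw [e1]
      generalize (m₂.map (· - 1)).prod = Q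
      have : (z + 1 + 1 + d) * ((z + 1 + 1 + d) * ((z + 1 + 1) * m₂.prod)) +
          (z + 1 + d) * ((z + 1) * Q) =
          (z + 1 + 1 + d) * ((z + 1 + 1 + d + 1) * ((z + 1) * m₂.prod)) +
            (z + 1 + 1 + d) * (z * Q) + (z + 1 + 1 + d) * (d + 1) * m₂.prod + (d + 1) * Q := by
        ring
      rw [this]
      have : 0 < (z + 1 + 1 + d) * (d + 1) * m₂.prod := by positivity
      omega
    rw [hs] at h1
    simp only [Multiset.card_cons] at h1 ⊢
    exact ⟨(hlt'.trans_le h1).le, fun h => absurd h (hlt'.trans_le h1).ne⟩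
  · obtain ⟨m₁, rfl⟩ := Multiset.exists_cons_of_mem hy
    simp only [Multiset.mem_cons, forall_eq_or_imp, not_or] at h2 hk htop
    have hlt : (((y + 1) ::ₘ m₁).map (· ^ 2)).sum + (y + d + 1) ^ 2 <
        ((y ::ₘ m₁).map (· ^ 2)).sum + (y + 1 + d + 1) ^ 2 := by
      simp only [Multiset.map_cons, Multiset.sum_cons]
      nlinarith
    obtain ⟨h1, -⟩ := ih _ (hlt.trans_le hM) (y + d) ((y + 1) ::ₘ m₁) le_rfl
      (by simp only [Multiset.mem_cons, forall_eq_or_imp]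
          exact ⟨by omega, h2.2⟩)
      (by simp only [Multiset.mem_cons, forall_eq_or_imp]
          refine ⟨by omega, fun x hx => ?_⟩
          have := hk.2 x hx
          have : x ≠ y + 1 + d + 1 := fun h => htop.2 (h ▸ hx)
          omega)
    have hs : y + d + 1 + ((y + 1) ::ₘ m₁).sum = y + 1 + d + 1 + (y ::ₘ m₁).sum := by
      simp only [Multiset.sum_cons]; ring
    have hpos : 0 < (m₁.map (· - 1)).prod := by
      rw [Nat.pos_iff_ne_zero, Ne, Multiset.prod_eq_zero_iff, Multiset.mem_map]
      rintro ⟨x, hx, h0⟩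
      have := h2.2 x hx
      omega
    obtain ⟨z, rfl⟩ : ∃ z, y = z + 1 := ⟨y - 1, by omega⟩
    have hlt' : starProd (z + 1 + 1 + d) ((z + 1) ::ₘ m₁) <
        starProd (z + 1 + d) ((z + 1 + 1) ::ₘ m₁) := by
      simp only [starProd, Multiset.map_cons, Multiset.prod_cons, Nat.add_sub_cancel]
      have : (z + 1 + d) * ((z + 1 + 1) * m₁.prod) + (z + 1) * (m₁.map (· - 1)).prod =
          (z + 1 + 1 + d) * ((z + 1) * m₁.prod) + z * (m₁.map (· - 1)).prod +
            d * m₁.prod + (m₁.map (· - 1)).prod := by ring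
      rw [this]
      omega
    rw [hs] at h1
    simp only [Multiset.card_cons] at h1 ⊢
    exact ⟨(hlt'.trans_le h1).le, fun h => absurd h (hlt'.trans_le h1).ne⟩

lemma prod_pred_le (m : Multiset ℕ) : (m.map (· - 1)).prod ≤ m.prod := by
  induction m using Multiset.induction with
  | empty => simp
  | cons x m ih =>
    simp only [Multiset.map_cons, Multiset.prod_cons]
    exact Nat.mul_le_mul (Nat.sub_le x 1) ih

lemma prod_pos_of_forall {m : Multiset ℕ} (h : ∀ x ∈ m, 1 ≤ x) : 0 < m.prod := by
  rw [Nat.pos_iff_ne_zero, Ne, Multiset.prod_eq_zero_iff]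
  exact fun h0 => absurd (h 0 h0) (by omega)

lemma prod_pred_lt {m : Multiset ℕ} (h : ∀ x ∈ m, 1 ≤ x) (h0 : m ≠ 0) :
    (m.map (· - 1)).prod < m.prod := by
  obtain ⟨x, hx⟩ := Multiset.exists_mem_of_ne_zero h0
  obtain ⟨m₁, rfl⟩ := Multiset.exists_cons_of_mem hx
  simp only [Multiset.mem_cons, forall_eq_or_imp] at h
  simp only [Multiset.map_cons, Multiset.prod_cons]
  exact (Nat.mul_le_mul_left _ (prod_pred_le m₁)).trans_lt
    (Nat.mul_lt_mul_of_pos_right (by omega) (prod_pos_of_forall h.2))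

/-- A star of cliques has at most as many maximum independent sets as the balanced one. -/
lemma starProd_le_and {k : ℕ} {m : Multiset ℕ} (hk : 1 ≤ k) (h2 : ∀ x ∈ m, 2 ≤ x) :
    starProd k m ≤ connBound (k + 1 + m.sum) (m.card + 1) ∧
      (starProd k m = connBound (k + 1 + m.sum) (m.card + 1) →
        (∀ x ∈ m, k ≤ x ∧ x ≤ k + 1) ∨ m = {k + 2}) := by
  by_cases htop : ∀ x ∈ m, x ≤ k + 1
  · obtain ⟨h1, h3⟩ := starProd_le_and_of_le _ k m le_rfl h2 htop
    exact ⟨h1, fun h => Or.inl fun x hx => ⟨h3 h x hx, htop x hx⟩⟩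
  push Not at htop
  obtain ⟨x₀, hx₀, hx₀k⟩ := htop
  have hne : m.toFinset.Nonempty := ⟨x₀, Multiset.mem_toFinset.2 hx₀⟩
  obtain ⟨x, hx, hmax⟩ := m.toFinset.exists_max_image id hne
  simp only [Multiset.mem_toFinset, id] at hx hmax
  have hkx := hx₀k.trans_le (hmax x₀ hx₀)
  obtain ⟨m₁, rfl⟩ := Multiset.exists_cons_of_mem hx
  obtain ⟨d, rfl⟩ : ∃ d, x = k + 2 + d := ⟨x - k - 2, by omega⟩
  simp only [Multiset.mem_cons, forall_eq_or_imp] at h2 hmax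
  obtain ⟨h1, h3⟩ := starProd_le_and_of_le _ (k + 1 + d) ((k + 1) ::ₘ m₁) le_rfl
      (by simp only [Multiset.mem_cons, forall_eq_or_imp]
          exact ⟨by omega, h2.2⟩)
      (by simp only [Multiset.mem_cons, forall_eq_or_imp]
          refine ⟨by omega, fun x hx => ?_⟩
          have := hmax.2 x hx
          omega)
  have hs : k + 1 + d + 1 + ((k + 1) ::ₘ m₁).sum = k + 1 + ((k + 2 + d) ::ₘ m₁).sum := by
    simp only [Multiset.sum_cons]; ring
  rw [hs] at h1 h3
  simp only [Multiset.card_cons] at h1 h3 ⊢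
  have hPQ := prod_pred_le m₁
  obtain ⟨e, he⟩ := Nat.exists_eq_add_of_le hPQ
  -- Making the largest clique, of order `k + 2 + d`, the centre gains `(d + 1) * e`, where `e` is
  -- the product of the remaining orders minus its reduced version. Equality therefore needs `m₁ =
  -- 0`: with only two cliques the choice of the centre is immaterial, which is the exceptional case
  -- `m = {k + 2}`.
  have key : starProd (k + 1 + d) ((k + 1) ::ₘ m₁) =
      starProd k ((k + 2 + d) ::ₘ m₁) + (d + 1) * e := by
    simp only [starProd, Multiset.map_cons, Multiset.prod_cons, Nat.add_sub_cancel]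
    have e1 : k + 2 + d - 1 = k + 1 + d := by omega
    rw [e1, he]
    ring
  refine ⟨by omega, fun h => Or.inr ?_⟩
  have he0 : e = 0 := by
    have : (d + 1) * e = 0 := by omega
    simpa using this
  have hm : m₁ = 0 := by
    by_contra h0
    have := prod_pred_lt (fun x hx => (by have := h2.2 x hx; omega : 1 ≤ x)) h0
    omega
  have hd := h3 (by rw [key, he0]; omega) (k + 1) (Multiset.mem_cons_self _ _)
  obtain rfl : d = 0 := by omega
  rw [hm]
  rfl

/-- If some order is at most 1, the second product vanishes and the first alone is bounded by a
balanced product. -/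
lemma starProd_le {k : ℕ} (m : Multiset ℕ) (hk : 1 ≤ k) :
    starProd k m ≤ connBound (k + 1 + m.sum) (m.card + 1) := by
  by_cases h2 : ∀ x ∈ m, 2 ≤ x
  · exact (starProd_le_and hk h2).1
  push Not at h2
  obtain ⟨x, hx, hx2⟩ := h2
  have hQ : (m.map (· - 1)).prod = 0 := by
    rw [Multiset.prod_eq_zero_iff, Multiset.mem_map]
    exact ⟨x, hx, by omega⟩
  have := prod_le_balancedProd (k ::ₘ m)
  simp only [Multiset.prod_cons, Multiset.sum_cons, Multiset.card_cons] at this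
  rw [starProd, hQ, connBound, show k + 1 + m.sum - 1 = k + m.sum by omega]
  omega

/-- A balanced star that attains `connBound`, with its two summands given separately for use in
`connBound_glue`. -/
lemma exists_starProd {n a : ℕ} (hn : 1 ≤ n) (ha : 0 < a) :
    ∃ m : Multiset ℕ, m.card + 1 = a ∧ (n - 1) / a + 1 + m.sum = n ∧
      balancedProd (n - 1) a = (n - 1) / a * m.prod ∧
      reducedProd n a = (m.map (· - 1)).prod ∧ ∀ x ∈ m, (n - 1) / a ≤ x := by
  have hr := Nat.mod_lt (n - 1) ha
  have hdm := Nat.div_add_mod (n - 1) a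
  obtain ⟨k, hk⟩ : ∃ k, k = (n - 1) / a := ⟨_, rfl⟩
  obtain ⟨r, hr'⟩ : ∃ r, r = (n - 1) % a := ⟨_, rfl⟩
  rw [← hr'] at hr
  rw [← hk, ← hr'] at hdm
  rw [balancedProd, reducedProd, ← hk, ← hr']
  obtain ⟨u, rfl⟩ : ∃ u, a = u + 1 + r := ⟨a - 1 - r, by omega⟩
  refine ⟨Multiset.replicate u k + Multiset.replicate r (k + 1), ?_, ?_, ?_, ?_, ?_⟩
  · simp; omega
  · simp only [Multiset.sum_add, Multiset.sum_replicate, smul_eq_mul]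
    have : k + 1 + (u * k + r * (k + 1)) = (u + 1 + r) * k + r + 1 := by ring
    omega
  · rw [Nat.add_sub_cancel]
    simp [pow_succ]
    ring
  · rw [show u + 1 + r - 1 - r = u by omega]
    simp
  · simp only [Multiset.mem_add, Multiset.mem_replicate]
    omega

/-- The left side counts the single star in which the second centre, of order `k₂ + 1`, is one of
the cliques linked to the first centre. The first two terms on the right count two stars joined at
their centres; the last product is the surplus of the single star. -/
lemma starProd_merge {k₁ k₂ P₁ Q₁ P₂ Q₂ : ℕ} (hk : k₂ ≤ k₁) (h₁ : Q₁ ≤ P₁) (h₂ : Q₂ ≤ P₂) :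
    k₁ * ((k₂ + 1) * (P₁ * P₂)) + k₂ * (Q₁ * Q₂) =
      (k₂ * P₂ + Q₂) * (k₁ * P₁) + k₂ * P₂ * Q₁ + (k₁ * P₁ - k₂ * Q₁) * (P₂ - Q₂) := by
  have h₃ : k₂ * Q₁ ≤ k₁ * P₁ := Nat.mul_le_mul hk h₁
  zify [h₂, h₃]
  ring

/-- Joining two stars of cliques at their centres does not beat a single star. -/
lemma connBound_glue {n₁ a₁ n₂ a₂ : ℕ} (ha₁ : 1 ≤ a₁) (hn₁ : a₁ < n₁) (ha₂ : 1 ≤ a₂)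
    (hn₂ : a₂ < n₂ ∨ n₂ = 1 ∧ a₂ = 1) :
    connBound n₂ a₂ * balancedProd (n₁ - 1) a₁ + balancedProd (n₂ - 1) a₂ * reducedProd n₁ a₁ ≤
        connBound (n₁ + n₂) (a₁ + a₂) ∧
      (connBound n₂ a₂ * balancedProd (n₁ - 1) a₁ + balancedProd (n₂ - 1) a₂ * reducedProd n₁ a₁ =
        connBound (n₁ + n₂) (a₁ + a₂) → a₁ = 1 ∨ a₂ = 1) := by
  obtain ⟨m₁, hc₁, hs₁, hg₁, hq₁, hb₁⟩ := exists_starProd (n := n₁) (a := a₁) (by omega) ha₁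
  obtain ⟨m₂, hc₂, hs₂, hg₂, hq₂, hb₂⟩ := exists_starProd (n := n₂) (a := a₂) (by omega) ha₂
  have hk₁ : 1 ≤ (n₁ - 1) / a₁ := Nat.div_pos (by omega) ha₁
  have hk₂ : 1 ≤ (n₂ - 1) / a₂ ∨ m₂ = 0 := by
    rcases hn₂ with h | h
    · exact Or.inl (Nat.div_pos (by omega) ha₂)
    · exact Or.inr (Multiset.card_eq_zero.1 (by omega))
  rw [connBound, hg₁, hq₁, hg₂, hq₂]
  generalize (n₁ - 1) / a₁ = k₁ at *
  generalize (n₂ - 1) / a₂ = k₂ at *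
  have h1 : ∀ x ∈ m₁, 1 ≤ x := fun x hx => hk₁.trans (hb₁ x hx)
  have h2 : ∀ x ∈ m₂, 1 ≤ x := by
    rcases hk₂ with h | rfl
    · exact fun x hx => h.trans (hb₂ x hx)
    · simp
  have hP₁ := prod_pos_of_forall h1
  have hP₂ := prod_pos_of_forall h2
  have hQ₁ := prod_pred_le m₁
  have hQ₂ := prod_pred_le m₂
  have hlt₁ : a₁ ≠ 1 → (m₁.map (· - 1)).prod < m₁.prod := fun h =>
    prod_pred_lt h1 (by rintro rfl; simp at hc₁; omega)
  have hlt₂ : a₂ ≠ 1 → (m₂.map (· - 1)).prod < m₂.prod := fun h =>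
    prod_pred_lt h2 (by rintro rfl; simp at hc₂; omega)
  -- The larger centre becomes the centre of the single star. The count of the joined stars is
  -- symmetric in the two, as `hcomm` below expresses.
  rcases le_total k₂ k₁ with hle | hle
  · have hstar := starProd_le ((k₂ + 1) ::ₘ (m₁ + m₂)) hk₁
    simp only [starProd, Multiset.map_cons, Multiset.map_add, Multiset.prod_cons,
      Multiset.prod_add, Multiset.sum_cons, Multiset.sum_add, Multiset.card_cons,
      Multiset.card_add, Nat.add_sub_cancel] at hstar
    rw [starProd_merge hle hQ₁ hQ₂,
      show k₁ + 1 + (k₂ + 1 + (m₁.sum + m₂.sum)) = n₁ + n₂ by omega,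
      show m₁.card + m₂.card + 1 + 1 = a₁ + a₂ by omega] at hstar
    refine ⟨by omega, fun h => ?_⟩
    by_contra hne
    push Not at hne
    have h₂ := hlt₂ hne.2
    have h₁ : k₂ * (m₁.map (· - 1)).prod < k₁ * m₁.prod :=
      (Nat.mul_le_mul_right _ hle).trans_lt (Nat.mul_lt_mul_of_pos_left (hlt₁ hne.1) hk₁)
    have := Nat.mul_pos (Nat.sub_pos_of_lt h₁) (Nat.sub_pos_of_lt h₂)
    omega
  · have hstar := starProd_le ((k₁ + 1) ::ₘ (m₂ + m₁)) (hk₁.trans hle)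
    simp only [starProd, Multiset.map_cons, Multiset.map_add, Multiset.prod_cons,
      Multiset.prod_add, Multiset.sum_cons, Multiset.sum_add, Multiset.card_cons,
      Multiset.card_add, Nat.add_sub_cancel] at hstar
    rw [starProd_merge hle hQ₂ hQ₁,
      show k₂ + 1 + (k₁ + 1 + (m₂.sum + m₁.sum)) = n₁ + n₂ by omega,
      show m₂.card + m₁.card + 1 + 1 = a₁ + a₂ by omega] at hstar
    have hcomm : (k₁ * m₁.prod + (m₁.map (· - 1)).prod) * (k₂ * m₂.prod) +
        k₁ * m₁.prod * (m₂.map (· - 1)).prod =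
        (k₂ * m₂.prod + (m₂.map (· - 1)).prod) * (k₁ * m₁.prod) +
          k₂ * m₂.prod * (m₁.map (· - 1)).prod := by ring
    rw [hcomm] at hstar
    refine ⟨by omega, fun h => ?_⟩
    by_contra hne
    push Not at hne
    have h₁ := hlt₁ hne.1
    have h₂ : k₁ * (m₂.map (· - 1)).prod < k₂ * m₂.prod :=
      (Nat.mul_le_mul_right _ hle).trans_lt
        (Nat.mul_lt_mul_of_pos_left (hlt₂ hne.2) (hk₁.trans hle))
    have := Nat.mul_pos (Nat.sub_pos_of_lt h₂) (Nat.sub_pos_of_lt h₁)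
    omega

/-! ### Positivity of the bound and its agreement with `f(n, a)`. -/

lemma connBound_pos {n a : ℕ} (h : a < n) : 0 < connBound n a :=
  Nat.add_pos_left (balancedProd_pos (by omega)) _

/-- For `2 * a ≤ n` all cliques of `G(n, a)` have order at least 2, so no factor vanishes. For `n =
2 * a` the base `(n - 1) / a - 1` is 0, but its exponent is 0 too. -/
lemma reducedProd_pos {n a : ℕ} (ha : 0 < a) (h : 2 * a ≤ n) : 0 < reducedProd n a := by
  rcases eq_or_lt_of_le h with rfl | h
  · have h1 : (2 * a - 1) / a = 1 := by
      rw [Nat.div_eq_iff ha]; omega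
    have h2 : (2 * a - 1) % a = a - 1 := by
      have := Nat.div_add_mod (2 * a - 1) a
      rw [h1] at this
      omega
    simp [reducedProd, h1, h2]
  · have : 2 ≤ (n - 1) / a := (Nat.le_div_iff_mul_le ha).2 (by omega)
    exact Nat.mul_pos (pow_pos (by omega) _) (pow_pos (by omega) _)

/-- For `n < 2 * a` a one-vertex clique remains besides the chosen largest one, and it contributes
the factor 0. -/
lemma reducedProd_eq_zero {n a : ℕ} (han : a < n) (h : n < 2 * a) : reducedProd n a = 0 := by
  have h1 : (n - 1) / a = 1 := by
    rw [Nat.div_eq_iff (by omega)]; omega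
  have h2 := Nat.div_add_mod (n - 1) a
  rw [h1] at h2
  rw [reducedProd, h1, Nat.sub_self, zero_pow (by omega), zero_mul]

lemma ceil_div_eq {n a : ℕ} (ha : 0 < a) (h : n % a ≠ 0) : ⌈(n : ℚ) / (a : ℚ)⌉₊ = n / a + 1 := by
  have hdm := Nat.div_add_mod n a
  have hlt := Nat.mod_lt n ha
  have ha' : (0 : ℚ) < a := by exact_mod_cast ha
  rw [Nat.ceil_eq_iff (Nat.succ_ne_zero (n / a)), Nat.succ_eq_add_one, Nat.add_sub_cancel, lt_div_iff₀ ha', div_le_iff₀ ha']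
  have h1 : n / a * a < n := by rw [mul_comm]; omega
  have h2 : n ≤ (n / a + 1) * a := by rw [add_mul, mul_comm, one_mul]; omega
  exact ⟨by exact_mod_cast h1, by exact_mod_cast h2⟩

lemma gCount_eq (n a : ℕ) (ha : 0 < a) : gCount n a = balancedProd n a := by
  rw [gCount, balancedProd, Nat.floor_div_eq_div]
  by_cases h : n % a = 0
  · simp [h]
  · rw [ceil_div_eq ha h]

/-- If `a` divides `n`, the exponent `-1` in `fCount` cancels one of the `a` equal factors `n / a -
1`; otherwise the exponent is natural. In both cases one largest clique is left out. -/
lemma fCount_eq (n a : ℕ) (ha : 0 < a) (han : a < n) : fCount n a = connBound n a := by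
  rw [fCount, connBound, gCount_eq _ _ ha, Nat.floor_div_eq_div]
  rw [Nat.cast_add]
  congr 1
  have hdm := Nat.div_add_mod n a
  have hlt := Nat.mod_lt n ha
  by_cases h : n % a = 0
  · rw [h, add_zero] at hdm
    obtain ⟨k, hk⟩ : ∃ k, k = n / a := ⟨_, rfl⟩
    rw [← hk] at hdm
    subst hdm
    obtain ⟨b, rfl⟩ : ∃ b, a = b + 1 := ⟨a - 1, by omega⟩
    obtain ⟨j, rfl⟩ : ∃ j, k = j + 2 := ⟨k - 2, by
      have : ¬ k ≤ 1 := fun hk1 => by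
        have := Nat.mul_le_mul_left (b + 1) hk1
        omega
      omega⟩
    have e : (b + 1) * (j + 2) - 1 = (b + 1) * (j + 1) + b := by
      have : (b + 1) * (j + 2) = (b + 1) * (j + 1) + b + 1 := by ring
      omega
    have h1 : ((b + 1) * (j + 2) - 1) / (b + 1) = j + 1 := by
      rw [e, Nat.mul_add_div ha, Nat.div_eq_of_lt (by omega), add_zero]
    have h2 : ((b + 1) * (j + 2) - 1) % (b + 1) = b := by
      rw [e, Nat.mul_add_mod, Nat.mod_eq_of_lt (by omega)]
    have hb : ((b : ℚ) + 1) ≠ 0 := by positivity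
    have hj : ((j : ℚ) + 1) ≠ 0 := by positivity
    have hc : (((b + 1) * (j + 2) : ℕ) : ℚ) / ((b + 1 : ℕ) : ℚ) = ((j + 2 : ℕ) : ℚ) := by
      push_cast
      field_simp
    rw [h, ← hk, hc, Nat.ceil_natCast, reducedProd, h1, h2]
    simp only [Nat.add_sub_cancel, Nat.sub_self, pow_zero, one_mul, Nat.sub_zero, Nat.cast_add,
      Nat.cast_ofNat, Nat.cast_pow, Nat.cast_zero, Nat.cast_one, zero_sub, zpow_neg_one]
    rw [show (j : ℚ) + 2 - 1 = j + 1 by ring, pow_succ]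
    field_simp
  · rw [ceil_div_eq ha h]
    have hn1 : n - 1 = a * (n / a) + (n % a - 1) := by omega
    have h1 : (n - 1) / a = n / a := by
      rw [hn1, Nat.mul_add_div ha, Nat.div_eq_of_lt (a := n % a - 1) (by omega), add_zero]
    have h2 : (n - 1) % a = n % a - 1 := by
      rw [hn1, Nat.mul_add_mod, Nat.mod_eq_of_lt (by omega)]
    have hk : 1 ≤ n / a := Nat.div_pos han.le ha
    rw [reducedProd, h1, h2, show a - 1 - (n % a - 1) = a - n % a by omega]
    have : ((n % a : ℕ) : ℤ) - 1 = ((n % a - 1 : ℕ) : ℤ) := by omega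
    rw [this, zpow_natCast]
    push_cast [Nat.cast_sub hk]
    ring

set_option linter.unusedSectionVars false

/-! ### Counting independent sets inside a vertex set. -/

section Counting

variable {V : Type*} [DecidableEq V] {G : SimpleGraph V}

open Classical in
/-- The independent sets of `G` with `k` elements that lie in `S`. -/
noncomputable def indepSets (G : SimpleGraph V) (S : Finset V) (k : ℕ) : Finset (Finset V) :=
  {I ∈ S.powersetCard k | G.IsIndepSet (I : Set V)}

/-- The independent sets of `G` with `k` elements that lie in `S` and contain `x`. -/
noncomputable def indepSetsAt (G : SimpleGraph V) (S : Finset V) (k : ℕ) (x : V) :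
    Finset (Finset V) :=
  {I ∈ indepSets G S k | x ∈ I}

/-- The independence number of the subgraph of `G` induced by `S` is at most `a`. -/
def IndepLE (G : SimpleGraph V) (S : Finset V) (a : ℕ) : Prop :=
  ∀ I ⊆ S, G.IsIndepSet (I : Set V) → I.card ≤ a

open Classical in
/-- The vertices of `S` that are neither equal nor adjacent to `x`. -/
noncomputable def far (G : SimpleGraph V) (S : Finset V) (x : V) : Finset V :=
  {v ∈ S | v ≠ x ∧ ¬ G.Adj x v}

open Classical in
/-- The vertices of `S` that are equal or adjacent to `x`. -/
noncomputable def near (G : SimpleGraph V) (S : Finset V) (x : V) : Finset V :=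
  {v ∈ S | v = x ∨ G.Adj x v}

/-- The function `p` colours the vertices in `T` with colours from `s` in such a way that two of
them are adjacent in `G` if and only if they have the same colour. -/
structure CliqueUnion (G : SimpleGraph V) (T : Finset V) (s : Finset ℕ) (p : V → ℕ) : Prop where
  mapsTo : ∀ v ∈ T, p v ∈ s
  adj_iff : ∀ u ∈ T, ∀ v ∈ T, u ≠ v → (G.Adj u v ↔ p u = p v)

variable {S T D E I J : Finset V} {a b k : ℕ} {x y u v w : V}

lemma indep_iff : G.IsIndepSet (I : Set V) ↔ ∀ u ∈ I, ∀ v ∈ I, ¬ G.Adj u v := by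
  constructor
  · intro h u hu v hv huv
    exact h hu hv huv.ne huv
  · intro h u hu v hv _
    exact h u hu v hv

lemma mem_indepSets :
    I ∈ indepSets G S k ↔ I ⊆ S ∧ I.card = k ∧ ∀ u ∈ I, ∀ v ∈ I, ¬ G.Adj u v := by
  simp only [indepSets, Finset.mem_filter, Finset.mem_powersetCard, indep_iff, and_assoc]

lemma mem_indepSetsAt : I ∈ indepSetsAt G S k x ↔ I ∈ indepSets G S k ∧ x ∈ I := by
  simp [indepSetsAt]

lemma mem_far : v ∈ far G S x ↔ v ∈ S ∧ v ≠ x ∧ ¬ G.Adj x v := by simp [far]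

lemma mem_near : v ∈ near G S x ↔ v ∈ S ∧ (v = x ∨ G.Adj x v) := by simp [near]

lemma indepLE_iff :
    IndepLE G S a ↔ ∀ I ⊆ S, (∀ u ∈ I, ∀ v ∈ I, ¬ G.Adj u v) → I.card ≤ a := by
  simp only [IndepLE, indep_iff]

lemma IndepLE.mono (h : IndepLE G S a) (hT : T ⊆ S) : IndepLE G T a :=
  fun I hI => h I (hI.trans hT)

lemma indepSets_mono (h : T ⊆ S) : indepSets G T k ⊆ indepSets G S k := by
  intro I
  simp only [mem_indepSets]
  exact fun hI => ⟨hI.1.trans h, hI.2⟩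

lemma indep_insert (hI : ∀ u ∈ I, ∀ v ∈ I, ¬ G.Adj u v) (hx : ∀ u ∈ I, ¬ G.Adj x u) :
    ∀ u ∈ insert x I, ∀ v ∈ insert x I, ¬ G.Adj u v := by
  simp only [Finset.mem_insert, forall_eq_or_imp]
  exact ⟨⟨G.loopless.irrefl x, hx⟩, fun u hu => ⟨fun h => hx u hu h.symm, hI u hu⟩⟩

lemma indep_union (hI : ∀ u ∈ I, ∀ v ∈ I, ¬ G.Adj u v) (hJ : ∀ u ∈ J, ∀ v ∈ J, ¬ G.Adj u v)
    (hIJ : ∀ u ∈ I, ∀ v ∈ J, ¬ G.Adj u v) : ∀ u ∈ I ∪ J, ∀ v ∈ I ∪ J, ¬ G.Adj u v := by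
  intro u hu v hv
  rcases Finset.mem_union.1 hu with hu | hu <;> rcases Finset.mem_union.1 hv with hv | hv
  · exact hI u hu v hv
  · exact hIJ u hu v hv
  · exact fun h => hIJ v hv u hu h.symm
  · exact hJ u hu v hv

lemma card_indepSets_eq_add (G : SimpleGraph V) (S : Finset V) (k : ℕ) (x : V) :
    (indepSets G S k).card =
      (indepSets G (S.erase x) k).card + (indepSetsAt G S k x).card := by
  rw [indepSetsAt, ← Finset.card_filter_add_card_filter_not (p := fun I => x ∈ I), add_comm]
  congr 2
  ext I
  simp only [Finset.mem_filter, mem_indepSets, Finset.subset_erase]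
  tauto

lemma card_indepSetsAt (hx : x ∈ S) :
    (indepSetsAt G S (k + 1) x).card = (indepSets G (far G S x) k).card := by
  refine Finset.card_nbij' (fun I => I.erase x) (fun I => insert x I) ?_ ?_ ?_ ?_
  · intro I hI
    obtain ⟨hI, hxI⟩ := mem_indepSetsAt.1 hI
    obtain ⟨hIS, hc, hI⟩ := mem_indepSets.1 hI
    refine mem_indepSets.2 ⟨fun v hv => ?_, ?_, fun u hu v hv => ?_⟩
    · obtain ⟨hvx, hv⟩ := Finset.mem_erase.1 hv
      exact mem_far.2 ⟨hIS hv, hvx, hI x hxI v hv⟩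
    · rw [Finset.card_erase_of_mem hxI, hc, Nat.add_sub_cancel]
    · exact hI u (Finset.mem_of_mem_erase hu) v (Finset.mem_of_mem_erase hv)
  · intro I hI
    obtain ⟨hIS, hc, hI⟩ := mem_indepSets.1 hI
    have hxI : x ∉ I := fun h => (mem_far.1 (hIS h)).2.1 rfl
    refine mem_indepSetsAt.2 ⟨mem_indepSets.2 ⟨?_, ?_, ?_⟩, Finset.mem_insert_self _ _⟩
    · exact Finset.insert_subset hx fun v hv => (mem_far.1 (hIS hv)).1
    · rw [Finset.card_insert_of_notMem hxI, hc]
    · exact indep_insert hI fun v hv => (mem_far.1 (hIS hv)).2.2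
  · intro I hI
    exact Finset.insert_erase (mem_indepSetsAt.1 hI).2
  · intro I hI
    have hxI : x ∉ I := fun h => (mem_far.1 ((mem_indepSets.1 hI).1 h)).2.1 rfl
    exact Finset.erase_insert hxI

/-- An independent set of `a + b` vertices has at most `a` of them in `D` and at most `b` in `E`,
hence exactly that many, and the two parts can be chosen independently. -/
lemma card_indepSets_union (hdisj : Disjoint D E) (hDE : ∀ u ∈ D, ∀ v ∈ E, ¬ G.Adj u v)
    (hD : IndepLE G D a) (hE : IndepLE G E b) :
    (indepSets G (D ∪ E) (a + b)).card = (indepSets G D a).card * (indepSets G E b).card := by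
  rw [← Finset.card_product]
  rw [indepLE_iff] at hD hE
  refine Finset.card_nbij' (fun I => (I ∩ D, I ∩ E)) (fun P => P.1 ∪ P.2) ?_ ?_ ?_ ?_
  · intro I hI
    obtain ⟨hIS, hc, hI⟩ := mem_indepSets.1 hI
    have hsub : ∀ F, ∀ u ∈ I ∩ F, ∀ v ∈ I ∩ F, ¬ G.Adj u v := fun F u hu v hv =>
      hI u (Finset.mem_inter.1 hu).1 v (Finset.mem_inter.1 hv).1
    have h1 := hD _ Finset.inter_subset_right (hsub D)
    have h2 := hE _ Finset.inter_subset_right (hsub E)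
    have h3 : (I ∩ D).card + (I ∩ E).card = a + b := by
      rw [← Finset.card_union_of_disjoint
        (hdisj.mono Finset.inter_subset_right Finset.inter_subset_right),
        ← Finset.inter_union_distrib_left, Finset.inter_eq_left.2 hIS, hc]
    exact Finset.mem_product.2
      ⟨mem_indepSets.2 ⟨Finset.inter_subset_right, by dsimp only; omega, hsub D⟩,
        mem_indepSets.2 ⟨Finset.inter_subset_right, by dsimp only; omega, hsub E⟩⟩
  · rintro ⟨I, J⟩ h
    obtain ⟨hI, hJ⟩ := Finset.mem_product.1 h
    obtain ⟨hID, hIc, hI⟩ := mem_indepSets.1 hI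
    obtain ⟨hJE, hJc, hJ⟩ := mem_indepSets.1 hJ
    dsimp only at *
    refine mem_indepSets.2 ⟨Finset.union_subset_union hID hJE, ?_, ?_⟩
    · rw [Finset.card_union_of_disjoint (hdisj.mono hID hJE), hIc, hJc]
    · exact indep_union hI hJ fun u hu v hv => hDE u (hID hu) v (hJE hv)
  · intro I hI
    dsimp only
    rw [← Finset.inter_union_distrib_left, Finset.inter_eq_left.2 (mem_indepSets.1 hI).1]
  · rintro ⟨I, J⟩ h
    obtain ⟨hI, hJ⟩ := Finset.mem_product.1 h
    have hID := (mem_indepSets.1 hI).1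
    have hJE := (mem_indepSets.1 hJ).1
    dsimp only at *
    have h1 := Finset.disjoint_iff_inter_eq_empty.1 (hdisj.mono_left hID)
    have h2 := Finset.disjoint_iff_inter_eq_empty.1 (hdisj.symm.mono_left hJE)
    rw [Finset.union_inter_distrib_right, Finset.union_inter_distrib_right,
      Finset.inter_eq_left.2 hID, Finset.inter_eq_left.2 hJE, h1, h2]
    simp

lemma card_indepSets_one (G : SimpleGraph V) (S : Finset V) : (indepSets G S 1).card = S.card := by
  have : indepSets G S 1 = S.powersetCard 1 := by
    ext I
    rw [mem_indepSets, Finset.mem_powersetCard, ← and_assoc, and_iff_left_iff_imp]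
    rintro ⟨-, h⟩
    obtain ⟨x, rfl⟩ := Finset.card_eq_one.1 h
    simp
  simp [this]

lemma indepLE_one (h : ∀ u ∈ S, ∀ v ∈ S, u ≠ v → G.Adj u v) : IndepLE G S 1 := by
  rw [indepLE_iff]
  intro I hI hind
  rw [Finset.card_le_one]
  intro u hu v hv
  by_contra huv
  exact hind u hu v hv (h u (hI hu) v (hI hv) huv)

lemma adj_of_indepLE_one (h : IndepLE G S 1) (hu : u ∈ S) (hv : v ∈ S) (huv : u ≠ v) :
    G.Adj u v := by
  rw [indepLE_iff] at h
  by_contra hadj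
  have := h {u, v} (by simp [Finset.insert_subset_iff, hu, hv])
    (indep_insert (by simp) (by simpa using hadj))
  rw [Finset.card_pair huv] at this
  omega

lemma CliqueUnion.mono {s : Finset ℕ} {p : V → ℕ} (h : CliqueUnion G S s p) (hT : T ⊆ S) :
    CliqueUnion G T s p :=
  ⟨fun v hv => h.mapsTo v (hT hv), fun u hu v hv => h.adj_iff u (hT hu) v (hT hv)⟩

lemma CliqueUnion.injOn {s : Finset ℕ} {p : V → ℕ} (h : CliqueUnion G S s p) (hI : I ⊆ S)
    (hind : ∀ u ∈ I, ∀ v ∈ I, ¬ G.Adj u v) : Set.InjOn p I := by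
  intro u hu v hv huv
  by_contra hne
  exact hind u hu v hv ((h.adj_iff u (hI hu) v (hI hv) hne).2 huv)

lemma CliqueUnion.indepLE {s : Finset ℕ} {p : V → ℕ} (h : CliqueUnion G S s p) :
    IndepLE G S s.card := by
  rw [indepLE_iff]
  intro I hI hind
  exact Finset.card_le_card_of_injOn p (fun v hv => h.mapsTo v (hI hv)) (h.injOn hI hind)

/-- An independent set of `s.card` vertices picks exactly one vertex of each colour; the induction
splits off one colour class. -/
lemma CliqueUnion.card_indepSets {s : Finset ℕ} {p : V → ℕ} (h : CliqueUnion G S s p) :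
    (indepSets G S s.card).card = ∏ i ∈ s, (S.filter (p · = i)).card := by
  induction s using Finset.induction_on generalizing S with
  | empty =>
    have hS : S = ∅ := Finset.eq_empty_of_forall_notMem fun v hv => by simpa using h.mapsTo v hv
    have : indepSets G S 0 = {∅} := by
      ext I
      rw [mem_indepSets, Finset.mem_singleton]
      constructor
      · exact fun hI => Finset.card_eq_zero.1 hI.2.1
      · rintro rfl
        simp
    simp [this]
  | insert i s hi ih =>
    have h1 : CliqueUnion G (S.filter (p · ≠ i)) s p := by
      refine ⟨fun v hv => ?_, (h.mono (Finset.filter_subset _ _)).adj_iff⟩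
      obtain ⟨hv, hne⟩ := Finset.mem_filter.1 hv
      exact (Finset.mem_insert.1 (h.mapsTo v hv)).resolve_left hne
    have h2 : IndepLE G (S.filter (p · = i)) 1 := by
      refine indepLE_one fun u hu v hv huv => ?_
      rw [Finset.mem_filter] at hu hv
      exact (h.adj_iff u hu.1 v hv.1 huv).2 (hu.2.trans hv.2.symm)
    have h3 : ∀ u ∈ S.filter (p · = i), ∀ v ∈ S.filter (p · ≠ i), ¬ G.Adj u v := by
      intro u hu v hv huv
      rw [Finset.mem_filter] at hu hv
      exact hv.2 (((h.adj_iff u hu.1 v hv.1 huv.ne).1 huv).symm.trans hu.2)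
    have h4 := card_indepSets_union (Finset.disjoint_filter_filter_not S S (p · = i)) h3 h2
      h1.indepLE
    rw [Finset.filter_union_filter_not_eq] at h4
    rw [Finset.card_insert_of_notMem hi, add_comm, h4, ih h1, card_indepSets_one,
      Finset.prod_insert hi]
    congr 1
    refine Finset.prod_congr rfl fun j hj => ?_
    rw [Finset.filter_filter]
    congr 1
    refine Finset.filter_congr fun v _ => ?_
    constructor
    · exact fun h => h.2
    · rintro rfl
      exact ⟨fun h => hi (h ▸ hj), rfl⟩

lemma CliqueUnion.sum_card {s : Finset ℕ} {p : V → ℕ} (h : CliqueUnion G S s p) :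
    ∑ i ∈ s, (S.filter (p · = i)).card = S.card :=
  (Finset.card_eq_sum_card_fiberwise h.mapsTo).symm

lemma CliqueUnion.card_eq_of_card_eq {s : Finset ℕ} {p : V → ℕ} (h : CliqueUnion G S s p)
    (hs : s.card ≤ S.card)
    (hcard : (indepSets G S s.card).card = balancedProd S.card s.card) {i j : ℕ} (hi : i ∈ s)
    (hj : j ∈ s) : (S.filter (p · = i)).card ≤ (S.filter (p · = j)).card + 1 := by
  have hm : (s.val.map fun i => (S.filter (p · = i)).card).sum = S.card := h.sum_card
  refine le_add_one_of_prod_eq (m := s.val.map fun i => (S.filter (p · = i)).card) ?_ ?_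
    (Multiset.mem_map_of_mem _ hi) (Multiset.mem_map_of_mem _ hj)
  · rw [hm, Multiset.card_map]
    exact h.card_indepSets.symm.trans hcard
  · rw [hm, Multiset.card_map]
    exact hs

end Counting

/-! ### Zykov's theorem and its extremal graphs. -/

/-- Enlarge one factor by 1 and rebalance. The strictness shows that no vertex is superfluous in an
extremal graph of Zykov's theorem. -/
lemma balancedProd_lt_succ {n a : ℕ} (ha : 0 < a) (h : a ≤ n + 1) :
    balancedProd n a < balancedProd (n + 1) a := by
  rcases Nat.lt_or_ge n a with hlt | hle
  · have : balancedProd n a = 0 := by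
      rw [balancedProd, Nat.div_eq_of_lt hlt, Nat.mod_eq_of_lt hlt, zero_pow (by omega), zero_mul]
    rw [this]
    exact balancedProd_pos h
  · obtain ⟨m, rfl, rfl, hm⟩ := exists_eq_balancedProd (n := n) ha
    have hpos := balancedProd_pos hle
    rw [← hm] at hpos ⊢
    obtain ⟨x, hx⟩ := Multiset.card_pos_iff_exists_mem.1 ha
    obtain ⟨m, rfl⟩ := Multiset.exists_cons_of_mem hx
    have := prod_le_balancedProd ((x + 1) ::ₘ m)
    simp only [Multiset.prod_cons, Multiset.sum_cons, Multiset.card_cons] at this hpos ⊢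
    rw [show x + m.sum + 1 = x + 1 + m.sum by ring]
    refine lt_of_lt_of_le ?_ this
    exact Nat.mul_lt_mul_of_pos_right (Nat.lt_succ_self x) (Nat.pos_of_mul_pos_left hpos)

section Zykov

variable {V : Type*} [DecidableEq V] {G : SimpleGraph V}
variable {S T D E I J : Finset V} {a b k : ℕ} {x y u v w : V}

lemma near_union_far : near G S x ∪ far G S x = S := by
  ext v
  simp only [Finset.mem_union, mem_near, mem_far]
  tauto

lemma disjoint_near_far : Disjoint (near G S x) (far G S x) := by
  rw [Finset.disjoint_left]
  intro v h1 h2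
  rw [mem_near] at h1
  rw [mem_far] at h2
  tauto

lemma card_near_add_card_far (G : SimpleGraph V) (S : Finset V) (x : V) :
    (near G S x).card + (far G S x).card = S.card := by
  rw [← Finset.card_union_of_disjoint disjoint_near_far, near_union_far]

lemma IndepLE.far (h : IndepLE G S (a + 1)) (hx : x ∈ S) : IndepLE G (far G S x) a := by
  rw [indepLE_iff] at *
  intro I hI hind
  have hxI : x ∉ I := fun h => (mem_far.1 (hI h)).2.1 rfl
  have := h (insert x I) (Finset.insert_subset hx fun v hv => (mem_far.1 (hI hv)).1)
    (indep_insert hind fun v hv => (mem_far.1 (hI hv)).2.2)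
  rw [Finset.card_insert_of_notMem hxI] at this
  omega

lemma IndepLE.eq_empty (h : IndepLE G S 0) : S = ∅ := by
  rw [indepLE_iff] at h
  refine Finset.eq_empty_of_forall_notMem fun v hv => ?_
  have := h {v} (by simpa using hv) (by simp)
  simp at this

/-- Every maximum independent set meets every closed neighbourhood. -/
lemma IndepLE.inter_near_nonempty (h : IndepLE G S a) (hx : x ∈ S) (hI : I ∈ indepSets G S a) :
    ((near G S x).filter (· ∈ I)).Nonempty := by
  obtain ⟨hIS, hc, hind⟩ := mem_indepSets.1 hI
  rw [indepLE_iff] at h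
  by_contra hne
  rw [Finset.not_nonempty_iff_eq_empty, Finset.filter_eq_empty_iff] at hne
  have hxI : x ∉ I := hne (mem_near.2 ⟨hx, Or.inl rfl⟩)
  have := h (insert x I) (Finset.insert_subset hx hIS) (indep_insert hind fun v hv hxv =>
    hne (mem_near.2 ⟨hIS hv, Or.inr hxv⟩) hv)
  rw [Finset.card_insert_of_notMem hxI] at this
  omega

lemma sum_card_filter_mem (G : SimpleGraph V) (S T : Finset V) (a : ℕ) :
    ∑ I ∈ indepSets G S a, (T.filter (· ∈ I)).card = ∑ y ∈ T, (indepSetsAt G S a y).card :=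
  Finset.sum_card_bipartiteAbove_eq_sum_card_bipartiteBelow (fun I y => y ∈ I)

/-- For a vertex in the largest number of maximum independent sets, the usual estimate, together
with the consequences of equality. -/
lemma zykov_step (h : IndepLE G S (a + 1)) (hx : x ∈ S)
    (hmax : ∀ y ∈ S, (indepSetsAt G S (a + 1) y).card ≤ (indepSetsAt G S (a + 1) x).card) :
    (indepSets G S (a + 1)).card ≤ (near G S x).card * (indepSets G (far G S x) a).card ∧
      ((indepSets G S (a + 1)).card = (near G S x).card * (indepSets G (far G S x) a).card →
        (∀ I ∈ indepSets G S (a + 1), ((near G S x).filter (· ∈ I)).card = 1) ∧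
        ∀ y ∈ near G S x,
          (indepSetsAt G S (a + 1) y).card = (indepSets G (far G S x) a).card) := by
  -- Double counting of the pairs `(I, y)` with `y` in `I` and in the closed neighbourhood of `x`:
  -- every `I` has such a `y`, and every `y` lies in at most as many sets as `x`.
  have h1 : ∀ I ∈ indepSets G S (a + 1), 1 ≤ ((near G S x).filter (· ∈ I)).card :=
    fun I hI => (h.inter_near_nonempty hx hI).card_pos
  have h2 := Finset.sum_le_sum h1
  have h3 : ∀ y ∈ near G S x,
      (indepSetsAt G S (a + 1) y).card ≤ (indepSets G (far G S x) a).card := fun y hy =>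
    card_indepSetsAt (G := G) (k := a) hx ▸ hmax y (mem_near.1 hy).1
  have h4 := Finset.sum_le_sum h3
  rw [Finset.sum_const, smul_eq_mul] at h4
  rw [sum_card_filter_mem, Finset.sum_const, smul_eq_mul, mul_one] at h2
  refine ⟨h2.trans h4, fun heq => ⟨?_, ?_⟩⟩
  · have : ∑ I ∈ indepSets G S (a + 1), 1 =
        ∑ I ∈ indepSets G S (a + 1), ((near G S x).filter (· ∈ I)).card := by
      rw [sum_card_filter_mem, Finset.sum_const, smul_eq_mul, mul_one]
      omega
    exact fun I hI => ((Finset.sum_eq_sum_iff_of_le h1).1 this I hI).symm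
  · refine (Finset.sum_eq_sum_iff_of_le h3).1 ?_
    rw [Finset.sum_const, smul_eq_mul]
    omega

/-- Zykov's theorem. -/
theorem card_indepSets_le (h : IndepLE G S a) :
    (indepSets G S a).card ≤ balancedProd S.card a := by
  induction a generalizing S with
  | zero =>
    have : indepSets G S 0 ⊆ {∅} := fun I hI =>
      Finset.mem_singleton.2 (Finset.card_eq_zero.1 (mem_indepSets.1 hI).2.1)
    have := Finset.card_le_card this
    simpa [h.eq_empty, balancedProd] using this
  | succ a ih =>
    rcases S.eq_empty_or_nonempty with rfl | hne
    · have : indepSets G ∅ (a + 1) = ∅ := by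
        refine Finset.eq_empty_of_forall_notMem fun I hI => ?_
        obtain ⟨h1, h2, -⟩ := mem_indepSets.1 hI
        rw [Finset.subset_empty.1 h1] at h2
        simp at h2
      simp [this]
    · obtain ⟨x, hx, hmax⟩ := S.exists_max_image (fun y => (indepSetsAt G S (a + 1) y).card) hne
      refine (zykov_step h hx hmax).1.trans ?_
      refine (Nat.mul_le_mul_left _ (ih (h.far hx))).trans ?_
      rw [← card_near_add_card_far G S x]
      refine mul_balancedProd_le _ _ _ ?_
      rcases Nat.eq_zero_or_pos a with rfl | ha
      · exact Or.inr (by rw [(h.far hx).eq_empty]; rfl)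
      · exact Or.inl ha

/-- Otherwise deleting `w` would keep the count, against Zykov's bound for one vertex fewer, which
is strictly smaller. -/
lemma card_indepSetsAt_pos (h : IndepLE G S a) (ha : a ≤ S.card)
    (heq : (indepSets G S a).card = balancedProd S.card a) (hw : w ∈ S) :
    0 < (indepSetsAt G S a w).card := by
  have h1 := card_indepSets_eq_add G S a w
  have h2 := card_indepSets_le (h.mono (Finset.erase_subset w S))
  have hcard := Finset.card_erase_add_one hw
  have ha0 : 0 < a := by
    rcases Nat.eq_zero_or_pos a with rfl | h0
    · rw [h.eq_empty] at hw
      simp at hw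
    · exact h0
  have h3 := balancedProd_lt_succ (n := (S.erase w).card) ha0 (by omega)
  rw [hcard] at h3
  omega

/-- The extremal graphs in Zykov's theorem are disjoint unions of cliques. -/
theorem exists_cliqueUnion (h : IndepLE G S a) (ha : a ≤ S.card)
    (heq : (indepSets G S a).card = balancedProd S.card a) :
    ∃ p, CliqueUnion G S (Finset.range a) p := by
  induction a generalizing S with
  | zero =>
    have := h.eq_empty
    subst this
    exact ⟨fun _ => 0, by simp, by simp⟩
  | succ a ih =>
    have hne : S.Nonempty := Finset.card_pos.1 (by omega)
    obtain ⟨x, hx, hmax⟩ := S.exists_max_image (fun y => (indepSetsAt G S (a + 1) y).card) hne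
    obtain ⟨h1, h2⟩ := zykov_step h hx hmax
    have h3 := Nat.mul_le_mul_left (near G S x).card (card_indepSets_le (h.far hx))
    have h4 : (near G S x).card * balancedProd (far G S x).card a ≤
        balancedProd S.card (a + 1) := by
      rw [← card_near_add_card_far G S x]
      refine mul_balancedProd_le _ _ _ ?_
      rcases Nat.eq_zero_or_pos a with rfl | ha
      · exact Or.inr (by rw [(h.far hx).eq_empty]; rfl)
      · exact Or.inl ha
    have hnear : 0 < (near G S x).card := Finset.card_pos.2 ⟨x, mem_near.2 ⟨hx, Or.inl rfl⟩⟩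
    have hfar : (indepSets G (far G S x) a).card = balancedProd (far G S x).card a :=
      Nat.eq_of_mul_eq_mul_left hnear (by omega)
    have hfar_pos : 0 < (indepSets G (far G S x) a).card := by
      rw [← card_indepSetsAt hx]
      exact card_indepSetsAt_pos h ha heq hx
    obtain ⟨J, hJ⟩ := Finset.card_pos.1 hfar_pos
    obtain ⟨hJfar, hJc, hJ⟩ := mem_indepSets.1 hJ
    have ha' : a ≤ (far G S x).card := hJc ▸ Finset.card_le_card hJfar
    obtain ⟨hone, hall⟩ := h2 (by omega)
    obtain ⟨p, hp⟩ := ih (h.far hx) ha' hfar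
    -- A set through `y` meets the closed neighbourhood of `x` only in `y`. If `y` had a far
    -- neighbour `w`, removing `y` would embed the sets through `y` into those sets of the far part
    -- that miss `w`; these are too few, since some set of the far part contains `w`.
    have hsep : ∀ y ∈ near G S x, ∀ w ∈ far G S x, ¬ G.Adj y w := by
      intro y hy w hw hyw
      have hle : (indepSetsAt G S (a + 1) y).card ≤
          (indepSets G ((far G S x).erase w) a).card := by
        refine Finset.card_le_card_of_injOn (fun I => I.erase y) ?_ ?_
        · intro I hI
          obtain ⟨hI, hyI⟩ := mem_indepSetsAt.1 hI
          obtain ⟨hIS, hc, hind⟩ := mem_indepSets.1 hI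
          obtain ⟨z, hz⟩ := Finset.card_eq_one.1 (hone I hI)
          have huniq : ∀ v ∈ near G S x, v ∈ I → v = y := by
            intro v hv hvI
            have hv' : v ∈ (near G S x).filter (· ∈ I) := Finset.mem_filter.2 ⟨hv, hvI⟩
            have hy' : y ∈ (near G S x).filter (· ∈ I) := Finset.mem_filter.2 ⟨hy, hyI⟩
            rw [hz, Finset.mem_singleton] at hv' hy'
            rw [hv', hy']
          refine mem_indepSets.2 ⟨fun v hv => ?_, ?_, fun u hu v hv => ?_⟩
          · obtain ⟨hvy, hvI⟩ := Finset.mem_erase.1 hv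
            refine Finset.mem_erase.2 ⟨?_, ?_⟩
            · rintro rfl
              exact hind y hyI v hvI hyw
            · have := hIS hvI
              rw [← near_union_far (G := G) (S := S) (x := x), Finset.mem_union] at this
              exact this.resolve_left fun h => hvy (huniq v h hvI)
          · rw [Finset.card_erase_of_mem hyI, hc, Nat.add_sub_cancel]
          · exact hind u (Finset.mem_of_mem_erase hu) v (Finset.mem_of_mem_erase hv)
        · intro I hI I' hI' hII'
          have e1 := Finset.insert_erase (mem_indepSetsAt.1 hI).2
          have e2 := Finset.insert_erase (mem_indepSetsAt.1 hI').2
          dsimp only at hII'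
          rw [← e1, hII', e2]
      have hpos := card_indepSetsAt_pos (h.far hx) ha' hfar hw
      have hsplit := card_indepSets_eq_add G (far G S x) a w
      have := hall y hy
      omega
    -- Two nonadjacent near vertices would extend `J` to an independent set with `a + 2` vertices.
    have hclique : ∀ y ∈ near G S x, ∀ z ∈ near G S x, y ≠ z → G.Adj y z := by
      intro y hy z hz hyz
      by_contra hadj
      rw [indepLE_iff] at h
      have hnot : ∀ v ∈ near G S x, v ∉ J := fun v hv hvJ =>
        Finset.disjoint_left.1 disjoint_near_far hv (hJfar hvJ)
      have hzJ : z ∉ J := hnot z hz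
      have hyJ : y ∉ insert z J := by
        rw [Finset.mem_insert, not_or]
        exact ⟨hyz, hnot y hy⟩
      have := h (insert y (insert z J))
        (Finset.insert_subset (mem_near.1 hy).1 (Finset.insert_subset (mem_near.1 hz).1
          fun v hv => (mem_far.1 (hJfar hv)).1))
        (indep_insert (indep_insert hJ fun v hv => hsep z hz v (hJfar hv)) (by
          intro v hv
          rcases Finset.mem_insert.1 hv with rfl | hv
          · exact hadj
          · exact hsep y hy v (hJfar hv)))
      rw [Finset.card_insert_of_notMem hyJ, Finset.card_insert_of_notMem hzJ] at this
      omega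
    classical
    have hcases : ∀ v ∈ S, v ∈ near G S x ∨ v ∉ near G S x ∧ v ∈ far G S x := by
      intro v hv
      by_cases h : v ∈ near G S x
      · exact Or.inl h
      · rw [← near_union_far (G := G) (S := S) (x := x), Finset.mem_union] at hv
        exact Or.inr ⟨h, hv.resolve_left h⟩
    have hpa : ∀ v ∈ far G S x, p v ≠ a := fun v hv =>
      (Finset.mem_range.1 (hp.mapsTo v hv)).ne
    refine ⟨fun v => if v ∈ near G S x then a else p v, ?_, ?_⟩
    · intro v hv
      rcases hcases v hv with h1 | ⟨h1, h2⟩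
      · simp [h1]
      · have := Finset.mem_range.1 (hp.mapsTo v h2)
        simp only [h1, if_false, Finset.mem_range]
        omega
    · intro u hu v hv huv
      rcases hcases u hu with h1 | ⟨h1, h2⟩ <;> rcases hcases v hv with h3 | ⟨h3, h4⟩
      · simp [h1, h3, hclique u h1 v h3 huv]
      · simp [h1, h3, hsep u h1 v h4, (hpa v h4).symm]
      · simp only [h1, h3, if_false, if_true, hpa u h2, iff_false]
        exact fun h => hsep v h3 u h2 h.symm
      · simp [h1, h3, hp.adj_iff u h2 v h4 huv]

end Zykov

/-! ### Splitting at a cut vertex. -/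

section CutVertex

variable {V : Type*} [DecidableEq V] {G : SimpleGraph V}
variable {S T D E I J K : Finset V} {a b c k : ℕ} {x y u v w : V}

/-- The subgraph of `G` induced by `S` is connected: every nonempty proper part of `S` is left by
some edge. -/
def Conn (G : SimpleGraph V) (S : Finset V) : Prop :=
  ∀ T ⊆ S, T.Nonempty → T ≠ S → ∃ u ∈ T, ∃ v ∈ S, v ∉ T ∧ G.Adj u v

/-- Deleting some vertex of `S` leaves a disjoint union of `a` nonempty cliques. -/
def HasCentre (G : SimpleGraph V) (S : Finset V) (a : ℕ) : Prop :=
  ∃ w ∈ S, 0 < (indepSets G (S.erase w) a).card ∧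
    ∃ p, CliqueUnion G (S.erase w) (Finset.range a) p

lemma Conn.exists_adj (h : Conn G S) (hS : 1 < S.card) (hx : x ∈ S) : ∃ y ∈ S, G.Adj x y := by
  obtain ⟨u, hu, v, hv, -, huv⟩ := h {x} (by simpa using hx) (by simp) (by
    rintro rfl
    simp at hS)
  rw [Finset.mem_singleton] at hu
  exact ⟨v, hv, hu ▸ huv⟩

/-- Deleting `w` loses nothing, and Zykov's bound for the remaining vertices is the first summand of
`connBound`. Equality makes `S.erase w` extremal for Zykov's theorem, hence a union of cliques. -/
lemma card_le_connBound_of_card_indepSetsAt_eq_zero (h : IndepLE G S a) (haS : a < S.card)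
    (hw : w ∈ S) (h0 : (indepSetsAt G S a w).card = 0) :
    (indepSets G S a).card ≤ connBound S.card a ∧
      ((indepSets G S a).card = connBound S.card a → HasCentre G S a) := by
  have h1 := card_indepSets_eq_add G S a w
  have h2 := card_indepSets_le (h.mono (Finset.erase_subset w S))
  rw [Finset.card_erase_of_mem hw] at h2
  have h3 : connBound S.card a = balancedProd (S.card - 1) a + reducedProd S.card a := rfl
  refine ⟨by omega, fun heq => ⟨w, hw, ?_, ?_⟩⟩
  · have := balancedProd_pos (n := S.card - 1) (a := a) (by omega)
    omega
  · refine exists_cliqueUnion (h.mono (Finset.erase_subset w S)) ?_ ?_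
    · rw [Finset.card_erase_of_mem hw]
      omega
    · rw [Finset.card_erase_of_mem hw]
      omega

lemma CliqueUnion.exists_union {p : V → ℕ} (h : CliqueUnion G T (Finset.range b) p)
    (hK : ∀ u ∈ K, ∀ v ∈ K, u ≠ v → G.Adj u v) (hTK : ∀ u ∈ T, ∀ v ∈ K, ¬ G.Adj u v)
    (hdisj : Disjoint T K) :
    ∃ p, CliqueUnion G (T ∪ K) (Finset.range (b + 1)) p := by
  have hT : ∀ v ∈ T, v ∉ K := fun v hv => Finset.disjoint_left.1 hdisj hv
  have hpb : ∀ v ∈ T, p v ≠ b := fun v hv => (Finset.mem_range.1 (h.mapsTo v hv)).ne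
  refine ⟨fun v => if v ∈ K then b else p v, ?_, ?_⟩
  · intro v hv
    rcases Finset.mem_union.1 hv with hv | hv
    · have := Finset.mem_range.1 (h.mapsTo v hv)
      simp only [hT v hv, if_false, Finset.mem_range]
      omega
    · simp [hv]
  · intro u hu v hv huv
    rcases Finset.mem_union.1 hu with hu | hu <;> rcases Finset.mem_union.1 hv with hv | hv
    · simp [hT u hu, hT v hv, h.adj_iff u hu v hv huv]
    · simp [hT u hu, hv, hTK u hu v hv, hpb u hu]
    · simp only [hu, hT v hv, if_true, if_false, (hpb v hv).symm, iff_false]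
      exact fun h => hTK v hv u hu h.symm
    · simp [hu, hv, hK u hu v hv huv]

/-- A vertex set `S` is split by a cut vertex `y` into a part `D` and the rest `insert y E`. -/
structure CutSplit (G : SimpleGraph V) (S : Finset V) (a : ℕ) (y : V) (D E : Finset V)
    (b c : ℕ) : Prop where
  union : D ∪ E = S.erase y
  disj : Disjoint D E
  sep : ∀ u ∈ D, ∀ v ∈ E, ¬ G.Adj u v
  nonempty : D.Nonempty
  conn : Conn G D
  left : IndepLE G D b
  right : IndepLE G (insert y E) c
  add : b + c = a
  left_le : b ≤ D.card
  right_le : c ≤ E.card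
  left_pos : 1 ≤ b
  right_pos : 1 ≤ c

lemma card_inter_add_card_sdiff_inter {R : Finset V} (hT : T ⊆ R) (I : Finset V) :
    (I ∩ T).card + (I ∩ (R \ T)).card = (I ∩ R).card := by
  rw [← Finset.card_union_of_disjoint
    (Finset.disjoint_sdiff.mono Finset.inter_subset_right Finset.inter_subset_right),
    ← Finset.inter_union_distrib_left, Finset.union_sdiff_of_subset hT]

/-- Let `I` be a maximum independent set through `y` and `J` one through a neighbour of `y`, so that
`J` avoids `y`. On every union of components of `S.erase y` the set `J` is as large as possible, and
outside `y` the set `I` has exactly one vertex fewer than `J`. So whenever `S.erase y` is separated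
into two sides, `I` and `J` have equally many vertices on one of them. A smallest nonempty side of
this kind is `D`. The rest together with `y` has independence number at most `c`, because `I ∩ D`
can be added to any independent set through `y` in it. -/
lemma exists_cutSplit (hconn : Conn G S) (h : IndepLE G S a)
    (haS : a < S.card) (hpos : ∀ v ∈ S, 0 < (indepSetsAt G S a v).card) (hy : y ∈ S)
    (hcut : ¬ Conn G (S.erase y)) : ∃ D E b c, CutSplit G S a y D E b c := by
  classical
  obtain ⟨I, hyI, hIS, hIc, hI⟩ : ∃ I, y ∈ I ∧ I ⊆ S ∧ I.card = a ∧
      ∀ u ∈ I, ∀ v ∈ I, ¬ G.Adj u v := by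
    obtain ⟨I, hI⟩ := Finset.card_pos.1 (hpos y hy)
    obtain ⟨hI, hyI⟩ := mem_indepSetsAt.1 hI
    exact ⟨I, hyI, mem_indepSets.1 hI⟩
  have hapos : 0 < a := hIc ▸ Finset.card_pos.2 ⟨y, hyI⟩
  obtain ⟨x, hx, hyx⟩ := hconn.exists_adj (by omega) hy
  obtain ⟨J, hJ⟩ := Finset.card_pos.1 (hpos x hx)
  obtain ⟨hJ, hxJ⟩ := mem_indepSetsAt.1 hJ
  obtain ⟨hJS, hJc, hJ⟩ := mem_indepSets.1 hJ
  have hyJ : y ∉ J := fun hyJ => hJ y hyJ x hxJ hyx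
  set R := S.erase y with hR
  have hJR : J ∩ R = J := by
    rw [Finset.inter_eq_left, hR]
    exact fun v hv => Finset.mem_erase.2 ⟨fun hvy => hyJ (hvy ▸ hv), hJS hv⟩
  have hIR : (I ∩ R).card + 1 = a := by
    have : I ∩ R = I.erase y := by
      ext v
      simp only [hR, Finset.mem_inter, Finset.mem_erase]
      exact ⟨fun h => ⟨h.2.1, h.1⟩, fun h => ⟨h.2, h.1, hIS h.2⟩⟩
    rw [this, Finset.card_erase_add_one hyI, hIc]
  rw [indepLE_iff] at h
  -- Exchange argument: replacing `J ∩ T` by `X` inside `J` keeps independence, because no edge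
  -- leaves `T` within `R`.
  have hmax : ∀ T ⊆ R, (∀ u ∈ T, ∀ v ∈ R \ T, ¬ G.Adj u v) → ∀ X ⊆ T,
      (∀ u ∈ X, ∀ v ∈ X, ¬ G.Adj u v) → X.card ≤ (J ∩ T).card := by
    intro T hT hsep X hX hXind
    have h1 := card_inter_add_card_sdiff_inter hT J
    rw [hJR, hJc] at h1
    have h2 := h (X ∪ J ∩ (R \ T))
      (Finset.union_subset ((hX.trans hT).trans (Finset.erase_subset _ _))
        (Finset.inter_subset_left.trans hJS))
      (indep_union hXind
        (fun u hu v hv => hJ u (Finset.mem_inter.1 hu).1 v (Finset.mem_inter.1 hv).1)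
        fun u hu v hv => hsep u (hX hu) v (Finset.mem_inter.1 hv).2)
    rw [Finset.card_union_of_disjoint
      (Finset.disjoint_sdiff.mono hX Finset.inter_subset_right)] at h2
    omega
  have hIT : ∀ T : Finset V, ∀ u ∈ I ∩ T, ∀ v ∈ I ∩ T, ¬ G.Adj u v := fun T u hu v hv =>
    hI u (Finset.mem_inter.1 hu).1 v (Finset.mem_inter.1 hv).1
  have hcompl : ∀ T ⊆ R, (∀ u ∈ T, ∀ v ∈ R \ T, ¬ G.Adj u v) →
      ∀ u ∈ R \ T, ∀ v ∈ R \ (R \ T), ¬ G.Adj u v := by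
    intro T hT hsep u hu v hv huv
    rw [Finset.sdiff_sdiff_eq_self hT] at hv
    exact hsep v hv u hu huv.symm
  -- the candidates for the part `D`
  set C := R.powerset.filter fun T => T.Nonempty ∧ (∀ u ∈ T, ∀ v ∈ R \ T, ¬ G.Adj u v) ∧
    (I ∩ T).card = (J ∩ T).card with hC
  have hCne : C.Nonempty := by
    rw [Conn] at hcut
    push Not at hcut
    obtain ⟨T, hT, hTne, hTR, hsep⟩ := hcut
    have hsep' : ∀ u ∈ T, ∀ v ∈ R \ T, ¬ G.Adj u v := fun u hu v hv =>
      hsep u hu v (Finset.mem_sdiff.1 hv).1 (Finset.mem_sdiff.1 hv).2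
    have h1 := hmax T hT hsep' _ Finset.inter_subset_right (hIT T)
    have h2 := hmax (R \ T) Finset.sdiff_subset (hcompl T hT hsep') _ Finset.inter_subset_right
      (hIT (R \ T))
    have h3 := card_inter_add_card_sdiff_inter hT I
    have h4 := card_inter_add_card_sdiff_inter hT J
    rw [hJR, hJc] at h4
    by_cases heq : (I ∩ T).card = (J ∩ T).card
    · exact ⟨T, Finset.mem_filter.2 ⟨Finset.mem_powerset.2 hT, hTne, hsep', heq⟩⟩
    · refine ⟨R \ T, Finset.mem_filter.2 ⟨Finset.mem_powerset.2 Finset.sdiff_subset, ?_,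
        hcompl T hT hsep', by omega⟩⟩
      rw [Finset.sdiff_nonempty]
      exact fun h => hTR (hT.antisymm h)
  obtain ⟨D, hD, hDmin⟩ := C.exists_min_image Finset.card hCne
  obtain ⟨hDR, hDne, hDsep, hDeq⟩ := Finset.mem_filter.1 hD
  rw [Finset.mem_powerset] at hDR
  have hDI := card_inter_add_card_sdiff_inter hDR I
  have hDJ := card_inter_add_card_sdiff_inter hDR J
  rw [hJR, hJc] at hDJ
  have hDleft : IndepLE G D (J ∩ D).card := indepLE_iff.2 (hmax D hDR hDsep)
  refine ⟨D, R \ D, (J ∩ D).card, (J ∩ (R \ D)).card, Finset.union_sdiff_of_subset hDR,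
    Finset.disjoint_sdiff, hDsep, hDne, ?_, hDleft, ?_, hDJ,
    Finset.card_le_card Finset.inter_subset_right,
    Finset.card_le_card Finset.inter_subset_right, ?_, by omega⟩
  -- A separation of `D` would give a smaller candidate: the deficits of `I` against `J` on its two
  -- sides are nonnegative and add up to 0.
  · intro T hT hTne hTD
    by_contra hno
    push Not at hno
    have hTsep : ∀ u ∈ T, ∀ v ∈ R \ T, ¬ G.Adj u v := by
      intro u hu v hv
      obtain ⟨hvR, hvT⟩ := Finset.mem_sdiff.1 hv
      by_cases hvD : v ∈ D
      · exact hno u hu v hvD hvT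
      · exact hDsep u (hT hu) v (Finset.mem_sdiff.2 ⟨hvR, hvD⟩)
    have hDTsep : ∀ u ∈ D \ T, ∀ v ∈ R \ (D \ T), ¬ G.Adj u v := by
      intro u hu v hv huv
      obtain ⟨hvR, hvT⟩ := Finset.mem_sdiff.1 hv
      obtain ⟨huD, huT⟩ := Finset.mem_sdiff.1 hu
      by_cases hvD : v ∈ D
      · by_cases hvT' : v ∈ T
        · exact hno v hvT' u huD huT huv.symm
        · exact hvT (Finset.mem_sdiff.2 ⟨hvD, hvT'⟩)
      · exact hDsep u huD v (Finset.mem_sdiff.2 ⟨hvR, hvD⟩) huv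
    have h1 := hmax T (hT.trans hDR) hTsep _ Finset.inter_subset_right (hIT T)
    have h2 := hmax (D \ T) (Finset.sdiff_subset.trans hDR) hDTsep _ Finset.inter_subset_right
      (hIT (D \ T))
    have h3 := card_inter_add_card_sdiff_inter hT I
    have h4 := card_inter_add_card_sdiff_inter hT J
    have h5 := hDmin T (Finset.mem_filter.2
      ⟨Finset.mem_powerset.2 (hT.trans hDR), hTne, hTsep, by omega⟩)
    exact hTD (Finset.eq_of_subset_of_card_le hT h5)
  · rw [indepLE_iff]
    intro X hX hXind
    by_cases hyX : y ∈ X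
    · have h1 := h (X ∪ I ∩ D)
        (Finset.union_subset
          (hX.trans (Finset.insert_subset hy (Finset.sdiff_subset.trans (Finset.erase_subset _ _))))
          (Finset.inter_subset_left.trans hIS))
        (indep_union hXind (hIT D) (by
          intro u hu v hv huv
          obtain ⟨hvI, hvD⟩ := Finset.mem_inter.1 hv
          rcases Finset.mem_insert.1 (hX hu) with rfl | hu'
          · exact hI u hyI v hvI huv
          · exact hDsep v hvD u hu' huv.symm))
      rw [Finset.card_union_of_disjoint] at h1
      · omega
      · rw [Finset.disjoint_left]
        intro v hv hv'
        have hvD := (Finset.mem_inter.1 hv').2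
        rcases Finset.mem_insert.1 (hX hv) with rfl | hv''
        · exact (Finset.mem_erase.1 (hDR hvD)).1 rfl
        · exact (Finset.mem_sdiff.1 hv'').2 hvD
    · refine hmax (R \ D) Finset.sdiff_subset (hcompl D hDR hDsep) X (fun v hv => ?_) hXind
      exact (Finset.mem_insert.1 (hX hv)).resolve_left fun h => hyX (h ▸ hv)
  · obtain ⟨d, hd⟩ := hDne
    have := (indepLE_iff.1 hDleft) {d} (by simpa using hd) (by simp)
    simpa using this

namespace CutSplit

lemma notMem_left (h : CutSplit G S a y D E b c) : y ∉ D := fun hy =>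
  (Finset.mem_erase.1 (h.union ▸ Finset.mem_union_left E hy)).1 rfl

lemma notMem_right (h : CutSplit G S a y D E b c) : y ∉ E := fun hy =>
  (Finset.mem_erase.1 (h.union ▸ Finset.mem_union_right D hy)).1 rfl

lemma left_subset (h : CutSplit G S a y D E b c) : D ⊆ S :=
  (h.union ▸ Finset.subset_union_left : D ⊆ S.erase y).trans (Finset.erase_subset _ _)

lemma right_subset (h : CutSplit G S a y D E b c) : E ⊆ S :=
  (h.union ▸ Finset.subset_union_right : E ⊆ S.erase y).trans (Finset.erase_subset _ _)

lemma mem_cases (h : CutSplit G S a y D E b c) (hv : v ∈ S) : v ∈ D ∨ v ∈ insert y E := by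
  by_cases hvy : v = y
  · exact Or.inr (hvy ▸ Finset.mem_insert_self _ _)
  · have : v ∈ D ∪ E := h.union ▸ Finset.mem_erase.2 ⟨hvy, hv⟩
    exact (Finset.mem_union.1 this).imp_right Finset.mem_insert_of_mem

lemma disj_insert (h : CutSplit G S a y D E b c) : Disjoint D (insert y E) :=
  Finset.disjoint_insert_right.2 ⟨h.notMem_left, h.disj⟩

lemma card_add (h : CutSplit G S a y D E b c) (hy : y ∈ S) : D.card + E.card + 1 = S.card := by
  rw [← Finset.card_union_of_disjoint h.disj, h.union, Finset.card_erase_add_one hy]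

lemma exists_adj_left (h : CutSplit G S a y D E b c) (hconn : Conn G S) (hy : y ∈ S) :
    ∃ w ∈ D, G.Adj y w := by
  obtain ⟨u, hu, v, hv, hvD, huv⟩ := hconn D h.left_subset h.nonempty fun hDS =>
    h.notMem_left (hDS ▸ hy)
  rcases Finset.mem_insert.1 ((h.mem_cases hv).resolve_left hvD) with rfl | hvE
  · exact ⟨u, hu, huv.symm⟩
  · exact absurd huv (h.sep u hu v hvE)

lemma conn_right (h : CutSplit G S a y D E b c) (hconn : Conn G S) (hy : y ∈ S) :
    Conn G (insert y E) := by
  have hsub : insert y E ⊆ S := Finset.insert_subset hy h.right_subset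
  have key : ∀ T ⊆ E, T.Nonempty → ∃ u ∈ T, ∃ v ∈ insert y E, v ∉ T ∧ G.Adj u v := by
    intro T hT hTne
    obtain ⟨u, hu, v, hv, hvT, huv⟩ := hconn T (hT.trans h.right_subset) hTne fun hTS =>
      h.notMem_right (hT (hTS ▸ hy))
    rcases h.mem_cases hv with hvD | hvE
    · exact absurd huv.symm (h.sep v hvD u (hT hu))
    · exact ⟨u, hu, v, hvE, hvT, huv⟩
  intro T hT hTne hTE
  by_cases hyT : y ∈ T
  · obtain ⟨u, hu, v, hv, hvT, huv⟩ := key (insert y E \ T)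
      (fun v hv => by
        obtain ⟨h1, h2⟩ := Finset.mem_sdiff.1 hv
        exact (Finset.mem_insert.1 h1).resolve_left fun h => h2 (h ▸ hyT))
      (Finset.sdiff_nonempty.2 fun h => hTE (hT.antisymm h))
    obtain ⟨huE, huT⟩ := Finset.mem_sdiff.1 hu
    refine ⟨v, ?_, u, huE, huT, huv.symm⟩
    by_contra hvT'
    exact hvT (Finset.mem_sdiff.2 ⟨hv, hvT'⟩)
  · exact key T (fun v hv =>
      (Finset.mem_insert.1 (hT hv)).resolve_left fun h => hyT (h ▸ hv)) hTne

/-- Equality would make `D` itself independent, although it is connected with more than one vertex.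
-/
lemma left_lt_card (h : CutSplit G S a y D E b c) (hD : D.card ≠ 1)
    (hb : (indepSets G D b).Nonempty) : b < D.card := by
  refine lt_of_le_of_ne h.left_le fun hbD => ?_
  obtain ⟨I, hb⟩ := hb
  obtain ⟨hID, hIc, hI⟩ := mem_indepSets.1 hb
  rw [Finset.eq_of_subset_of_card_le hID (by omega)] at hI
  have := h.nonempty.card_pos
  obtain ⟨x, hx⟩ := h.nonempty
  obtain ⟨z, hz, hxz⟩ := h.conn.exists_adj (by omega) hx
  exact hI x hx z hz hxz

lemma card_indepSets_erase (h : CutSplit G S a y D E b c) :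
    (indepSets G (S.erase y) a).card = (indepSets G D b).card * (indepSets G E c).card := by
  rw [← h.union, ← h.add]
  exact card_indepSets_union h.disj h.sep h.left (h.right.mono (Finset.subset_insert _ _))

lemma card_inter (h : CutSplit G S a y D E b c) (hI : I ∈ indepSets G S a) :
    I ∩ D ∈ indepSets G D b ∧ I ∩ insert y E ∈ indepSets G (insert y E) c ∧
      I ∩ D ∪ I ∩ insert y E = I := by
  obtain ⟨hIS, hIc, hind⟩ := mem_indepSets.1 hI
  have hun : I ∩ D ∪ I ∩ insert y E = I := by
    rw [← Finset.inter_union_distrib_left, Finset.inter_eq_left]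
    exact fun v hv => Finset.mem_union.2 (h.mem_cases (hIS hv))
  have hsub : ∀ F, ∀ u ∈ I ∩ F, ∀ v ∈ I ∩ F, ¬ G.Adj u v := fun F u hu v hv =>
    hind u (Finset.mem_inter.1 hu).1 v (Finset.mem_inter.1 hv).1
  have h1 := indepLE_iff.1 h.left _ Finset.inter_subset_right (hsub D)
  have h2 := indepLE_iff.1 h.right _ Finset.inter_subset_right (hsub (insert y E))
  have h3 : (I ∩ D).card + (I ∩ insert y E).card = a := by
    rw [← Finset.card_union_of_disjoint
      (h.disj_insert.mono Finset.inter_subset_right Finset.inter_subset_right), hun, hIc]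
  have h4 := h.add
  exact ⟨mem_indepSets.2 ⟨Finset.inter_subset_right, by omega, hsub D⟩,
    mem_indepSets.2 ⟨Finset.inter_subset_right, by omega, hsub _⟩, hun⟩

lemma card_indepSetsAt_le (h : CutSplit G S a y D E b c) :
    (indepSetsAt G S a y).card ≤
      (indepSets G (far G D y) b).card * (indepSetsAt G (insert y E) c y).card := by
  rw [← Finset.card_product]
  refine Finset.card_le_card_of_injOn (fun I => (I ∩ D, I ∩ insert y E)) ?_ ?_
  · intro I hI
    obtain ⟨hI, hyI⟩ := mem_indepSetsAt.1 hI
    obtain ⟨hD, hE, -⟩ := h.card_inter hI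
    obtain ⟨-, hDc, hDi⟩ := mem_indepSets.1 hD
    refine Finset.mem_product.2 ⟨mem_indepSets.2 ⟨fun v hv => ?_, hDc, hDi⟩,
      mem_indepSetsAt.2 ⟨hE, Finset.mem_inter.2 ⟨hyI, Finset.mem_insert_self _ _⟩⟩⟩
    obtain ⟨hvI, hvD⟩ := Finset.mem_inter.1 hv
    exact mem_far.2 ⟨hvD, fun hvy => h.notMem_left (hvy ▸ hvD),
      (mem_indepSets.1 hI).2.2 y hyI v hvI⟩
  · intro I hI I' hI' heq
    simp only [Prod.mk.injEq] at heq
    rw [← (h.card_inter (mem_indepSetsAt.1 hI).1).2.2,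
      ← (h.card_inter (mem_indepSetsAt.1 hI').1).2.2, heq.1, heq.2]

end CutSplit

lemma far_subset (G : SimpleGraph V) (S : Finset V) (x : V) : far G S x ⊆ S :=
  fun _ hv => (mem_far.1 hv).1

lemma far_subset_erase (hw : G.Adj y w) : far G D y ⊆ D.erase w := by
  intro v hv
  obtain ⟨hvD, -, hyv⟩ := mem_far.1 hv
  exact Finset.mem_erase.2 ⟨fun h => hyv (h ▸ hw), hvD⟩

lemma connBound_one_one : connBound 1 1 = 1 := by decide

lemma reducedProd_one_pos (n : ℕ) : 0 < reducedProd n 1 := by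
  simp [reducedProd, Nat.mod_one]

/-- The bound for connected graphs with a cut vertex. -/
lemma card_indepSets_le_of_cut (hconn : Conn G S) (h : IndepLE G S a) (haS : a < S.card)
    (hpos : ∀ v ∈ S, 0 < (indepSetsAt G S a v).card) (hy : y ∈ S)
    (hcut : ¬ Conn G (S.erase y))
    (ih : ∀ T ⊂ S, Conn G T → ∀ b, 1 ≤ b → b < T.card → IndepLE G T b →
      (indepSets G T b).card ≤ connBound T.card b) :
    (indepSets G S a).card ≤ connBound S.card a ∧
      ((indepSets G S a).card = connBound S.card a → HasCentre G S a) := by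
  obtain ⟨D, E, b, c, hs⟩ := exists_cutSplit hconn h haS hpos hy hcut
  obtain ⟨w, hw, hyw⟩ := hs.exists_adj_left hconn hy
  have hcard := hs.card_add hy
  have hcle := hs.right_le
  have hcpos := hs.right_pos
  have hbpos := hs.left_pos
  have hadd := hs.add
  have hDpos : 0 < D.card := hs.nonempty.card_pos
  -- a part of the centre lies in every maximum independent set of the graph
  have hA1 : (indepSets G D b).Nonempty := by
    obtain ⟨I, hI⟩ := Finset.card_pos.1 (hpos y hy)
    exact ⟨_, (hs.card_inter (mem_indepSetsAt.1 hI).1).1⟩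
  have hpos' : ∀ v ∈ S, 0 < (indepSets G (S.erase v) a).card := by
    intro v hv
    obtain ⟨x, hx, hvx⟩ := hconn.exists_adj (by omega) hv
    obtain ⟨I, hI⟩ := Finset.card_pos.1 (hpos x hx)
    obtain ⟨hI, hxI⟩ := mem_indepSetsAt.1 hI
    obtain ⟨hIS, hIc, hI⟩ := mem_indepSets.1 hI
    exact Finset.card_pos.2 ⟨I, mem_indepSets.2
      ⟨fun u hu => Finset.mem_erase.2 ⟨fun h => hI v (h ▸ hu) x hxI hvx, hIS hu⟩, hIc, hI⟩⟩
  have hN := card_indepSets_eq_add G S a y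
  rw [hs.card_indepSets_erase] at hN
  have hNy := hs.card_indepSetsAt_le
  have hF := card_indepSets_eq_add G (insert y E) c y
  rw [Finset.erase_insert hs.notMem_right] at hF
  have hFcard : (insert y E).card = E.card + 1 := Finset.card_insert_of_notMem hs.notMem_right
  have hDS : D ⊂ S := Finset.ssubset_iff_subset_ne.2
    ⟨hs.left_subset, fun hDS => hs.notMem_left (hDS ▸ hy)⟩
  have hFS : insert y E ⊂ S := by
    refine Finset.ssubset_iff_subset_ne.2 ⟨Finset.insert_subset hy hs.right_subset, fun hES => ?_⟩
    have := Finset.disjoint_left.1 hs.disj_insert hw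
    rw [hES] at this
    exact this (hs.left_subset hw)
  have hFle := ih _ hFS (hs.conn_right hconn hy) c hcpos (by omega) hs.right
  rw [hFcard, hF, connBound, Nat.add_sub_cancel] at hFle
  have hEle := card_indepSets_le (hs.right.mono (Finset.subset_insert _ _))
  have hBw := Finset.card_le_card
    (indepSets_mono (G := G) (k := b) (far_subset_erase (D := D) hyw))
  have hwle := card_indepSets_le (hs.left.mono (Finset.erase_subset w D))
  rw [Finset.card_erase_of_mem hw] at hwle
  have hBA := Finset.card_le_card (indepSets_mono (G := G) (k := b) (far_subset G D y))
  have hDcases : b < D.card ∨ D.card = 1 ∧ b = 1 := by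
    by_cases hD1 : D.card = 1
    · have := hs.left_le
      omega
    · exact Or.inl (hs.left_lt_card hD1 hA1)
  have hAle : (indepSets G D b).card ≤ connBound D.card b := by
    rcases hDcases with hlt | ⟨h1, rfl⟩
    · exact ih D hDS hs.conn b hbpos hlt hs.left
    · rw [card_indepSets_one, h1, connBound_one_one]
  obtain ⟨hglue, hglue_eq⟩ := connBound_glue (n₁ := E.card + 1) (n₂ := D.card) hcpos
    (by omega) hbpos hDcases
  rw [Nat.add_sub_cancel, show E.card + 1 + D.card = S.card by omega,
    show c + b = a by omega] at hglue hglue_eq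
  -- the chain of estimates
  set A := (indepSets G D b).card
  set B := (indepSets G (far G D y) b).card
  set X := (indepSetsAt G (insert y E) c y).card
  set N := (indepSets G E c).card
  set g := balancedProd E.card c
  set q := reducedProd (E.card + 1) c
  obtain ⟨d, hd⟩ := Nat.exists_eq_add_of_le hBA
  -- With `A = B + d`, the count is at most `A * N + B * X = d * N + B * (N + X)`. Zykov's theorem
  -- gives `N ≤ g` and the induction hypothesis gives `N + X ≤ g + q`; there is no separate bound `X
  -- ≤ q`. The slacks are kept for the equality case.
  have e1 : (indepSets G S a).card + (d * (g - N) + B * (g + q - (N + X))) ≤ A * g + B * q := by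
    obtain ⟨t, ht⟩ := Nat.exists_eq_add_of_le hEle
    obtain ⟨s, hs⟩ := Nat.exists_eq_add_of_le hFle
    rw [hs, ht, hd, Nat.add_sub_cancel_left, Nat.add_sub_cancel_left]
    have : B * (N + t + q) = B * (N + X + s) := by rw [← hs, ht]
    have h1 : (B + d) * (N + t) + B * q = d * N + d * t + B * (N + t + q) := by ring
    have h2 : B * (N + X + s) = B * N + B * X + B * s := by ring
    have h3 : A * N = B * N + d * N := by rw [hd]; ring
    omega
  have e2 : A * g + B * q ≤ connBound D.card b * g + B * q := by
    have := Nat.mul_le_mul_right g hAle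
    omega
  have e3 : B * q ≤ balancedProd (D.card - 1) b * q := Nat.mul_le_mul_right q (hBw.trans hwle)
  refine ⟨by omega, fun heq => ?_⟩
  -- Equality forces one part to be a clique. If it is `D`, then `d > 0` gives `N = g`, so `E` is a
  -- union of cliques and `y` is a centre. If it is `insert y E`, then `q > 0` makes `D.erase w` a
  -- union of cliques without neighbours of `y`, and `w` is a centre.
  by_cases hb1 : b = 1
  · subst hb1
    have hBlt : B < A := by
      have h1 := card_indepSets_one G (far G D y)
      have h2 := card_indepSets_one G D
      have h3 := Finset.card_le_card (far_subset_erase (D := D) hyw)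
      rw [Finset.card_erase_of_mem hw] at h3
      omega
    have hgN : N = g := by
      have : d * (g - N) = 0 := by omega
      rcases Nat.mul_eq_zero.1 this with h | h <;> omega
    obtain ⟨p, hp⟩ := exists_cliqueUnion (hs.right.mono (Finset.subset_insert _ _)) hcle hgN
    obtain ⟨p', hp'⟩ := hp.exists_union (K := D)
      (fun u hu v hv huv => adj_of_indepLE_one hs.left hu hv huv)
      (fun u hu v hv huv => hs.sep v hv u hu huv.symm) hs.disj.symm
    rw [Finset.union_comm, hs.union, add_comm, hs.add] at hp'
    exact ⟨y, hy, hpos' y hy, p', hp'⟩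
  · obtain rfl : c = 1 := (hglue_eq (by omega)).resolve_right hb1
    have hq : 0 < q := reducedProd_one_pos _
    have hB : B = balancedProd (D.card - 1) b := Nat.eq_of_mul_eq_mul_right hq (by omega)
    have hDw : (indepSets G (D.erase w) b).card = balancedProd (D.erase w).card b := by
      rw [Finset.card_erase_of_mem hw]
      omega
    have hbw : b ≤ (D.erase w).card := by
      rw [Finset.card_erase_of_mem hw]
      omega
    obtain ⟨p, hp⟩ := exists_cliqueUnion (hs.left.mono (Finset.erase_subset w D)) hbw hDw
    -- A second neighbour `v` of `y` in `D` would make `B` strictly smaller, as some maximum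
    -- independent set of `D.erase w` contains `v`.
    have hnadj : ∀ v ∈ D.erase w, ¬ G.Adj v y := by
      intro v hv hvy
      have h1 := card_indepSetsAt_pos (hs.left.mono (Finset.erase_subset w D)) hbw hDw hv
      have h2 := card_indepSets_eq_add G (D.erase w) b v
      have h3 : far G D y ⊆ (D.erase w).erase v := fun z hz =>
        Finset.mem_erase.2 ⟨fun h => (mem_far.1 hz).2.2 (h ▸ hvy.symm), far_subset_erase hyw hz⟩
      have h4 := Finset.card_le_card (indepSets_mono (G := G) (k := b) h3)
      omega
    obtain ⟨p', hp'⟩ := hp.exists_union (K := insert y E)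
      (fun u hu v hv huv => adj_of_indepLE_one hs.right hu hv huv) (by
        intro u hu v hv huv
        rcases Finset.mem_insert.1 hv with rfl | hv
        · exact hnadj u hu huv
        · exact hs.sep u (Finset.mem_of_mem_erase hu) v hv huv)
      (hs.disj_insert.mono_left (Finset.erase_subset _ _))
    have hun : D.erase w ∪ insert y E = S.erase w := by
      ext v
      rw [Finset.mem_union, Finset.mem_erase, Finset.mem_erase]
      constructor
      · rintro (⟨h1, h2⟩ | h1)
        · exact ⟨h1, hs.left_subset h2⟩
        · refine ⟨?_, hFS.1 h1⟩
          rintro rfl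
          exact Finset.disjoint_left.1 hs.disj_insert hw h1
      · rintro ⟨h1, h2⟩
        exact (hs.mem_cases h2).imp_left fun h => ⟨h1, h⟩
    rw [hun, hs.add] at hp'
    exact ⟨w, hs.left_subset hw, hpos' w (hs.left_subset hw), p', hp'⟩

end CutVertex

/-! ### The twin operation and the upper bound. -/

section Twin

variable {V : Type*} [DecidableEq V] {G : SimpleGraph V}
variable {S T D E I J K : Finset V} {a b c k : ℕ} {x y u v w : V}

/-- The graph that arises from `G` by turning `y` into a true twin of `x`. -/
def twinGraph (G : SimpleGraph V) (x y : V) : SimpleGraph V where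
  Adj u v := (u ≠ y ∧ v ≠ y ∧ G.Adj u v) ∨ (u = y ∧ v ≠ y ∧ (v = x ∨ G.Adj x v)) ∨
    (v = y ∧ u ≠ y ∧ (u = x ∨ G.Adj x u))
  symm := ⟨by
    rintro u v (⟨h1, h2, h3⟩ | ⟨h1, h2, h3⟩ | ⟨h1, h2, h3⟩)
    · exact Or.inl ⟨h2, h1, h3.symm⟩
    · exact Or.inr (Or.inr ⟨h1, h2, h3⟩)
    · exact Or.inr (Or.inl ⟨h1, h2, h3⟩)⟩
  loopless := ⟨by
    rintro u (⟨h1, h2, h3⟩ | ⟨h1, h2, h3⟩ | ⟨h1, h2, h3⟩)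
    · exact h3.ne rfl
    · exact h2 h1
    · exact h2 h1⟩

lemma twinGraph_adj (hu : u ≠ y) (hv : v ≠ y) : (twinGraph G x y).Adj u v ↔ G.Adj u v := by
  simp [twinGraph, hu, hv]

lemma twinGraph_adj_right (hu : u ≠ y) : (twinGraph G x y).Adj y u ↔ u = x ∨ G.Adj x u := by
  simp [twinGraph, hu]

lemma indepSets_congr {G' : SimpleGraph V}
    (h : ∀ u ∈ S, ∀ v ∈ S, G.Adj u v ↔ G'.Adj u v) : indepSets G S k = indepSets G' S k := by
  ext I
  simp only [mem_indepSets]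
  refine and_congr_right fun hI => and_congr_right fun _ => ?_
  exact forall₂_congr fun u hu => forall₂_congr fun v hv => not_congr (h u (hI hu) v (hI hv))

lemma indepSets_twinGraph (hy : y ∉ S) : indepSets (twinGraph G x y) S k = indepSets G S k :=
  indepSets_congr fun _ hu _ hv =>
    twinGraph_adj (fun h => hy (h ▸ hu)) (fun h => hy (h ▸ hv))

lemma conn_congr {G' : SimpleGraph V}
    (h : ∀ u ∈ S, ∀ v ∈ S, G.Adj u v ↔ G'.Adj u v) (hc : Conn G S) : Conn G' S := by
  intro T hT hTne hTS
  obtain ⟨u, hu, v, hv, hvT, huv⟩ := hc T hT hTne hTS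
  exact ⟨u, hu, v, hv, hvT, (h u (hT hu) v hv).1 huv⟩

lemma far_twinGraph_self (hxy : G.Adj x y) : far (twinGraph G x y) S x = far G S x := by
  ext v
  rw [mem_far, mem_far]
  refine and_congr_right fun _ => and_congr_right fun _ => not_congr ?_
  by_cases hv : v = y
  · subst hv
    simp only [hxy, iff_true]
    exact ((twinGraph_adj_right hxy.ne).2 (Or.inl rfl)).symm
  · exact twinGraph_adj hxy.ne hv

lemma far_twinGraph_right (hxy : G.Adj x y) : far (twinGraph G x y) S y = far G S x := by
  ext v
  rw [mem_far, mem_far]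
  refine and_congr_right fun _ => ?_
  by_cases hv : v = y
  · subst hv
    simp [hxy]
  · rw [twinGraph_adj_right hv]
    simp [hv]

lemma notMem_far_of_adj (hxy : G.Adj x y) : y ∉ far G S x := fun h => (mem_far.1 h).2.2 hxy

lemma card_indepSetsAt_twinGraph_self (hx : x ∈ S) (hxy : G.Adj x y) :
    (indepSetsAt (twinGraph G x y) S (k + 1) x).card = (indepSetsAt G S (k + 1) x).card := by
  rw [card_indepSetsAt hx, card_indepSetsAt hx, far_twinGraph_self hxy,
    indepSets_twinGraph (notMem_far_of_adj hxy)]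

lemma card_indepSetsAt_twinGraph_right (hx : x ∈ S) (hy : y ∈ S) (hxy : G.Adj x y) :
    (indepSetsAt (twinGraph G x y) S (k + 1) y).card = (indepSetsAt G S (k + 1) x).card := by
  rw [card_indepSetsAt hx, card_indepSetsAt hy, far_twinGraph_right hxy,
    indepSets_twinGraph (notMem_far_of_adj hxy)]

/-- Sets avoiding `y` are unchanged, and the sets through `y` are replaced by as many as there are
through `x`. -/
lemma card_indepSets_twinGraph (hx : x ∈ S) (hy : y ∈ S) (hxy : G.Adj x y) :
    (indepSets (twinGraph G x y) S (k + 1)).card + (indepSetsAt G S (k + 1) y).card =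
      (indepSets G S (k + 1)).card + (indepSetsAt G S (k + 1) x).card := by
  rw [card_indepSets_eq_add _ S _ y, card_indepSets_eq_add G S _ y,
    card_indepSetsAt_twinGraph_right hx hy hxy, indepSets_twinGraph (Finset.notMem_erase y S)]
  omega

/-- Together with the unchanged count at `x`, this keeps `x` maximal among its neighbours after the
operation. -/
lemma card_indepSetsAt_twinGraph_le (hxv : G.Adj x v) (hv : v ≠ y) :
    (indepSetsAt (twinGraph G x y) S k v).card ≤ (indepSetsAt G S k v).card := by
  refine Finset.card_le_card fun I hI => ?_
  obtain ⟨hI, hvI⟩ := mem_indepSetsAt.1 hI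
  obtain ⟨hIS, hIc, hind⟩ := mem_indepSets.1 hI
  have hyI : y ∉ I := fun hyI =>
    hind y hyI v hvI ((twinGraph_adj_right hv).2 (Or.inr hxv))
  refine mem_indepSetsAt.2 ⟨mem_indepSets.2 ⟨hIS, hIc, fun u hu z hz huz => ?_⟩, hvI⟩
  exact hind u hu z hz
    ((twinGraph_adj (ne_of_mem_of_not_mem hu hyI) (ne_of_mem_of_not_mem hz hyI)).2 huz)

/-- An independent set through `y` becomes one of the old graph when `y` is replaced by `x`. -/
lemma IndepLE.twinGraph (h : IndepLE G S a) (hx : x ∈ S) :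
    IndepLE (twinGraph G x y) S a := by
  rw [indepLE_iff] at *
  intro I hI hind
  by_cases hyI : y ∈ I
  · have hadj : ∀ v ∈ I.erase y, ¬ (v = x ∨ G.Adj x v) := fun v hv hxv => by
      obtain ⟨hvy, hvI⟩ := Finset.mem_erase.1 hv
      exact hind y hyI v hvI ((twinGraph_adj_right hvy).2 hxv)
    have := h (insert x (I.erase y))
      (Finset.insert_subset hx ((Finset.erase_subset _ _).trans hI))
      (indep_insert (fun u hu v hv huv => by
        obtain ⟨huy, huI⟩ := Finset.mem_erase.1 hu
        obtain ⟨hvy, hvI⟩ := Finset.mem_erase.1 hv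
        exact hind u huI v hvI ((twinGraph_adj huy hvy).2 huv))
        fun v hv hxv => hadj v hv (Or.inr hxv))
    rwa [Finset.card_insert_of_notMem fun hxI => hadj x hxI (Or.inl rfl),
      Finset.card_erase_add_one hyI] at this
  · exact h I hI fun u hu v hv huv => hind u hu v hv
      ((twinGraph_adj (ne_of_mem_of_not_mem hu hyI) (ne_of_mem_of_not_mem hv hyI)).2 huv)

lemma conn_erase_twinGraph (h : Conn G (S.erase y)) : Conn (twinGraph G x y) (S.erase y) :=
  conn_congr (fun _ hu _ hv =>
    (twinGraph_adj (Finset.ne_of_mem_erase hu) (Finset.ne_of_mem_erase hv)).symm) h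

lemma conn_twinGraph (h : Conn G (S.erase y)) (hx : x ∈ S) (hy : y ∈ S) (hxy : x ≠ y) :
    Conn (twinGraph G x y) S := by
  have hadj : (twinGraph G x y).Adj y x := (twinGraph_adj_right hxy).2 (Or.inl rfl)
  intro T hT hTne hTS
  by_cases h1 : (T.erase y).Nonempty
  · by_cases h2 : T.erase y = S.erase y
    · have hyT : y ∉ T := fun hyT => hTS (by
        rw [← Finset.insert_erase hyT, h2, Finset.insert_erase hy])
      have hxT : x ∈ T := Finset.mem_of_mem_erase (h2 ▸ Finset.mem_erase.2 ⟨hxy, hx⟩)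
      exact ⟨x, hxT, y, hy, hyT, hadj.symm⟩
    · obtain ⟨u, hu, v, hv, hvT, huv⟩ :=
        conn_erase_twinGraph (x := x) h _ (Finset.erase_subset_erase y hT) h1 h2
      refine ⟨u, Finset.mem_of_mem_erase hu, v, Finset.mem_of_mem_erase hv, fun hvT' => ?_, huv⟩
      exact hvT (Finset.mem_erase.2 ⟨Finset.ne_of_mem_erase hv, hvT'⟩)
  · have hTy : ∀ v ∈ T, v = y := fun v hv => by
      by_contra hne
      exact h1 ⟨v, Finset.mem_erase.2 ⟨hne, hv⟩⟩
    obtain ⟨v, hv⟩ := hTne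
    exact ⟨y, hTy v hv ▸ hv, x, hx, fun hxT => hxy (hTy x hxT), hadj⟩

/-- `x` and `y` have the same neighbours in `S`, apart from each other. -/
def IsTwin (G : SimpleGraph V) (S : Finset V) (x y : V) : Prop :=
  ∀ z ∈ S, z ≠ x → z ≠ y → (G.Adj x z ↔ G.Adj y z)

lemma isTwin_twinGraph (hxy : x ≠ y) : IsTwin (twinGraph G x y) S x y := by
  intro z _ hzx hzy
  rw [twinGraph_adj_right hzy, twinGraph_adj hxy hzy]
  simp [hzx]

open Classical in
/-- The neighbours of `x` in `S` that are no twins of `x`. -/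
noncomputable def nonTwins (G : SimpleGraph V) (S : Finset V) (x : V) : Finset V :=
  {v ∈ S | G.Adj x v ∧ ¬ IsTwin G S x v}

lemma mem_nonTwins : v ∈ nonTwins G S x ↔ v ∈ S ∧ G.Adj x v ∧ ¬ IsTwin G S x v := by
  simp [nonTwins]

/-- The termination measure of the twin process: `y` becomes a twin of `x`, and old twins of `x`
stay twins because they are joined to `y` as well. -/
lemma card_nonTwins_twinGraph_lt (hy : y ∈ nonTwins G S x) :
    (nonTwins (twinGraph G x y) S x).card < (nonTwins G S x).card := by
  have hxy := (mem_nonTwins.1 hy).2.1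
  refine Finset.card_lt_card (Finset.ssubset_of_subset_of_ssubset (fun v hv => ?_)
    (Finset.erase_ssubset hy))
  obtain ⟨hvS, hxv, hv⟩ := mem_nonTwins.1 hv
  have hvy : v ≠ y := by
    rintro rfl
    exact hv (isTwin_twinGraph hxy.ne)
  rw [twinGraph_adj hxy.ne hvy] at hxv
  refine Finset.mem_erase.2 ⟨hvy, mem_nonTwins.2 ⟨hvS, hxv, fun htwin => hv ?_⟩⟩
  intro z hz hzx hzv
  by_cases hzy : z = y
  · subst hzy
    have h1 : (twinGraph G x z).Adj x z := ((twinGraph_adj_right hxy.ne).2 (Or.inl rfl)).symm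
    have h2 : (twinGraph G x z).Adj v z := ((twinGraph_adj_right hvy).2 (Or.inr hxv)).symm
    simp [h1, h2]
  · rw [twinGraph_adj hxy.ne hzy, twinGraph_adj hvy hzy]
    exact htwin z hz hzx hzv

/-- An edge leaving the closed neighbourhood of `x` would start at `x` or at a twin of `x`, so its
other end would be adjacent to `x` after all. -/
lemma Conn.near_eq (hconn : Conn G S) (hx : x ∈ S) (h : nonTwins G S x = ∅) :
    near G S x = S := by
  by_contra hne
  obtain ⟨u, hu, v, hv, hvx, huv⟩ := hconn _ (fun v hv => (mem_near.1 hv).1)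
    ⟨x, mem_near.2 ⟨hx, Or.inl rfl⟩⟩ hne
  obtain ⟨huS, hu⟩ := mem_near.1 hu
  apply hvx
  refine mem_near.2 ⟨hv, Or.inr ?_⟩
  rcases hu with rfl | hxu
  · exact huv
  · by_contra hxv
    have hmem : u ∉ nonTwins G S x := by simp [h]
    rw [mem_nonTwins] at hmem
    push Not at hmem
    have hvx' : v ≠ x := fun h => hvx (mem_near.2 ⟨hv, Or.inl h⟩)
    exact hxv ((hmem huS hxu v hv hvx' huv.ne').2 huv)

/-- Here `x` is adjacent to all other vertices, so an independent set through `x` has no further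
vertex. -/
lemma indepLE_one_of_nonTwins_eq_empty (hconn : Conn G S) (hx : x ∈ S)
    (h : nonTwins G S x = ∅) (hpos : 0 < (indepSetsAt G S (k + 1) x).card) : k = 0 := by
  rw [card_indepSetsAt hx] at hpos
  obtain ⟨I, hI⟩ := Finset.card_pos.1 hpos
  obtain ⟨hIS, hIc, -⟩ := mem_indepSets.1 hI
  have h1 := card_near_add_card_far G S x
  rw [hconn.near_eq hx h] at h1
  have h2 := Finset.card_le_card hIS
  omega

lemma connBound_one {n : ℕ} (hn : 0 < n) : connBound n 1 = n := by
  simp [connBound, balancedProd, reducedProd, Nat.mod_one]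
  omega

/-- No vertex of `S` is a cut vertex. -/
def NoCut (G : SimpleGraph V) (S : Finset V) : Prop := ∀ v ∈ S, Conn G (S.erase v)

/-- The number of maximum independent sets of a connected graph is at most `f(n, a)`. -/
theorem card_indepSets_le_connBound (G : SimpleGraph V) (S : Finset V) (hconn : Conn G S)
    (a : ℕ) (ha : 1 ≤ a) (haS : a < S.card) (h : IndepLE G S a) :
    (indepSets G S a).card ≤ connBound S.card a := by
  induction S using Finset.strongInduction generalizing G a with
  | H S ih =>
  obtain ⟨k, rfl⟩ : ∃ k, a = k + 1 := ⟨a - 1, by omega⟩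
  -- The graph varies here while `S` is fixed. Maximality of `x` is required only among its
  -- neighbours, since this is what the twin operation preserves.
  suffices hmain : ∀ (m : ℕ) (G : SimpleGraph V) (x : V), Conn G S → IndepLE G S (k + 1) →
      x ∈ S → (nonTwins G S x).card = m →
      (∀ v ∈ S, G.Adj x v →
        (indepSetsAt G S (k + 1) v).card ≤ (indepSetsAt G S (k + 1) x).card) →
      (indepSets G S (k + 1)).card ≤ connBound S.card (k + 1) by
    obtain ⟨x, hx, hmax⟩ := S.exists_max_image (fun y => (indepSetsAt G S (k + 1) y).card)
      (Finset.card_pos.1 (by omega))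
    exact hmain _ G x hconn h hx rfl fun v hv _ => hmax v hv
  intro m
  induction m using Nat.strong_induction_on with
  | _ m ihm =>
  intro G x hconn h hx hm hmax
  by_cases h0 : ∃ w ∈ S, (indepSetsAt G S (k + 1) w).card = 0
  · obtain ⟨w, hw, hw0⟩ := h0
    exact (card_le_connBound_of_card_indepSetsAt_eq_zero h haS hw hw0).1
  push Not at h0
  have hpos : ∀ v ∈ S, 0 < (indepSetsAt G S (k + 1) v).card := fun v hv =>
    Nat.pos_of_ne_zero (h0 v hv)
  by_cases hcut : NoCut G S
  · rcases (nonTwins G S x).eq_empty_or_nonempty with hempty | ⟨y, hy⟩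
    · obtain rfl := indepLE_one_of_nonTwins_eq_empty hconn hx hempty (hpos x hx)
      rw [card_indepSets_one, connBound_one (by omega)]
    · obtain ⟨hyS, hxy, -⟩ := mem_nonTwins.1 hy
      have h1 := card_indepSets_twinGraph (k := k) hx hyS hxy
      have h2 := hmax y hyS hxy
      refine le_trans (by omega) (ihm _ (hm ▸ card_nonTwins_twinGraph_lt hy) (twinGraph G x y) x
        (conn_twinGraph (hcut y hyS) hx hyS hxy.ne) (h.twinGraph hx) hx rfl ?_)
      intro v hv hxv
      rw [card_indepSetsAt_twinGraph_self hx hxy]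
      by_cases hvy : v = y
      · subst hvy
        rw [card_indepSetsAt_twinGraph_right hx hyS hxy]
      · rw [twinGraph_adj hxy.ne hvy] at hxv
        exact (card_indepSetsAt_twinGraph_le hxv hvy).trans (hmax v hv hxv)
  · rw [NoCut] at hcut
    push Not at hcut
    obtain ⟨y, hy, hcut⟩ := hcut
    exact (card_indepSets_le_of_cut hconn h haS hpos hy hcut
      fun T hT hTc b hb hbT hTb => ih T hT G hTc b hb hbT hTb).1

lemma hasCentre_of_not_noCut (hconn : Conn G S) (h : IndepLE G S a) (haS : a < S.card)
    (heq : (indepSets G S a).card = connBound S.card a) (hcut : ¬ NoCut G S) :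
    HasCentre G S a := by
  by_cases h0 : ∃ w ∈ S, (indepSetsAt G S a w).card = 0
  · obtain ⟨w, hw, hw0⟩ := h0
    exact (card_le_connBound_of_card_indepSetsAt_eq_zero h haS hw hw0).2 heq
  push Not at h0
  rw [NoCut] at hcut
  push Not at hcut
  obtain ⟨y, hy, hcut⟩ := hcut
  exact (card_indepSets_le_of_cut hconn h haS (fun v hv => Nat.pos_of_ne_zero (h0 v hv)) hy hcut
    fun T _ hTc b hb hbT hTb => card_indepSets_le_connBound G T hTc b hb hbT hTb).2 heq

end Twin

/-! ### Stars of cliques and extremal graphs with a centre. -/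

section Linked

variable {V : Type*} [DecidableEq V] {G : SimpleGraph V}
variable {S T D E I J K : Finset V} {a b c k : ℕ} {x y u v w : V}
variable {s t : Finset ℕ} {p : V → ℕ} {z : ℕ → V}

/-- The subgraph of `G` induced by `S` consists of one clique for each index in `s`, where `p`
maps a vertex to the index of its clique, and of the edges that join the vertex `z 0` of the clique
with index `0` to the vertices `z i` of the other cliques. -/
structure Linked (G : SimpleGraph V) (S : Finset V) (s : Finset ℕ) (p : V → ℕ) (z : ℕ → V) :
    Prop where
  zero_mem : 0 ∈ s
  mapsTo : ∀ v ∈ S, p v ∈ s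
  mem : ∀ i ∈ s, z i ∈ S
  apply_z : ∀ i ∈ s, p (z i) = i
  adj_iff : ∀ u ∈ S, ∀ v ∈ S, u ≠ v →
    (G.Adj u v ↔ p u = p v ∨ (u = z 0 ∧ v = z (p v)) ∨ (v = z 0 ∧ u = z (p u)))

namespace Linked

lemma mono (h : Linked G S s p z) (hT : T ⊆ S) (hts : t ⊆ s) (h0 : 0 ∈ t)
    (hmaps : ∀ v ∈ T, p v ∈ t) (hmem : ∀ i ∈ t, z i ∈ T) : Linked G T t p z :=
  ⟨h0, hmaps, hmem, fun i hi => h.apply_z i (hts hi),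
    fun u hu v hv => h.adj_iff u (hT hu) v (hT hv)⟩

lemma cliqueUnion_of_notMem (h : Linked G S s p z) (hT : T ⊆ S) (h0 : z 0 ∉ T)
    (hmaps : ∀ v ∈ T, p v ∈ t) : CliqueUnion G T t p := by
  refine ⟨hmaps, fun u hu v hv huv => (h.adj_iff u (hT hu) v (hT hv) huv).trans ?_⟩
  have h1 : u ≠ z 0 := fun h => h0 (h ▸ hu)
  have h2 : v ≠ z 0 := fun h => h0 (h ▸ hv)
  simp [h1, h2]

lemma mem_far_iff (h : Linked G S s p z) (hv : v ∈ S) :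
    v ∈ far G S (z 0) ↔ p v ≠ 0 ∧ v ≠ z (p v) := by
  have hz := h.apply_z 0 h.zero_mem
  rw [mem_far]
  constructor
  · rintro ⟨-, h1, h2⟩
    rw [h.adj_iff _ (h.mem 0 h.zero_mem) v hv (Ne.symm h1), hz] at h2
    push Not at h2
    exact ⟨h2.1.symm, h2.2.1 rfl⟩
  · rintro ⟨h1, h2⟩
    have h3 : v ≠ z 0 := fun h => h1 (h ▸ hz)
    refine ⟨hv, h3, fun hadj => ?_⟩
    rw [h.adj_iff _ (h.mem 0 h.zero_mem) v hv (Ne.symm h3), hz] at hadj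
    rcases hadj with h' | ⟨-, h'⟩ | ⟨h', -⟩
    · exact h1 h'.symm
    · exact h2 h'
    · exact h3 h'

/-- Without `z 0` only disjoint cliques remain, the one with index 0 smaller by one. A set through
`z 0` has to avoid `z i` in every other clique. The result has the form of `starProd`. -/
lemma card_indepSets (h : Linked G S s p z) :
    (indepSets G S s.card).card =
      ((S.filter (p · = 0)).card - 1) * ∏ i ∈ s.erase 0, (S.filter (p · = i)).card +
        ∏ i ∈ s.erase 0, ((S.filter (p · = i)).card - 1) := by
  have hz0 := h.mem 0 h.zero_mem
  have hpz := h.apply_z 0 h.zero_mem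
  rw [card_indepSets_eq_add G S _ (z 0)]
  congr 1
  · rw [(h.cliqueUnion_of_notMem (Finset.erase_subset _ _) (Finset.notMem_erase _ _)
      fun v hv => h.mapsTo v (Finset.mem_of_mem_erase hv)).card_indepSets,
      ← Finset.mul_prod_erase s _ h.zero_mem]
    congr 1
    · rw [Finset.filter_erase, Finset.card_erase_of_mem (by simp [hz0, hpz])]
    · refine Finset.prod_congr rfl fun i hi => ?_
      rw [Finset.filter_erase, Finset.erase_eq_of_notMem]
      rw [Finset.mem_filter, hpz]
      exact fun h => Finset.ne_of_mem_erase hi h.2.symm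
  · have hcl : CliqueUnion G (far G S (z 0)) (s.erase 0) p := by
      refine h.cliqueUnion_of_notMem (far_subset G S _) (fun h => (mem_far.1 h).2.1 rfl) ?_
      intro v hv
      have hvS := far_subset G S _ hv
      exact Finset.mem_erase.2 ⟨((h.mem_far_iff hvS).1 hv).1, h.mapsTo v hvS⟩
    rw [← Finset.card_erase_add_one h.zero_mem, card_indepSetsAt hz0, hcl.card_indepSets]
    refine Finset.prod_congr rfl fun i hi => ?_
    obtain ⟨hi0, his⟩ := Finset.mem_erase.1 hi
    have : (far G S (z 0)).filter (p · = i) = (S.filter (p · = i)).erase (z i) := by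
      ext v
      rw [Finset.mem_filter, Finset.mem_erase, Finset.mem_filter]
      constructor
      · rintro ⟨h1, rfl⟩
        have hvS := far_subset G S _ h1
        exact ⟨((h.mem_far_iff hvS).1 h1).2, hvS, rfl⟩
      · rintro ⟨h1, h2, rfl⟩
        exact ⟨(h.mem_far_iff h2).2 ⟨hi0, h1⟩, rfl⟩
    rw [this, Finset.card_erase_of_mem (by simp [h.mem i his, h.apply_z i his])]

/-- With two cliques the single linking edge is symmetric, so either clique may serve as the centre.
This takes care of the exceptional case in `starProd_le_and`. -/
lemma swap (h : Linked G S (Finset.range 2) p z) :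
    Linked G S (Finset.range 2) (fun v => 1 - p v) (fun i => z (1 - i)) := by
  have h2 : ∀ v ∈ S, p v = 0 ∨ p v = 1 := fun v hv => by
    have := Finset.mem_range.1 (h.mapsTo v hv)
    omega
  refine ⟨by simp, fun v _ => Finset.mem_range.2 (by omega), fun i _ => h.mem _
    (Finset.mem_range.2 (by omega)), fun i hi => ?_, fun u hu v hv huv => ?_⟩
  · have := Finset.mem_range.1 hi
    rw [h.apply_z (1 - i) (Finset.mem_range.2 (by omega))]
    omega
  · have hz0 := h.apply_z 0 (by simp)
    have hz1 := h.apply_z 1 (by simp)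
    rw [h.adj_iff u hu v hv huv]
    rcases h2 u hu with h3 | h3 <;> rcases h2 v hv with h4 | h4 <;> simp only [h3, h4]
    · simp
    · constructor
      · rintro (h5 | h5 | ⟨rfl, h5⟩)
        · simp at h5
        · exact Or.inr (Or.inr ⟨h5.2, h5.1⟩)
        · omega
      · rintro (h5 | ⟨rfl, h5⟩ | h5)
        · simp at h5
        · simp [hz1] at h3
        · exact Or.inr (Or.inl ⟨h5.2, h5.1⟩)
    · constructor
      · rintro (h5 | ⟨rfl, h5⟩ | h5)
        · simp at h5
        · omega
        · exact Or.inr (Or.inl ⟨h5.2, h5.1⟩)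
      · rintro (h5 | h5 | ⟨rfl, h5⟩)
        · simp at h5
        · exact Or.inr (Or.inr ⟨h5.2, h5.1⟩)
        · simp [hz1] at h4
    · simp

end Linked

lemma CliqueUnion.comp_perm (h : CliqueUnion G S s p) (σ : Equiv.Perm ℕ)
    (hσ : ∀ i ∈ s, σ i ∈ s) : CliqueUnion G S s (fun v => σ (p v)) :=
  ⟨fun v hv => hσ _ (h.mapsTo v hv), fun u hu v hv huv => by
    rw [h.adj_iff u hu v hv huv, σ.injective.eq_iff]⟩

/-- If `w` lies in some maximum independent set, then it is completely joined to one of the cliques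
that remain when it is deleted. -/
lemma CliqueUnion.exists_clique_adj (h : CliqueUnion G (S.erase w) (Finset.range a) p)
    (hle : IndepLE G S a) (hw : w ∈ S) (hpos : 0 < (indepSetsAt G S a w).card) :
    ∃ p, CliqueUnion G (S.erase w) (Finset.range a) p ∧
      ∀ v ∈ S.erase w, p v = 0 → G.Adj w v := by
  obtain ⟨k, rfl⟩ : ∃ k, a = k + 1 := by
    obtain ⟨I, hI⟩ := Finset.card_pos.1 hpos
    obtain ⟨hI, hwI⟩ := mem_indepSetsAt.1 hI
    obtain ⟨-, hc, -⟩ := mem_indepSets.1 hI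
    have := Finset.card_pos.2 ⟨w, hwI⟩
    exact ⟨a - 1, by omega⟩
  rw [card_indepSetsAt hw] at hpos
  obtain ⟨J, hJ⟩ := Finset.card_pos.1 hpos
  obtain ⟨hJF, hJc, hJ⟩ := mem_indepSets.1 hJ
  have hFS : far G S w ⊆ S.erase w := fun v hv =>
    Finset.mem_erase.2 ⟨(mem_far.1 hv).2.1, (mem_far.1 hv).1⟩
  -- `J` has only `k` vertices, so it misses one of the `k + 1` colours. A vertex of that colour not
  -- adjacent to `w` could be added to `J`, which together with `w` would be too large.
  obtain ⟨i, hi, hiJ⟩ : ∃ i ∈ Finset.range (k + 1), i ∉ J.image p := by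
    by_contra hno
    push Not at hno
    have h1 := Finset.card_le_card (show Finset.range (k + 1) ⊆ J.image p from hno)
    have h2 := Finset.card_image_le (s := J) (f := p)
    rw [Finset.card_range] at h1
    omega
  refine ⟨_, h.comp_perm (Equiv.swap 0 i) fun j hj => ?_, fun v hv hv0 => ?_⟩
  · rw [Equiv.swap_apply_def]
    split_ifs
    · exact hi
    · simp
    · exact hj
  · have hpv : p v = i := by
      rw [Equiv.swap_apply_eq_iff, Equiv.swap_apply_left] at hv0
      exact hv0
    by_contra hwv
    have hvJ : v ∉ J := fun hvJ => hiJ (hpv ▸ Finset.mem_image_of_mem p hvJ)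
    have hvF : v ∈ far G S w :=
      mem_far.2 ⟨Finset.mem_of_mem_erase hv, Finset.ne_of_mem_erase hv, hwv⟩
    have := indepLE_iff.1 (hle.far hw) (insert v J) (Finset.insert_subset hvF hJF)
      (indep_insert hJ fun u hu hvu => hiJ (by
        rw [← hpv, (h.adj_iff v hv u (hFS (hJF hu)) hvu.ne).1 hvu]
        exact Finset.mem_image_of_mem p hu))
    rw [Finset.card_insert_of_notMem hvJ] at this
    omega

/-- Together with clique 0, `w` forms a clique of order `b 0 + 1`, and connectivity gives `w` a
neighbour in every other clique. So at most the product of the numbers `b i - 1` counts the sets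
through `w`, and the total is at most a `starProd`. Equality leaves exactly one neighbour of `w` in
each other clique, and `starProd_le_and` yields the balance. -/
lemma exists_linked_of_adj (hconn : Conn G S) (ha : 1 ≤ a)
    (heq : (indepSets G S a).card = connBound S.card a) (hw : w ∈ S)
    (hpos : 0 < (indepSetsAt G S a w).card) (hpos' : 0 < (indepSets G (S.erase w) a).card)
    (hp : CliqueUnion G (S.erase w) (Finset.range a) p)
    (hadj : ∀ v ∈ S.erase w, p v = 0 → G.Adj w v) :
    ∃ p z, Linked G S (Finset.range a) p z ∧ (∀ i < a, 2 ≤ (S.filter (p · = i)).card) ∧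
      ∀ i < a, (S.filter (p · = i)).card ≤ (S.filter (p · = 0)).card ∧
        (S.filter (p · = 0)).card ≤ (S.filter (p · = i)).card + 1 := by
  obtain ⟨k, rfl⟩ : ∃ k, a = k + 1 := ⟨a - 1, by omega⟩
  have h0 : 0 ∈ Finset.range (k + 1) := by simp
  -- the cliques are nonempty
  have hcount := hp.card_indepSets
  rw [Finset.card_range] at hcount
  rw [hcount] at hpos'
  have hb : ∀ i ∈ Finset.range (k + 1), 0 < ((S.erase w).filter (p · = i)).card :=
    fun i hi => Nat.pos_of_ne_zero fun h => by
      rw [Finset.prod_eq_zero hi h] at hpos'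
      exact lt_irrefl 0 hpos'
  -- the centre has a neighbour in each clique
  have hnb : ∀ i ∈ Finset.range (k + 1), ∃ v ∈ (S.erase w).filter (p · = i), G.Adj w v := by
    intro i hi
    obtain ⟨u, hu, v, hv, hvT, huv⟩ := hconn ((S.erase w).filter (p · = i))
      ((Finset.filter_subset _ _).trans (Finset.erase_subset _ _)) (Finset.card_pos.1 (hb i hi))
      fun h => by
        have := h ▸ hw
        simp at this
    have hvw : v = w := by
      by_contra hvw
      have hv' : v ∈ S.erase w := Finset.mem_erase.2 ⟨hvw, hv⟩
      obtain ⟨hu', hui⟩ := Finset.mem_filter.1 hu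
      exact hvT (Finset.mem_filter.2 ⟨hv', ((hp.adj_iff u hu' v hv' huv.ne).1 huv) ▸ hui⟩)
    exact ⟨u, hu, (hvw ▸ huv).symm⟩
  have hwne : Nonempty V := ⟨w⟩
  choose! nb hnb hwnb using hnb
  have hFS : far G S w ⊆ S.erase w := fun v hv =>
    Finset.mem_erase.2 ⟨(mem_far.1 hv).2.1, (mem_far.1 hv).1⟩
  have hF : CliqueUnion G (far G S w) ((Finset.range (k + 1)).erase 0) p :=
    ⟨fun v hv => Finset.mem_erase.2 ⟨fun h => (mem_far.1 hv).2.2 (hadj v (hFS hv) h),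
      hp.mapsTo v (hFS hv)⟩, (hp.mono hFS).adj_iff⟩
  have hcardF : ((Finset.range (k + 1)).erase 0).card = k := by simp
  have hFcount := hF.card_indepSets
  rw [hcardF, ← card_indepSetsAt hw] at hFcount
  have hFsub : ∀ i ∈ Finset.range (k + 1),
      (far G S w).filter (p · = i) ⊆ ((S.erase w).filter (p · = i)).erase (nb i) := by
    intro i hi v hv
    obtain ⟨h1, h2⟩ := Finset.mem_filter.1 hv
    exact Finset.mem_erase.2 ⟨fun h => (mem_far.1 h1).2.2 (h ▸ hwnb i hi),
      Finset.mem_filter.2 ⟨hFS h1, h2⟩⟩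
  have hFle : ∀ i ∈ (Finset.range (k + 1)).erase 0, ((far G S w).filter (p · = i)).card ≤
      ((S.erase w).filter (p · = i)).card - 1 := by
    intro i hi
    have hi' := Finset.mem_of_mem_erase hi
    rw [← Finset.card_erase_of_mem (hnb i hi')]
    exact Finset.card_le_card (hFsub i hi')
  have hFpos : ∀ i ∈ (Finset.range (k + 1)).erase 0, 0 < ((far G S w).filter (p · = i)).card :=
    fun i hi => Nat.pos_of_ne_zero fun h => by
      rw [hFcount, Finset.prod_eq_zero hi h] at hpos
      exact lt_irrefl 0 hpos
  -- comparison with the star of cliques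
  set b : ℕ → ℕ := fun i => ((S.erase w).filter (p · = i)).card with hbdef
  set m : Multiset ℕ := ((Finset.range (k + 1)).erase 0).val.map b with hm
  have hmprod : m.prod = ∏ i ∈ (Finset.range (k + 1)).erase 0, b i := rfl
  have hmpred : (m.map (· - 1)).prod = ∏ i ∈ (Finset.range (k + 1)).erase 0, (b i - 1) := by
    rw [hm, Multiset.map_map]
    rfl
  have hmsum : b 0 + m.sum = (S.erase w).card := by
    rw [← hp.sum_card]
    exact Finset.add_sum_erase _ b h0
  have hmcard : m.card = k := by rw [hm, Multiset.card_map]; exact hcardF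
  have hm2 : ∀ x ∈ m, 2 ≤ x := by
    intro x hx
    obtain ⟨i, hi, rfl⟩ := Multiset.mem_map.1 hx
    have h1 := hFle i hi
    have h2 := hFpos i hi
    change _ ≤ b i - 1 at h1
    omega
  have hSw := Finset.card_erase_add_one hw
  obtain ⟨hstar, hstar_eq⟩ := starProd_le_and (k := b 0) (hb 0 h0) hm2
  rw [show b 0 + 1 + m.sum = S.card by omega, hmcard] at hstar hstar_eq
  have hN := card_indepSets_eq_add G S (k + 1) w
  rw [hcount, hFcount, ← Finset.mul_prod_erase _ _ h0] at hN
  have hprod := Finset.prod_le_prod' hFle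
  rw [starProd, hmprod, hmpred] at hstar hstar_eq
  change _ = b 0 * ∏ i ∈ (Finset.range (k + 1)).erase 0, b i + _ at hN
  change _ ≤ ∏ i ∈ (Finset.range (k + 1)).erase 0, (b i - 1) at hprod
  have hFeq : ∀ i ∈ (Finset.range (k + 1)).erase 0, ((far G S w).filter (p · = i)).card =
      ((S.erase w).filter (p · = i)).card - 1 := by
    by_contra hne
    push Not at hne
    obtain ⟨i, hi, hne⟩ := hne
    have := Finset.prod_lt_prod hFpos hFle ⟨i, hi, lt_of_le_of_ne (hFle i hi) hne⟩
    change _ < ∏ i ∈ (Finset.range (k + 1)).erase 0, (b i - 1) at this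
    omega
  have hFeq' : ∀ i ∈ (Finset.range (k + 1)).erase 0, (far G S w).filter (p · = i) =
      ((S.erase w).filter (p · = i)).erase (nb i) := by
    intro i hi
    have hi' := Finset.mem_of_mem_erase hi
    refine Finset.eq_of_subset_of_card_le (hFsub i hi') ?_
    rw [Finset.card_erase_of_mem (hnb i hi'), hFeq i hi]
  have hwadj : ∀ v ∈ S.erase w, (G.Adj w v ↔ 0 = p v ∨ p v ≠ 0 ∧ v = nb (p v)) := by
    intro v hv
    have hpv := hp.mapsTo v hv
    constructor
    · intro hwv
      by_cases h : p v = 0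
      · exact Or.inl h.symm
      · refine Or.inr ⟨h, ?_⟩
        by_contra hne
        have hmem : v ∈ ((S.erase w).filter (p · = p v)).erase (nb (p v)) :=
          Finset.mem_erase.2 ⟨hne, Finset.mem_filter.2 ⟨hv, rfl⟩⟩
        rw [← hFeq' (p v) (Finset.mem_erase.2 ⟨h, hpv⟩)] at hmem
        exact (mem_far.1 (Finset.mem_filter.1 hmem).1).2.2 hwv
    · rintro (h | ⟨-, h⟩)
      · exact hadj v hv h.symm
      · rw [h]
        exact hwnb _ hpv
  have hlinked : Linked G S (Finset.range (k + 1)) (fun v => if v = w then 0 else p v)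
      (fun i => if i = 0 then w else nb i) := by
    refine ⟨h0, fun v hv => ?_, fun i hi => ?_, fun i hi => ?_, ?_⟩
    · split_ifs with h
      · exact h0
      · exact hp.mapsTo v (Finset.mem_erase.2 ⟨h, hv⟩)
    · split_ifs with h
      · exact hw
      · exact Finset.mem_of_mem_erase (Finset.mem_filter.1 (hnb i hi)).1
    · obtain ⟨h1, h2⟩ := Finset.mem_filter.1 (hnb i hi)
      by_cases h : i = 0
      · simp [h]
      · rw [if_neg h, if_neg (Finset.ne_of_mem_erase h1), h2]
    · intro u hu v hv huv
      by_cases hu' : u = w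
      · subst hu'
        have hvu : v ≠ u := huv.symm
        rw [hwadj v (Finset.mem_erase.2 ⟨hvu, hv⟩)]
        by_cases hpv : p v = 0 <;> simp [hvu, hpv]
      · by_cases hv' : v = w
        · subst hv'
          rw [G.adj_comm, hwadj u (Finset.mem_erase.2 ⟨hu', hu⟩)]
          by_cases hpu : p u = 0 <;> simp [hu', hpu, eq_comm]
        · rw [hp.adj_iff u (Finset.mem_erase.2 ⟨hu', hu⟩) v (Finset.mem_erase.2 ⟨hv', hv⟩) huv]
          simp [hu', hv']
  have hc0 : (S.filter fun v => (if v = w then 0 else p v) = 0).card = b 0 + 1 := by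
    have : (S.filter fun v => (if v = w then 0 else p v) = 0) =
        insert w ((S.erase w).filter (p · = 0)) := by
      ext v
      by_cases h : v = w <;> simp [h, hw]
    rw [this, Finset.card_insert_of_notMem (by simp)]
  have hci : ∀ i, i ≠ 0 → (S.filter fun v => (if v = w then 0 else p v) = i).card = b i := by
    intro i hi
    rw [hbdef]
    congr 1
    ext v
    by_cases h : v = w
    · simp [h, hi.symm]
    · simp [h]
  have hb2 : ∀ i ≤ k, i ≠ 0 → b i ∈ m := fun i hi hi0 =>
    Multiset.mem_map_of_mem _ (Finset.mem_erase.2 ⟨hi0, Finset.mem_range.2 (by omega)⟩)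
  have hb0 : 0 < b 0 := hb 0 h0
  rcases hstar_eq (by omega) with hbal | hsingle
  · refine ⟨_, _, hlinked, fun i hi => ?_, fun i hi => ?_⟩
    · by_cases hi0 : i = 0
      · subst hi0
        rw [hc0]
        omega
      · rw [hci i hi0]
        exact hm2 _ (hb2 i (by omega) hi0)
    · by_cases hi0 : i = 0
      · subst hi0
        omega
      · rw [hci i hi0, hc0]
        have := hbal _ (hb2 i (by omega) hi0)
        omega
  -- The exceptional star has two cliques, the one without `w` being larger by one vertex.
  -- Exchanging their roles makes the larger clique the centre.
  · obtain rfl : k = 1 := by rw [← hmcard, hsingle]; rfl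
    have hb1 : b 1 = b 0 + 2 := by
      have := hb2 1 le_rfl one_ne_zero
      rwa [hsingle, Multiset.mem_singleton] at this
    have hsw : ∀ i < 2, (S.filter fun v => 1 - (if v = w then 0 else p v) = i).card =
        (S.filter fun v => (if v = w then 0 else p v) = 1 - i).card := by
      intro i hi
      congr 1
      refine Finset.filter_congr fun v hv => ?_
      have := Finset.mem_range.1 (hlinked.mapsTo v hv)
      generalize (if v = w then 0 else p v) = j at *
      omega
    have e0 := hsw 0 (by omega)
    have e1 := hsw 1 (by omega)
    rw [Nat.sub_zero, hci 1 one_ne_zero] at e0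
    rw [Nat.sub_self, hc0] at e1
    refine ⟨_, _, hlinked.swap, fun i hi => ?_, fun i hi => ?_⟩
    · interval_cases i
      · rw [e0]; omega
      · rw [e1]; omega
    · rw [e0]
      interval_cases i
      · rw [e0]; omega
      · rw [e1]; omega

/-- The structure of the graphs that attain the bound and have a centre. -/
lemma HasCentre.exists (hcen : HasCentre G S a) (hconn : Conn G S) (h : IndepLE G S a)
    (ha : 1 ≤ a) (heq : (indepSets G S a).card = connBound S.card a) :
    (S.card < 2 * a ∧ ∃ w ∈ S, ∃ p, CliqueUnion G (S.erase w) (Finset.range a) p ∧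
      (indepSets G (S.erase w) a).card = balancedProd (S.erase w).card a) ∨
    ∃ p z, Linked G S (Finset.range a) p z ∧ (∀ i < a, 2 ≤ (S.filter (p · = i)).card) ∧
      ∀ i < a, (S.filter (p · = i)).card ≤ (S.filter (p · = 0)).card ∧
        (S.filter (p · = 0)).card ≤ (S.filter (p · = i)).card + 1 := by
  obtain ⟨w, hw, hpos', p, hp⟩ := hcen
  -- If `w` lies in no maximum independent set, Zykov's bound for `S.erase w` must already reach
  -- `connBound`, so `reducedProd` vanishes.
  rcases Nat.eq_zero_or_pos (indepSetsAt G S a w).card with hzero | hpos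
  · have h1 := card_indepSets_eq_add G S a w
    have h2 := card_indepSets_le (h.mono (Finset.erase_subset w S))
    have h3 : connBound S.card a = balancedProd (S.card - 1) a + reducedProd S.card a := rfl
    rw [← Finset.card_erase_of_mem hw] at h3
    refine Or.inl ⟨?_, w, hw, p, hp, by omega⟩
    by_contra hn
    have := reducedProd_pos (n := S.card) (a := a) ha (by omega)
    omega
  · obtain ⟨p', hp', hadj⟩ := hp.exists_clique_adj h hw hpos
    exact Or.inr (exists_linked_of_adj hconn ha heq hw hpos hpos' hp' hadj)

end Linked

/-! ### Extremal graphs without cut vertex. -/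

section NoCutVertex

variable {V : Type*} [DecidableEq V] {G : SimpleGraph V}
variable {S T D E I J K : Finset V} {a b c k : ℕ} {x y u v w : V}
variable {s t : Finset ℕ} {p : V → ℕ} {z : ℕ → V}

lemma sum_card_indepSetsAt (G : SimpleGraph V) (S : Finset V) (a : ℕ) :
    ∑ v ∈ S, (indepSetsAt G S a v).card = (indepSets G S a).card * a := by
  rw [← sum_card_filter_mem, ← smul_eq_mul, ← Finset.sum_const]
  refine Finset.sum_congr rfl fun I hI => ?_
  obtain ⟨hIS, hc, -⟩ := mem_indepSets.1 hI
  rw [Finset.filter_mem_eq_inter, Finset.inter_eq_right.2 hIS, hc]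

lemma card_indepSetsAt_add_le (hxy : G.Adj x y) :
    (indepSetsAt G S a x).card + (indepSetsAt G S a y).card ≤ (indepSets G S a).card := by
  rw [← Finset.card_union_of_disjoint]
  · exact Finset.card_le_card
      (Finset.union_subset (Finset.filter_subset _ _) (Finset.filter_subset _ _))
  · rw [Finset.disjoint_left]
    intro I hx hy
    obtain ⟨hI, hxI⟩ := mem_indepSetsAt.1 hx
    exact (mem_indepSets.1 hI).2.2 x hxI y (mem_indepSetsAt.1 hy).2 hxy

/-- In an extremal graph without cut vertex, all vertices lie in the same number of maximum
independent sets. -/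
lemma card_indepSetsAt_eq (hconn : Conn G S) (h : IndepLE G S (k + 1)) (haS : k + 1 < S.card)
    (hcut : NoCut G S) (heq : (indepSets G S (k + 1)).card = connBound S.card (k + 1))
    (hx : x ∈ S) (hy : y ∈ S) :
    (indepSetsAt G S (k + 1) x).card = (indepSetsAt G S (k + 1) y).card := by
  -- Turning `v` into a twin of `u` changes the count by the difference of the two sides, and the
  -- new graph still obeys the bound.
  have hle : ∀ u ∈ S, ∀ v ∈ S, G.Adj u v →
      (indepSetsAt G S (k + 1) u).card ≤ (indepSetsAt G S (k + 1) v).card := by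
    intro u hu v hv huv
    have h1 := card_indepSets_twinGraph (k := k) hu hv huv
    have h2 := card_indepSets_le_connBound _ S (conn_twinGraph (hcut v hv) hu hv huv.ne) _
      (by omega) haS (h.twinGraph (y := v) hu)
    omega
  by_contra hne
  set T := S.filter fun v =>
    (indepSetsAt G S (k + 1) x).card = (indepSetsAt G S (k + 1) v).card with hT
  obtain ⟨u, hu, v, hv, hvT, huv⟩ := hconn T (Finset.filter_subset _ _)
    ⟨x, Finset.mem_filter.2 ⟨hx, rfl⟩⟩ fun hTS => by
      rw [← hTS] at hy
      exact hne (Finset.mem_filter.1 hy).2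
  obtain ⟨huS, hxu⟩ := Finset.mem_filter.1 hu
  exact hvT (Finset.mem_filter.2
    ⟨hv, hxu.trans ((hle u huS v hv huv).antisymm (hle v hv u huS huv.symm))⟩)

lemma card_mul_card_indepSetsAt (hconn : Conn G S) (h : IndepLE G S (k + 1))
    (haS : k + 1 < S.card) (hcut : NoCut G S)
    (heq : (indepSets G S (k + 1)).card = connBound S.card (k + 1)) (hx : x ∈ S) :
    S.card * (indepSetsAt G S (k + 1) x).card = (indepSets G S (k + 1)).card * (k + 1) := by
  rw [← sum_card_indepSetsAt, ← smul_eq_mul, ← Finset.sum_const]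
  exact Finset.sum_congr rfl fun v hv => card_indepSetsAt_eq hconn h haS hcut heq hx hv

/-- Let `m` be the common number of sets through a vertex and `N` the total. Then `S.card * m = N *
(k + 1)`, and `2 * m ≤ N` because no set contains both ends of an edge. -/
lemma two_mul_le_card (hconn : Conn G S) (h : IndepLE G S (k + 1))
    (haS : k + 1 < S.card) (hcut : NoCut G S)
    (heq : (indepSets G S (k + 1)).card = connBound S.card (k + 1)) :
    2 * (k + 1) ≤ S.card := by
  obtain ⟨x, hx⟩ := Finset.card_pos.1 (show 0 < S.card by omega)
  obtain ⟨y, hy, hxy⟩ := hconn.exists_adj (by omega) hx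
  have h1 := card_mul_card_indepSetsAt hconn h haS hcut heq hx
  have h2 := card_indepSetsAt_add_le (S := S) (a := k + 1) hxy
  rw [← card_indepSetsAt_eq hconn h haS hcut heq hx hy] at h2
  have hN : 0 < (indepSets G S (k + 1)).card := heq ▸ connBound_pos haS
  generalize (indepSetsAt G S (k + 1) x).card = m at *
  generalize (indepSets G S (k + 1)).card = N at *
  have hm : 0 < m := by
    rcases Nat.eq_zero_or_pos m with rfl | hm
    · have := Nat.mul_pos hN (show 0 < k + 1 by omega)
      omega
    · exact hm
  refine Nat.le_of_mul_le_mul_right (c := m) ?_ hm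
  rw [h1]
  nlinarith [Nat.mul_le_mul_right (k + 1) h2]

/-- `S` has five vertices, each of them with two neighbours in `S`, and `a = 2`. -/
def IsPentagon (G : SimpleGraph V) (S : Finset V) (a : ℕ) : Prop :=
  S.card = 5 ∧ a = 2 ∧ ∀ v ∈ S, (near G S v).card = 3

/-- With a twin `y`, all three vertices in the closed neighbourhood of `x` would have it as their
own closed neighbourhood, so it would be a whole component. -/
lemma IsPentagon.not_isTwin (h : IsPentagon G S a) (hconn : Conn G S) (hx : x ∈ S) (hy : y ∈ S)
    (hxy : G.Adj x y) : ¬ IsTwin G S x y := by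
  intro htwin
  obtain ⟨h5, -, h3⟩ := h
  have hnear : ∀ u ∈ near G S x, near G S x ⊆ near G S u := by
    intro u hu v hv
    obtain ⟨huS, hu⟩ := mem_near.1 hu
    obtain ⟨hvS, hv⟩ := mem_near.1 hv
    refine mem_near.2 ⟨hvS, ?_⟩
    by_cases hvu : v = u
    · exact Or.inl hvu
    refine Or.inr ?_
    have hyadj : ∀ z ∈ S, G.Adj x z → z ≠ y → G.Adj y z := fun z hz hxz hzy =>
      (htwin z hz hxz.ne' hzy).1 hxz
    rcases hu with rfl | hxu
    · exact hv.resolve_left hvu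
    rcases hv with rfl | hxv
    · exact hxu.symm
    by_cases huy : u = y
    · subst huy
      exact hyadj v hvS hxv hvu
    by_cases hvy : v = y
    · subst hvy
      exact (hyadj u huS hxu huy).symm
    -- otherwise the closed neighbourhood of `x` would contain four vertices
    exfalso
    have hsub : ({x, y, u, v} : Finset V) ⊆ near G S x := by
      intro w hw
      simp only [Finset.mem_insert, Finset.mem_singleton] at hw
      rcases hw with rfl | rfl | rfl | rfl
      · exact mem_near.2 ⟨hx, Or.inl rfl⟩
      · exact mem_near.2 ⟨hy, Or.inr hxy⟩
      · exact mem_near.2 ⟨huS, Or.inr hxu⟩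
      · exact mem_near.2 ⟨hvS, Or.inr hxv⟩
    have hcard : ({x, y, u, v} : Finset V).card = 4 := by
      rw [Finset.card_insert_of_notMem, Finset.card_insert_of_notMem,
        Finset.card_insert_of_notMem, Finset.card_singleton]
      · simpa using Ne.symm hvu
      · simp [Ne.symm huy, Ne.symm hvy]
      · simp [hxy.ne, hxu.ne, hxv.ne]
    have := Finset.card_le_card hsub
    rw [hcard, h3 x hx] at this
    omega
  obtain ⟨u, hu, v, hv, hvx, huv⟩ := hconn (near G S x) (fun v hv => (mem_near.1 hv).1)
    ⟨x, mem_near.2 ⟨hx, Or.inl rfl⟩⟩ fun h => by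
      have := h3 x hx
      rw [h] at this
      omega
  have hu' := (mem_near.1 hu).1
  have := Finset.eq_of_subset_of_card_le (hnear u hu) (by rw [h3 x hx, h3 u hu'])
  exact hvx (this ▸ mem_near.2 ⟨hv, Or.inr huv⟩)

/-- A linking vertex has no adjacent twin: other vertices of its clique lack its link, and the other
end of a link is distinguished from it by a second vertex of a clique. -/
lemma Linked.ne_of_isTwin (h : Linked G S (Finset.range a) p z) (ha : 2 ≤ a)
    (hsize : ∀ i < a, 2 ≤ (S.filter (p · = i)).card) (hx : x ∈ S) (hy : y ∈ S)
    (hxy : G.Adj x y) (htwin : IsTwin G S x y) : x ≠ z (p x) := by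
  intro hxz
  have hex : ∀ i < a, ∃ u ∈ S, p u = i ∧ u ≠ z i := by
    intro i hi
    obtain ⟨u, hu, hne⟩ := Finset.exists_mem_ne
      (show 1 < (S.filter (p · = i)).card by have := hsize i hi; omega) (z i)
    obtain ⟨huS, hui⟩ := Finset.mem_filter.1 hu
    exact ⟨u, huS, hui, hne⟩
  have h0 : 0 ∈ Finset.range a := h.zero_mem
  have hz0S := h.mem 0 h0
  have hz0 := h.apply_z 0 h0
  have hpx := h.mapsTo x hx
  have hpy := h.mapsTo y hy
  have hadj := (h.adj_iff x hx y hy hxy.ne).1 hxy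
  by_cases hx0 : p x = 0
  · have h1 : 1 ∈ Finset.range a := Finset.mem_range.2 (by omega)
    have hz1S := h.mem 1 h1
    have hz1 := h.apply_z 1 h1
    rw [hx0] at hxz
    subst hxz
    have hne : z 0 ≠ z 1 := fun h => by rw [← h, hz0] at hz1; omega
    have hadj1 : G.Adj (z 0) (z 1) :=
      (h.adj_iff _ hz0S _ hz1S hne).2 (Or.inr (Or.inl ⟨rfl, by rw [hz1]⟩))
    by_cases hy1 : y = z 1
    · subst hy1
      obtain ⟨u, huS, hu1, hu⟩ := hex 1 (by omega)
      have hu0 : u ≠ z 0 := fun h => by rw [h, hz0] at hu1; omega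
      have hyu := (htwin u huS hu0 hu).2 ((h.adj_iff _ hz1S _ huS hu.symm).2
        (Or.inl (by rw [hz1, hu1])))
      rw [h.adj_iff _ hz0S _ huS hu0.symm, hz0, hu1] at hyu
      rcases hyu with h' | ⟨-, h'⟩ | ⟨h', -⟩
      · omega
      · exact hu h'
      · exact hu0 h'
    · have hyz := (htwin (z 1) hz1S hne.symm (Ne.symm hy1)).1 hadj1
      rw [h.adj_iff _ hy _ hz1S hy1, hz1] at hyz
      have hpy1 : p y = 1 := by
        rcases hyz with h' | ⟨h', -⟩ | ⟨h', -⟩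
        · exact h'
        · exact absurd h' hxy.ne'
        · exact absurd h'.symm hne
      rw [hpy1, hz0] at hadj
      rcases hadj with h' | ⟨-, h'⟩ | ⟨h', -⟩
      · omega
      · exact hy1 h'
      · exact hxy.ne h'.symm
  · have hxz0 : x ≠ z 0 := fun h => hx0 (h ▸ hz0)
    have hadj0 : G.Adj x (z 0) := (h.adj_iff _ hx _ hz0S hxz0).2 (Or.inr (Or.inr ⟨rfl, hxz⟩))
    by_cases hy0 : y = z 0
    · subst hy0
      obtain ⟨u, huS, hu0, hu⟩ := hex 0 (by omega)
      have hux : u ≠ x := fun h => hx0 (h ▸ hu0)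
      have hxu := (htwin u huS hux hu).2 ((h.adj_iff _ hz0S _ huS hu.symm).2
        (Or.inl (by rw [hz0, hu0])))
      rw [h.adj_iff _ hx _ huS hux.symm, hu0] at hxu
      rcases hxu with h' | ⟨h', -⟩ | ⟨h', -⟩
      · exact hx0 h'
      · exact hxz0 h'
      · exact hu h'
    · have hyz := (htwin (z 0) hz0S hxz0.symm (Ne.symm hy0)).1 hadj0
      have hpxy : p x = p y := by
        rcases hadj with h' | ⟨h', -⟩ | ⟨h', -⟩
        · exact h'
        · exact absurd h' hxz0
        · exact absurd h' hy0
      rw [h.adj_iff _ hy _ hz0S hy0, hz0] at hyz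
      rcases hyz with h' | ⟨h', -⟩ | ⟨-, h'⟩
      · omega
      · exact hy0 h'
      · rw [← hpxy, ← hxz] at h'
        exact hxy.ne h'.symm

lemma card_filter_filter_ne {i j : ℕ} (hij : i ≠ j) :
    ((S.filter (p · ≠ j)).filter (p · = i)).card = (S.filter (p · = i)).card := by
  rw [Finset.filter_filter]
  congr 1
  refine Finset.filter_congr fun v _ => ?_
  constructor
  · exact fun h => h.2
  · rintro rfl
    exact ⟨hij, rfl⟩

/-- An extremal graph without cut vertex in which turning a vertex into a twin of a neighbour
creates a cut vertex is a cycle of order five. -/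
lemma isPentagon_of_twinGraph (hconn : Conn G S) (h : IndepLE G S a) (ha : 2 ≤ a)
    (haS : a < S.card) (hcut : NoCut G S)
    (heq : (indepSets G S a).card = connBound S.card a) (hx : x ∈ S) (hy : y ∈ S)
    (hxy : G.Adj x y) (hcut' : ¬ NoCut (twinGraph G x y) S) : IsPentagon G S a := by
  obtain ⟨k, rfl⟩ : ∃ k, a = k + 1 := ⟨a - 1, by omega⟩
  have hall : ∀ v ∈ S, (indepSetsAt G S (k + 1) x).card = (indepSetsAt G S (k + 1) v).card :=
    fun v hv => card_indepSetsAt_eq hconn h haS hcut heq hx hv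
  have hcount := card_mul_card_indepSetsAt hconn h haS hcut heq hx
  have h2a := two_mul_le_card hconn h haS hcut heq
  have heq' := card_indepSets_twinGraph (k := k) hx hy hxy
  rw [hall y hy, Nat.add_right_cancel_iff] at heq'
  have hconn' := conn_twinGraph (hcut y hy) hx hy hxy.ne
  have hle' := h.twinGraph (y := y) hx
  have hxy' : (twinGraph G x y).Adj x y := ((twinGraph_adj_right hxy.ne).2 (Or.inl rfl)).symm
  have htwin := isTwin_twinGraph (G := G) (S := S) hxy.ne
  have hm := card_indepSetsAt_twinGraph_self (k := k) hx hxy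
  have hGadj : ∀ u v, u ≠ y → v ≠ y → G.Adj u v → (twinGraph G x y).Adj u v :=
    fun u v hu hv huv => (twinGraph_adj hu hv).2 huv
  -- The twin graph is extremal too, because all vertices of `G` lie in equally many sets. Having a
  -- cut vertex, it is a balanced star; the alternative contradicts `h2a`.
  obtain ⟨hlt, -⟩ | ⟨p, z, hL, hsize, hbal⟩ :=
    (hasCentre_of_not_noCut hconn' hle' haS (heq'.trans heq) hcut').exists hconn' hle'
      (by omega) (heq'.trans heq)
  · omega
  have hN := hL.card_indepSets
  rw [Finset.card_range, heq'] at hN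
  have h0 := hL.zero_mem
  have hz0 := hL.apply_z 0 h0
  have hxz := hL.ne_of_isTwin ha hsize hx hy hxy' htwin
  have hyz := hL.ne_of_isTwin ha hsize hy hx hxy'.symm
    fun w hw h1 h2 => (htwin w hw h2 h1).symm
  have hx0 : x ≠ z 0 := fun h' => hxz (by rw [h', hz0])
  have hy0 : y ≠ z 0 := fun h' => hyz (by rw [h', hz0])
  have hpxy : p x = p y := by
    rcases (hL.adj_iff x hx y hy hxy.ne).1 hxy' with h' | ⟨h', -⟩ | ⟨h', -⟩
    · exact h'
    · exact absurd h' hx0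
    · exact absurd h' hy0
  have hzy : ∀ i ∈ Finset.range (k + 1), z i ≠ y := fun i hi h' => hyz (by
    rw [← h', hL.apply_z i hi])
  have hfarx : far (twinGraph G x y) S x = S.filter (p · ≠ p x) := by
    ext v
    rw [mem_far, Finset.mem_filter]
    refine and_congr_right fun hv => ?_
    constructor
    · rintro ⟨h1, h2⟩ h3
      exact h2 ((hL.adj_iff x hx v hv h1.symm).2 (Or.inl h3.symm))
    · intro h1
      have hvx : v ≠ x := fun h' => h1 (by rw [h'])
      refine ⟨hvx, fun hadj => ?_⟩
      rcases (hL.adj_iff x hx v hv hvx.symm).1 hadj with h' | ⟨h', -⟩ | ⟨-, h'⟩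
      · exact h1 h'.symm
      · exact hx0 h'
      · exact hxz h'
  rw [card_indepSetsAt hx, hfarx] at hm
  -- each clique contains a neighbour of `y`
  have hnb : ∀ i ∈ Finset.range (k + 1), i ≠ p y → ∃ v ∈ S, p v = i ∧ G.Adj y v := by
    intro i hi hiy
    -- In the twin graph a clique without `z 0` is linked to the rest only through `z 0`. As `z 0`
    -- is no cut vertex of `G`, an edge of `G` must lead from this clique to `y`.
    obtain ⟨u, hu, v, hv, hvT, huv⟩ := hcut (z 0) (hL.mem 0 h0)
      ((S.erase (z 0)).filter (p · = i)) (Finset.filter_subset _ _) (by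
        obtain ⟨u, hu, hne⟩ := Finset.exists_mem_ne (show 1 < (S.filter (p · = i)).card by
          have := hsize i (Finset.mem_range.1 hi); omega) (z 0)
        obtain ⟨huS, hui⟩ := Finset.mem_filter.1 hu
        exact ⟨u, Finset.mem_filter.2 ⟨Finset.mem_erase.2 ⟨hne, huS⟩, hui⟩⟩) fun h' => by
          have : y ∈ S.erase (z 0) := Finset.mem_erase.2 ⟨hy0, hy⟩
          rw [← h'] at this
          exact hiy (Finset.mem_filter.1 this).2.symm
    obtain ⟨huS, hui⟩ := Finset.mem_filter.1 hu
    obtain ⟨hu0, huS⟩ := Finset.mem_erase.1 huS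
    obtain ⟨hv0, hvS⟩ := Finset.mem_erase.1 hv
    have huy : u ≠ y := fun h' => hiy (by rw [← h', hui])
    have hvy : v = y := by
      by_contra hvy
      rcases (hL.adj_iff u huS v hvS huv.ne).1 (hGadj u v huy hvy huv) with h' | ⟨h', -⟩ | ⟨h', -⟩
      · exact hvT (Finset.mem_filter.2 ⟨hv, h' ▸ hui⟩)
      · exact hu0 h'
      · exact hv0 h'
    exact ⟨u, huS, hui, (hvy ▸ huv).symm⟩
  -- neighbours of `y` lie in as many maximum independent sets as before
  have hAt : ∀ v ∈ S, G.Adj y v → (indepSetsAt G S (k + 1) x).card ≤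
      (indepSets (twinGraph G x y) ((S.erase y).filter (p · ≠ p v)) k).card := by
    intro v hv hyv
    rw [hall v hv, card_indepSetsAt hv,
      ← indepSets_twinGraph (x := x) (notMem_far_of_adj (S := S) hyv.symm)]
    refine Finset.card_le_card (indepSets_mono fun u hu => ?_)
    obtain ⟨huS, huv, hadj⟩ := mem_far.1 hu
    have huy : u ≠ y := fun h' => hadj (h' ▸ hyv.symm)
    refine Finset.mem_filter.2 ⟨Finset.mem_erase.2 ⟨huy, huS⟩, fun h' => hadj ?_⟩
    exact (twinGraph_adj hyv.ne' huy).1 ((hL.adj_iff v hv u huS huv.symm).2 (Or.inl h'.symm))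
  have hsize_erase : ∀ i j, i ≠ j → (((S.erase y).filter (p · ≠ j)).filter (p · = i)).card =
      (S.filter (p · = i)).card - if i = p y then 1 else 0 := by
    intro i j hij
    rw [card_filter_filter_ne hij, Finset.filter_erase]
    split_ifs with hi
    · rw [Finset.card_erase_of_mem (Finset.mem_filter.2 ⟨hy, hi.symm⟩)]
    · rw [Finset.erase_eq_of_notMem, Nat.sub_zero]
      exact fun h' => hi (Finset.mem_filter.1 h').2.symm
  have hcardk : ∀ i ∈ Finset.range (k + 1), ((Finset.range (k + 1)).erase i).card = k := by
    intro i hi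
    rw [Finset.card_erase_of_mem hi, Finset.card_range, Nat.add_sub_cancel]
  have h1 : 1 ∈ Finset.range (k + 1) := Finset.mem_range.2 (by omega)
  -- Let `c i` be the clique orders in the twin graph. If the twins lie in the centre clique,
  -- comparing the sets through `x` with those through a neighbour of `y` in clique 1 gives `c 1 * P
  -- ≤ (c 0 - 2) * P + Q`, where `P` and `Q` are the products of `c i` and of `c i - 1` over the
  -- other indices. Since `c 0 ≤ c 1 + 1`, there are only two cliques and `c 0 = c 1 + 1`.
  by_cases hpx0 : p x = 0
  · obtain ⟨v, hv, hv1, hyv⟩ := hnb 1 h1 (by rw [← hpxy, hpx0]; omega)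
    have hAtv := hAt v hv hyv
    rw [hv1] at hAtv
    have h01 : 0 ∈ (Finset.range (k + 1)).erase 1 := Finset.mem_erase.2 ⟨by omega, h0⟩
    have h10 : 1 ∈ (Finset.range (k + 1)).erase 0 := Finset.mem_erase.2 ⟨by omega, h1⟩
    have hLT : Linked (twinGraph G x y) ((S.erase y).filter (p · ≠ 1))
        ((Finset.range (k + 1)).erase 1) p z := by
      refine hL.mono ((Finset.filter_subset _ _).trans (Finset.erase_subset _ _))
        (Finset.erase_subset _ _) h01 (fun v hv => ?_) fun i hi => ?_
      · obtain ⟨hv, hv1⟩ := Finset.mem_filter.1 hv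
        exact Finset.mem_erase.2 ⟨hv1, hL.mapsTo v (Finset.mem_of_mem_erase hv)⟩
      · obtain ⟨hi1, hi⟩ := Finset.mem_erase.1 hi
        exact Finset.mem_filter.2 ⟨Finset.mem_erase.2 ⟨hzy i hi, hL.mem i hi⟩,
          by rwa [hL.apply_z i hi]⟩
    have hTcount := hLT.card_indepSets
    have hTi : ∀ i ∈ ((Finset.range (k + 1)).erase 1).erase 0,
        (((S.erase y).filter (p · ≠ 1)).filter (p · = i)).card = (S.filter (p · = i)).card := by
      intro i hi
      obtain ⟨hi0, hi⟩ := Finset.mem_erase.1 hi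
      rw [hsize_erase i 1 (Finset.ne_of_mem_erase hi), ← hpxy, hpx0, if_neg hi0, Nat.sub_zero]
    rw [hcardk 1 h1, hsize_erase 0 1 (by omega), ← hpxy, hpx0, if_pos rfl,
      Finset.prod_congr rfl hTi,
      Finset.prod_congr rfl fun i hi => congrArg (· - 1) (hTi i hi)] at hTcount
    have hX : CliqueUnion (twinGraph G x y) (S.filter (p · ≠ p x))
        ((Finset.range (k + 1)).erase 0) p := by
      refine hL.cliqueUnion_of_notMem (Finset.filter_subset _ _) (fun h' => ?_) fun v hv => ?_
      · exact (Finset.mem_filter.1 h').2 (hz0.trans hpx0.symm)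
      · obtain ⟨hv, hv0⟩ := Finset.mem_filter.1 hv
        exact Finset.mem_erase.2 ⟨fun h' => hv0 (h'.trans hpx0.symm), hL.mapsTo v hv⟩
    have hXcount := hX.card_indepSets
    rw [hcardk 0 h0, hm, Finset.prod_congr rfl fun i hi => card_filter_filter_ne
      (show i ≠ p x by rw [hpx0]; exact Finset.ne_of_mem_erase hi),
      ← Finset.mul_prod_erase _ _ h10, Finset.erase_right_comm] at hXcount
    rw [hTcount, hXcount] at hAtv
    set c : ℕ → ℕ := fun i => (S.filter (p · = i)).card with hc
    set s := ((Finset.range (k + 1)).erase 1).erase 0 with hs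
    change c 1 * ∏ i ∈ s, c i ≤ (c 0 - 1 - 1) * ∏ i ∈ s, c i + ∏ i ∈ s, (c i - 1) at hAtv
    have hcs : ∀ i ∈ s, 2 ≤ c i := fun i hi => hsize i
      (Finset.mem_range.1 (Finset.mem_of_mem_erase (Finset.mem_of_mem_erase hi)))
    have hR : 0 < ∏ i ∈ s, c i := Finset.prod_pos fun i hi => by
      have := hcs i hi
      omega
    have hc1 : 2 ≤ c 1 := hsize 1 (by omega)
    have hc01 : c 1 ≤ c 0 ∧ c 0 ≤ c 1 + 1 := hbal 1 (by omega)
    have hempty : s = ∅ := by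
      by_contra hne
      obtain ⟨i, hi⟩ := Finset.nonempty_iff_ne_empty.2 hne
      have hlt : ∏ i ∈ s, (c i - 1) < ∏ i ∈ s, c i := Finset.prod_lt_prod
        (fun i hi => by have := hcs i hi; omega) (fun i _ => Nat.sub_le _ _)
        ⟨i, hi, by have := hcs i hi; omega⟩
      have h3 : (c 0 - 1 - 1) * ∏ i ∈ s, c i ≤ (c 1 - 1) * ∏ i ∈ s, c i :=
        Nat.mul_le_mul_right _ (by omega)
      have h4 : c 1 * ∏ i ∈ s, c i = (c 1 - 1) * ∏ i ∈ s, c i + ∏ i ∈ s, c i := by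
        rw [← Nat.succ_mul]
        congr 1
        omega
      omega
    obtain rfl : k = 1 := by
      have : s.card = k - 1 := by
        rw [hs, Finset.card_erase_of_mem h01, hcardk 1 h1]
      rw [hempty, Finset.card_empty] at this
      omega
    rw [hempty] at hAtv hXcount
    simp only [Finset.prod_empty, mul_one] at hAtv hXcount
    have hsum : c 0 + c 1 = S.card := by
      have := Finset.card_eq_sum_card_fiberwise hL.mapsTo
      rw [this, Finset.sum_range_succ, Finset.sum_range_one]
    have herase : (Finset.range (1 + 1)).erase 0 = {1} := by decide
    rw [herase, Finset.prod_singleton, Finset.prod_singleton] at hN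
    change _ = (c 0 - 1) * c 1 + (c 1 - 1) at hN
    change _ = c 1 at hXcount
    have hc0 : c 0 = c 1 + 1 := by omega
    rw [hN, hXcount, ← hsum, hc0, Nat.add_sub_cancel] at hcount
    -- `hcount` now reads `(2 * c 1 + 1) * c 1 = 2 * (c 1 ^ 2 + c 1 - 1)`, whence `c 1 = 2` and
    -- there are five vertices.
    obtain ⟨d, hd⟩ : ∃ d, c 1 = d + 2 := ⟨c 1 - 2, by omega⟩
    have hd0 : d = 0 := by
      rw [hd, show d + 2 - 1 = d + 1 by omega] at hcount
      nlinarith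
    refine ⟨by omega, rfl, fun v hv => ?_⟩
    have h3 := card_near_add_card_far G S v
    have h4 := hall v hv
    rw [card_indepSetsAt (k := 1) hv, card_indepSets_one] at h4
    omega
  -- If the twins lie in another clique `j`, a neighbour of `y` in the centre clique gives `(c 0 -
  -- 1) * P + Q ≤ (c j - 1) * P`, against `c j ≤ c 0` and `Q > 0`.
  · exfalso
    obtain ⟨v, hv, hv0, hyv⟩ := hnb 0 h0 (by rw [← hpxy]; exact Ne.symm hpx0)
    have hAtv := hAt v hv hyv
    rw [hv0] at hAtv
    have hj : p x ∈ Finset.range (k + 1) := hL.mapsTo x hx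
    have h0j : 0 ∈ (Finset.range (k + 1)).erase (p x) := Finset.mem_erase.2 ⟨Ne.symm hpx0, h0⟩
    have hj0 : p x ∈ (Finset.range (k + 1)).erase 0 := Finset.mem_erase.2 ⟨hpx0, hj⟩
    have hT : CliqueUnion (twinGraph G x y) ((S.erase y).filter (p · ≠ 0))
        ((Finset.range (k + 1)).erase 0) p := by
      refine hL.cliqueUnion_of_notMem ((Finset.filter_subset _ _).trans (Finset.erase_subset _ _))
        (fun h' => (Finset.mem_filter.1 h').2 hz0) fun v hv => ?_
      obtain ⟨hv, hv0⟩ := Finset.mem_filter.1 hv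
      exact Finset.mem_erase.2 ⟨hv0, hL.mapsTo v (Finset.mem_of_mem_erase hv)⟩
    have hTcount := hT.card_indepSets
    have hTi : ∀ i ∈ ((Finset.range (k + 1)).erase 0).erase (p x),
        (((S.erase y).filter (p · ≠ 0)).filter (p · = i)).card = (S.filter (p · = i)).card := by
      intro i hi
      obtain ⟨hij, hi⟩ := Finset.mem_erase.1 hi
      rw [hsize_erase i 0 (Finset.ne_of_mem_erase hi), ← hpxy, if_neg hij, Nat.sub_zero]
    rw [hcardk 0 h0, ← Finset.mul_prod_erase _ _ hj0, Finset.prod_congr rfl hTi,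
      hsize_erase (p x) 0 hpx0, ← hpxy, if_pos rfl, Finset.erase_right_comm] at hTcount
    have hX : Linked (twinGraph G x y) (S.filter (p · ≠ p x))
        ((Finset.range (k + 1)).erase (p x)) p z := by
      refine hL.mono (Finset.filter_subset _ _) (Finset.erase_subset _ _) h0j (fun v hv => ?_)
        fun i hi => ?_
      · obtain ⟨hv, hvx⟩ := Finset.mem_filter.1 hv
        exact Finset.mem_erase.2 ⟨hvx, hL.mapsTo v hv⟩
      · obtain ⟨hij, hi⟩ := Finset.mem_erase.1 hi
        exact Finset.mem_filter.2 ⟨hL.mem i hi, by rwa [hL.apply_z i hi]⟩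
    have hXcount := hX.card_indepSets
    have hXi : ∀ i ∈ ((Finset.range (k + 1)).erase (p x)).erase 0,
        ((S.filter (p · ≠ p x)).filter (p · = i)).card = (S.filter (p · = i)).card :=
      fun i hi => card_filter_filter_ne (Finset.ne_of_mem_erase (Finset.mem_of_mem_erase hi))
    rw [hcardk _ hj, hm, card_filter_filter_ne (Ne.symm hpx0), Finset.prod_congr rfl hXi,
      Finset.prod_congr rfl fun i hi => congrArg (· - 1) (hXi i hi)] at hXcount
    have hQ : 0 < ∏ i ∈ ((Finset.range (k + 1)).erase (p x)).erase 0,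
        ((S.filter (p · = i)).card - 1) := Finset.prod_pos fun i hi => by
      have := hsize i
        (Finset.mem_range.1 (Finset.mem_of_mem_erase (Finset.mem_of_mem_erase hi)))
      omega
    have hle : ((S.filter (p · = p x)).card - 1) *
        ∏ i ∈ ((Finset.range (k + 1)).erase (p x)).erase 0, (S.filter (p · = i)).card ≤
        ((S.filter (p · = 0)).card - 1) *
        ∏ i ∈ ((Finset.range (k + 1)).erase (p x)).erase 0, (S.filter (p · = i)).card :=
      Nat.mul_le_mul_right _ (Nat.sub_le_sub_right (hbal _ (Finset.mem_range.1 hj)).1 1)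
    omega

/-- Turning a neighbour `y` into a twin of `x` preserves extremality. If no cut vertex arose,
induction on the number of non-twins would make the new graph a five-cycle, which has no adjacent
twins. So a cut vertex arises and `isPentagon_of_twinGraph` applies. -/
theorem isPentagon_of_noCut (m : ℕ) : ∀ (G : SimpleGraph V) (x : V), Conn G S →
    IndepLE G S a → 2 ≤ a → a < S.card → NoCut G S →
    (indepSets G S a).card = connBound S.card a → x ∈ S → (nonTwins G S x).card = m →
    IsPentagon G S a := by
  induction m using Nat.strong_induction_on with
  | _ m ih =>
  intro G x hconn h ha haS hcut heq hx hm
  obtain ⟨k, rfl⟩ : ∃ k, a = k + 1 := ⟨a - 1, by omega⟩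
  rcases (nonTwins G S x).eq_empty_or_nonempty with hempty | ⟨y, hyn⟩
  · exfalso
    have hN : 0 < (indepSets G S (k + 1)).card := heq ▸ connBound_pos haS
    have h1 := card_mul_card_indepSetsAt hconn h haS hcut heq hx
    have hpos : 0 < (indepSetsAt G S (k + 1) x).card := by
      refine Nat.pos_of_ne_zero fun h0 => ?_
      rw [h0] at h1
      have := Nat.mul_pos hN (show 0 < k + 1 by omega)
      omega
    have := indepLE_one_of_nonTwins_eq_empty hconn hx hempty hpos
    omega
  · obtain ⟨hy, hxy, -⟩ := mem_nonTwins.1 hyn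
    by_cases hcut' : NoCut (twinGraph G x y) S
    · exfalso
      have h1 := card_indepSets_twinGraph (k := k) hx hy hxy
      rw [card_indepSetsAt_eq hconn h haS hcut heq hx hy, Nat.add_right_cancel_iff] at h1
      have hconn' := conn_twinGraph (hcut y hy) hx hy hxy.ne
      have hpent := ih _ (hm ▸ card_nonTwins_twinGraph_lt hyn) (twinGraph G x y) x hconn'
        (h.twinGraph hx) ha haS hcut' (h1.trans heq) hx rfl
      exact hpent.not_isTwin hconn' hx hy ((twinGraph_adj_right hxy.ne).2 (Or.inl rfl)).symm
        (isTwin_twinGraph hxy.ne)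
    · exact isPentagon_of_twinGraph hconn h ha haS hcut heq hx hy hxy hcut'

/-- The graphs that attain the bound have a centre or are cycles of order five. -/
theorem hasCentre_or_isPentagon (hconn : Conn G S) (h : IndepLE G S a) (ha : 1 ≤ a)
    (haS : a < S.card) (heq : (indepSets G S a).card = connBound S.card a) :
    HasCentre G S a ∨ IsPentagon G S a := by
  obtain ⟨x, hx⟩ := Finset.card_pos.1 (show 0 < S.card by omega)
  by_cases hcut : NoCut G S
  · rcases eq_or_lt_of_le ha with rfl | ha
    · refine Or.inl ⟨x, hx, ?_, fun _ => 0, by simp, ?_⟩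
      · rw [card_indepSets_one, Finset.card_erase_of_mem hx]
        omega
      · intro u hu v hv huv
        simp [adj_of_indepLE_one h (Finset.mem_of_mem_erase hu) (Finset.mem_of_mem_erase hv) huv]
    · exact Or.inr (isPentagon_of_noCut _ G x hconn h ha haS hcut heq hx rfl)
  · exact Or.inl (hasCentre_of_not_noCut hconn h haS heq hcut)

end NoCutVertex

/-! ### Numbering vertices so that balanced classes become residue classes. -/

section Residues

/-- Entries that differ by at most one are determined by their number and their sum, through
division with remainder. -/
lemma eq_replicate_add_replicate {m : Multiset ℕ} (h : ∀ x ∈ m, ∀ y ∈ m, x ≤ y + 1) :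
    m = Multiset.replicate (m.card - m.sum % m.card) (m.sum / m.card) +
      Multiset.replicate (m.sum % m.card) (m.sum / m.card + 1) := by
  rcases m.empty_or_exists_mem with rfl | hne
  · simp
  have hex : ∃ k, k ∈ m := hne
  have hmin := Nat.find_spec hex
  obtain ⟨u, r, hm⟩ := exists_eq_replicate_add (m := m) (k := Nat.find hex) fun x hx => by
    have h1 := h x hx _ hmin
    have h2 := Nat.find_min' hex hx
    omega
  generalize Nat.find hex = k at *
  have hu : 0 < u := by
    rcases Nat.eq_zero_or_pos u with rfl | hu
    · rw [hm, Multiset.replicate_zero, zero_add, Multiset.mem_replicate] at hmin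
      omega
    · exact hu
  have hc : m.card = u + r := by rw [hm]; simp
  have hs : m.sum = (u + r) * k + r := by
    rw [hm]
    simp
    ring
  have h1 : m.sum / m.card = k := by
    rw [hc, hs, Nat.mul_add_div (by omega), Nat.div_eq_of_lt (by omega), add_zero]
  have h2 : m.sum % m.card = r := by
    rw [hc, hs, Nat.mul_add_mod, Nat.mod_eq_of_lt (by omega)]
  rw [h1, h2, hc, Nat.add_sub_cancel]
  exact hm

/-- Two families of natural numbers with the same sum, each of them as equal as possible, agree up
to a permutation. -/
lemma exists_perm_of_balanced {ι : Type*} [Fintype ι] {f g : ι → ℕ}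
    (hf : ∀ i j, f i ≤ f j + 1) (hg : ∀ i j, g i ≤ g j + 1) (h : ∑ i, f i = ∑ i, g i) :
    ∃ σ : Equiv.Perm ι, ∀ i, g (σ i) = f i := by
  classical
  have key : ∀ f : ι → ℕ, (∀ i j, f i ≤ f j + 1) →
      Finset.univ.val.map f = _ := fun f hf =>
    eq_replicate_add_replicate (m := Finset.univ.val.map f) (by
      simp only [Multiset.mem_map]
      rintro x ⟨i, -, rfl⟩ y ⟨j, -, rfl⟩
      exact hf i j)
  have hfg : Finset.univ.val.map f = Finset.univ.val.map g := by
    rw [key f hf, key g hg]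
    have hsum : (Finset.univ.val.map f).sum = (Finset.univ.val.map g).sum := h
    rw [hsum, Multiset.card_map, Multiset.card_map]
  have hfib : ∀ c, Nonempty ({i // f i = c} ≃ {i // g i = c}) := by
    intro c
    rw [← Fintype.card_eq, Fintype.card_subtype, Fintype.card_subtype]
    have := congrArg (Multiset.count c) hfg
    rw [Multiset.count_map, Multiset.count_map] at this
    simp only [@eq_comm _ c] at this
    exact this
  exact ⟨Equiv.ofFiberEquiv fun c => (hfib c).some, fun i => Equiv.ofFiberEquiv_map _ i⟩

/-- The residue class of `i` modulo `a` among the natural numbers less than `n`. -/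
lemma card_filter_mod_eq {n a i : ℕ} (hi : i < a) :
    (Finset.univ.filter fun v : Fin n => (v : ℕ) % a = i).card =
      n / a + if i < n % a then 1 else 0 := by
  have h := Nat.count_modEq_card n (r := a) (by omega) i
  rw [Nat.mod_eq_of_lt hi, Nat.count_eq_card_filter_range] at h
  rw [← h]
  refine Finset.card_bij (fun v _ => (v : ℕ)) ?_ (fun _ _ _ _ h => Fin.ext h) ?_
  · intro v hv
    simp only [Finset.mem_filter, Finset.mem_univ, true_and] at hv
    simp only [Finset.mem_filter, Finset.mem_range, v.2, true_and, Nat.ModEq, hv,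
      Nat.mod_eq_of_lt hi]
  · intro v hv
    simp only [Finset.mem_filter, Finset.mem_range, Nat.ModEq, Nat.mod_eq_of_lt hi] at hv
    exact ⟨⟨v, hv.1⟩, by simpa using hv.2, rfl⟩

/-- A bijection with prescribed fibres and prescribed images of one point in each fibre. -/
lemma exists_equiv_of_card_fibre {W X ι : Type*} [Fintype W] [Fintype X] [DecidableEq ι]
    {f : W → ι} {g : X → ι} (z : ι → W) (z' : ι → X) (hz : ∀ i, f (z i) = i)
    (hz' : ∀ i, g (z' i) = i)
    (h : ∀ i, (Finset.univ.filter fun v => f v = i).card =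
      (Finset.univ.filter fun v => g v = i).card) :
    ∃ e : W ≃ X, (∀ v, g (e v) = f v) ∧ ∀ i, e (z i) = z' i := by
  classical
  have hfib : ∀ c, ∃ e : {i // f i = c} ≃ {i // g i = c}, e ⟨z c, hz c⟩ = ⟨z' c, hz' c⟩ := by
    intro c
    have : Nonempty ({i // f i = c} ≃ {i // g i = c}) := by
      rw [← Fintype.card_eq, Fintype.card_subtype, Fintype.card_subtype]
      exact h c
    obtain ⟨e⟩ := this
    -- The swap corrects the image of the marked point.
    exact ⟨e.trans (Equiv.swap (e ⟨z c, hz c⟩) ⟨z' c, hz' c⟩), by simp⟩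
  choose e he using hfib
  refine ⟨Equiv.ofFiberEquiv e, fun v => Equiv.ofFiberEquiv_map e v, fun i => ?_⟩
  have key : ∀ c (v : W) (hv : f v = c), Equiv.ofFiberEquiv e v = (e c ⟨v, hv⟩ : X) := by
    rintro c v rfl
    rfl
  rw [key i (z i) (hz i), he]

/-- Vertices in balanced classes can be numbered so that the classes become the residue classes,
a prescribed largest class becomes the class of `0`, and prescribed representatives become the
least elements of the classes. -/
lemma exists_numbering {W : Type*} [Fintype W] {n a : ℕ} (hW : Fintype.card W = n)
    {f : W → Fin a} {z : Fin a → W} (hz : ∀ i, f (z i) = i) {i₀ : Fin a}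
    (hbal : ∀ i j, (Finset.univ.filter fun v => f v = i).card ≤
      (Finset.univ.filter fun v => f v = j).card + 1)
    (hmax : ∀ i, (Finset.univ.filter fun v => f v = i).card ≤
      (Finset.univ.filter fun v => f v = i₀).card) :
    ∃ (e : W ≃ Fin n) (σ : Equiv.Perm (Fin a)), (∀ v, (e v : ℕ) % a = σ (f v)) ∧
      (∀ i, (e (z i) : ℕ) = σ i) ∧ (σ i₀ : ℕ) = 0 := by
  classical
  have ha : 0 < a := i₀.pos
  have han : a ≤ n := by
    rw [← hW, ← Fintype.card_fin a]
    exact Fintype.card_le_of_injective z fun i j h => by rw [← hz i, h, hz j]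
  let t : Fin a → ℕ := fun i => n / a + if (i : ℕ) < n % a then 1 else 0
  let g : Fin n → Fin a := fun v => ⟨v % a, Nat.mod_lt _ ha⟩
  have hg : ∀ i, (Finset.univ.filter fun v => g v = i).card = t i := by
    intro i
    refine Eq.trans ?_ (card_filter_mod_eq i.2)
    congr 1
    refine Finset.filter_congr fun v _ => ?_
    exact Fin.ext_iff
  have hsum : ∑ i, (Finset.univ.filter fun v => f v = i).card = ∑ i, t i := by
    have h1 := Finset.card_eq_sum_card_fiberwise (f := f) (s := Finset.univ) (t := Finset.univ)
      fun _ _ => Finset.mem_coe.2 (Finset.mem_univ _)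
    have h2 := Finset.card_eq_sum_card_fiberwise (f := g) (s := Finset.univ) (t := Finset.univ)
      fun _ _ => Finset.mem_coe.2 (Finset.mem_univ _)
    rw [← h1, Finset.card_univ, hW, ← Finset.sum_congr rfl fun i _ => hg i, ← h2,
      Finset.card_univ, Fintype.card_fin]
  obtain ⟨σ, hσ⟩ := exists_perm_of_balanced hbal (g := t) (fun i j => by
    simp only [t]
    split_ifs <;> omega) hsum
  let o : Fin a := ⟨0, ha⟩
  have ho : t (σ i₀) = t o := by
    refine le_antisymm ?_ ?_
    · simp only [t, o]
      split_ifs <;> omega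
    · have := hmax (σ.symm o)
      rwa [← hσ, ← hσ, Equiv.apply_symm_apply] at this
  -- `σ` matches the class sizes but need not send `i₀` to 0. Both `σ i₀` and 0 index largest
  -- residue classes, so they may be swapped.
  let τ : Equiv.Perm (Fin a) := σ.trans (Equiv.swap (σ i₀) o)
  have hτ : ∀ i, t (τ i) = (Finset.univ.filter fun v => f v = i).card := by
    intro i
    rw [← hσ i]
    simp only [τ, Equiv.trans_apply, Equiv.swap_apply_def]
    split_ifs with h1 h2
    · rw [h1, ho]
    · rw [h2, ho]
    · rfl
  obtain ⟨e, he, hez⟩ := exists_equiv_of_card_fibre (f := fun v => τ (f v)) (g := g)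
    (fun i => z (τ.symm i)) (fun i => ⟨i, i.2.trans_le han⟩) (by simp [hz])
    (fun i => Fin.ext (Nat.mod_eq_of_lt i.2)) fun i => by
      rw [hg, ← τ.apply_symm_apply i, hτ]
      congr 1
      refine Finset.filter_congr fun v _ => ?_
      rw [Equiv.apply_symm_apply, Equiv.eq_symm_apply]
  refine ⟨e, τ, fun v => congrArg Fin.val (he v), fun i => ?_, ?_⟩
  · have := hez (τ i)
    rw [Equiv.symm_apply_apply] at this
    rw [this]
  · simp [τ, o]

end Residues

/-! ### Recognising `G(n, a)` and `F(n, a)`. -/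

section Isos

variable {V : Type*} [Fintype V] [DecidableEq V] {G : SimpleGraph V} {n a : ℕ}

lemma balancedCliques_adj {v w : Fin n} :
    (balancedCliques n a).Adj v w ↔ v ≠ w ∧ (v : ℕ) % a = (w : ℕ) % a := by
  rw [balancedCliques, compl_adj, turanGraph_adj, not_not]

lemma linkedCliques_adj {v w : Fin n} :
    (linkedCliques n a).Adj v w ↔ v ≠ w ∧ ((v : ℕ) % a = (w : ℕ) % a ∨
      ((v : ℕ) = 0 ∧ (w : ℕ) < a) ∨ ((w : ℕ) = 0 ∧ (v : ℕ) < a)) := by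
  rw [linkedCliques, sup_adj, balancedCliques_adj, fromRel_adj, ← and_or_left]
  refine and_congr_right fun h => ?_
  have : (v : ℕ) ≠ w := fun h' => h (Fin.ext h')
  constructor
  · rintro (h | ⟨h1, h2, h3⟩ | ⟨h1, h2, h3⟩)
    · exact Or.inl h
    · exact Or.inr (Or.inl ⟨h1, h3⟩)
    · exact Or.inr (Or.inr ⟨h1, h3⟩)
  · rintro (h | ⟨h1, h3⟩ | ⟨h1, h3⟩)
    · exact Or.inl h
    · exact Or.inr (Or.inl ⟨h1, by omega, h3⟩)
    · exact Or.inr (Or.inr ⟨h1, by omega, h3⟩)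

/-- A balanced disjoint union of cliques is the complement of a Turán graph. -/
lemma nonempty_iso_balancedCliques {T : Set V} {W : Finset V} {p : V → ℕ}
    (hTW : ∀ v, v ∈ T ↔ v ∈ W) (hp : CliqueUnion G W (Finset.range a) p) (ha : 0 < a)
    (hW : W.card = n) (hn : a ≤ n) (hbal : ∀ i < a, ∀ j < a,
      (W.filter (p · = i)).card ≤ (W.filter (p · = j)).card + 1) :
    Nonempty (G.induce T ≃g balancedCliques n a) := by
  classical
  have hTmem : ∀ v : T, (v : V) ∈ W := fun v => (hTW v).1 v.2
  let f : T → Fin a := fun v => ⟨p v, Finset.mem_range.1 (hp.mapsTo v (hTmem v))⟩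
  have hcard : ∀ i, (Finset.univ.filter fun v : T => f v = i).card =
      (W.filter (p · = i)).card := by
    intro i
    refine Finset.card_bij (fun v _ => (v : V)) ?_ (fun _ _ _ _ h => Subtype.ext h) ?_
    · intro v hv
      rw [Finset.mem_filter] at hv
      exact Finset.mem_filter.2 ⟨hTmem v, congrArg Fin.val hv.2⟩
    · intro v hv
      rw [Finset.mem_filter] at hv
      exact ⟨⟨v, (hTW v).2 hv.1⟩, Finset.mem_filter.2 ⟨Finset.mem_univ _, Fin.ext hv.2⟩, rfl⟩
  have hTcard : Fintype.card T = n := by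
    rw [← hW, ← Fintype.card_coe]
    exact Fintype.card_congr (Equiv.subtypeEquivRight hTW)
  -- An empty class would leave at most one vertex for each of the other `a - 1` classes, fewer than
  -- `a` in total.
  have hne : ∀ i : Fin a, ∃ v : T, f v = i := by
    intro i
    by_contra hno
    push Not at hno
    have h0 : (W.filter (p · = i)).card = 0 := by
      rw [← hcard, Finset.card_eq_zero, Finset.filter_eq_empty_iff]
      exact fun v _ => hno v
    have hsum := hp.sum_card
    rw [hW, ← Finset.add_sum_erase _ _ (Finset.mem_range.2 i.2), h0, zero_add] at hsum
    have hle : ∑ j ∈ (Finset.range a).erase i, (W.filter (p · = j)).card ≤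
        ∑ j ∈ (Finset.range a).erase (i : ℕ), 1 := Finset.sum_le_sum fun j hj => by
      have := hbal j (Finset.mem_range.1 (Finset.mem_of_mem_erase hj)) i i.2
      omega
    rw [Finset.sum_const, smul_eq_mul, mul_one,
      Finset.card_erase_of_mem (Finset.mem_range.2 i.2), Finset.card_range] at hle
    omega
  choose z hz using hne
  have : Nonempty (Fin a) := ⟨⟨0, ha⟩⟩
  obtain ⟨i₀, -, hi₀⟩ := Finset.univ.exists_max_image
    (fun i => (Finset.univ.filter fun v : T => f v = i).card)
    (Finset.univ_nonempty : (Finset.univ : Finset (Fin a)).Nonempty)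
  obtain ⟨e, σ, he, -, -⟩ := exists_numbering hTcard hz
    (fun i j => by rw [hcard, hcard]; exact hbal i i.2 j j.2)
    fun i => hi₀ i (Finset.mem_univ i)
  refine ⟨⟨e, fun {u v} => ?_⟩⟩
  rw [balancedCliques_adj, he, he, comap_adj, ← Fin.ext_iff, e.injective.ne_iff,
    σ.injective.eq_iff, Fin.ext_iff]
  by_cases huv : u = v
  · subst huv
    simp
  · have huv' : (u : V) ≠ v := fun h => huv (Subtype.ext h)
    exact ⟨fun h => (hp.adj_iff u (hTmem u) v (hTmem v) huv').2 h.2,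
      fun h => ⟨huv, (hp.adj_iff u (hTmem u) v (hTmem v) huv').1 h⟩⟩

/-- A balanced star of cliques is the graph `F(n, a)`. -/
lemma nonempty_iso_linkedCliques {p : V → ℕ} {z : ℕ → V}
    (hL : Linked G Finset.univ (Finset.range a) p z) (hn : Fintype.card V = n)
    (hbal : ∀ i < a, (Finset.univ.filter (p · = i)).card ≤ (Finset.univ.filter (p · = 0)).card ∧
        (Finset.univ.filter (p · = 0)).card ≤ (Finset.univ.filter (p · = i)).card + 1) :
    Nonempty (G ≃g linkedCliques n a) := by
  have ha : 0 < a := Finset.mem_range.1 hL.zero_mem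
  have hpa : ∀ v, p v < a := fun v => Finset.mem_range.1 (hL.mapsTo v (Finset.mem_univ v))
  let f : V → Fin a := fun v => ⟨p v, hpa v⟩
  have hcard : ∀ i, (Finset.univ.filter fun v => f v = i).card =
      (Finset.univ.filter (p · = i)).card := by
    intro i
    congr 1
    exact Finset.filter_congr fun v _ => Fin.ext_iff
  have hz : ∀ i : Fin a, f (z i) = i := fun i => Fin.ext (hL.apply_z i (Finset.mem_range.2 i.2))
  obtain ⟨e, σ, he, hez, hσ⟩ := exists_numbering (i₀ := ⟨0, ha⟩) (z := fun i => z i) hn hz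
    (fun i j => by
      rw [hcard, hcard]
      have := hbal i i.2
      have := hbal j j.2
      omega)
    fun i => by
      rw [hcard, hcard]
      exact (hbal i i.2).1
  have he0 : (e (z 0) : ℕ) = 0 := (hez ⟨0, ha⟩).trans hσ
  have hz0 : ∀ v, (e v : ℕ) = 0 ↔ v = z 0 := by
    intro v
    conv_lhs => rw [← he0, ← Fin.ext_iff, e.injective.eq_iff]
  have hza : ∀ v, (e v : ℕ) < a ↔ v = z (p v) := by
    intro v
    constructor
    · intro h
      have h1 := he v
      rw [Nat.mod_eq_of_lt h, ← hez (f v), ← Fin.ext_iff, e.injective.eq_iff] at h1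
      exact h1
    · intro h
      rw [h]
      exact (hez (f v)).trans_lt (σ (f v)).2
  refine ⟨⟨e, fun {u v} => ?_⟩⟩
  rw [linkedCliques_adj, he, he, ← Fin.ext_iff, e.injective.ne_iff, σ.injective.eq_iff,
    Fin.ext_iff, hz0, hz0, hza, hza]
  by_cases huv : u = v
  · subst huv
    simp
  · rw [hL.adj_iff u (Finset.mem_univ u) v (Finset.mem_univ v) huv]
    simp only [ne_eq, huv, not_false_eq_true, true_and]
    rfl

/-- The graph `F(n, a)` is a star of cliques. -/
lemma linked_of_iso (e : G ≃g linkedCliques n a) (ha : 0 < a) (han : a ≤ n) :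
    Linked G Finset.univ (Finset.range a) (fun v => (e v : ℕ) % a)
      (fun i => e.symm ⟨i % a, (Nat.mod_lt i ha).trans_le han⟩) := by
  have hz : ∀ i, (e (e.symm ⟨i % a, (Nat.mod_lt i ha).trans_le han⟩) : ℕ) = i % a := by simp
  have hz' : ∀ i v, v = e.symm ⟨i % a, (Nat.mod_lt i ha).trans_le han⟩ ↔ (e v : ℕ) = i % a := by
    intro i v
    constructor
    · rintro rfl
      exact hz i
    · intro h
      rw [← hz i, ← Fin.ext_iff] at h
      exact e.injective h
  have hmod : ∀ v, (e v : ℕ) = (e v : ℕ) % a ↔ (e v : ℕ) < a := fun v =>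
    ⟨fun h => h ▸ Nat.mod_lt _ ha, fun h => (Nat.mod_eq_of_lt h).symm⟩
  refine ⟨Finset.mem_range.2 ha, fun v _ => Finset.mem_range.2 (Nat.mod_lt _ ha),
    fun _ _ => Finset.mem_univ _, fun i hi => ?_, fun u _ v _ huv => ?_⟩
  · rw [hz, Nat.mod_mod, Nat.mod_eq_of_lt (Finset.mem_range.1 hi)]
  · rw [← e.map_adj_iff, linkedCliques_adj, hz', hz', hz', hz', Nat.zero_mod, Nat.mod_mod,
      Nat.mod_mod, hmod, hmod, and_iff_right (e.injective.ne huv)]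

end Isos

/-! ### The cycle of order five. -/

section Pentagon

variable {V : Type*} [Fintype V] [DecidableEq V] {G : SimpleGraph V} {a : ℕ} {v w : V}

lemma conn_univ (h : G.Connected) : Conn G Finset.univ := by
  intro T _ hT hne
  obtain ⟨u, hu⟩ := hT
  obtain ⟨v, hv⟩ : ∃ v, v ∉ T := by
    by_contra! hall
    exact hne (Finset.eq_univ_of_forall hall)
  obtain ⟨q⟩ := h.preconnected u v
  obtain ⟨d, -, h1, h2⟩ := q.exists_boundary_dart (T : Set V) hu hv
  exact ⟨d.fst, h1, d.snd, Finset.mem_univ _, h2, d.adj⟩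

lemma numMaxIndepSets_eq (G : SimpleGraph V) :
    numMaxIndepSets G = (indepSets G Finset.univ G.indepNum).card := by
  rw [numMaxIndepSets, ← Set.ncard_coe_finset]
  congr 1
  ext I
  simp only [Set.mem_ofPred_eq, Finset.mem_coe, mem_indepSets, Finset.subset_univ, true_and,
    ← indep_iff]
  refine ⟨fun h => ⟨maximumIndepSet_card_eq_indepNum I h, h.isIndepSet⟩, fun h => ⟨h.2, ?_⟩⟩
  intro J hJ
  rw [h.1]
  exact hJ.card_le_indepNum

lemma IsPentagon.exists_adj_iff (h : IsPentagon G Finset.univ a) (hvw : G.Adj v w) :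
    ∃ c, c ≠ w ∧ c ≠ v ∧ ∀ u, G.Adj v u ↔ u = w ∨ u = c := by
  have h3 := h.2.2 v (Finset.mem_univ v)
  have hv : v ∈ near G Finset.univ v := mem_near.2 ⟨Finset.mem_univ _, Or.inl rfl⟩
  have hw : w ∈ (near G Finset.univ v).erase v :=
    Finset.mem_erase.2 ⟨hvw.ne', mem_near.2 ⟨Finset.mem_univ _, Or.inr hvw⟩⟩
  have h1 : (((near G Finset.univ v).erase v).erase w).card = 1 := by
    rw [Finset.card_erase_of_mem hw, Finset.card_erase_of_mem hv, h3]
  obtain ⟨c, hc⟩ := Finset.card_eq_one.1 h1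
  have key : ∀ u, u ≠ w ∧ u ≠ v ∧ (u = v ∨ G.Adj v u) ↔ u = c := by
    intro u
    have := Finset.ext_iff.1 hc u
    rwa [Finset.mem_singleton, Finset.mem_erase, Finset.mem_erase, mem_near,
      and_iff_right (Finset.mem_univ u)] at this
  obtain ⟨hcw, hcv, hc'⟩ := (key c).2 rfl
  refine ⟨c, hcw, hcv, fun u => ⟨fun hu => ?_, ?_⟩⟩
  · by_cases huw : u = w
    · exact Or.inl huw
    · exact Or.inr ((key u).1 ⟨huw, hu.ne', Or.inr hu⟩)
  · rintro (rfl | rfl)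
    · exact hvw
    · exact hc'.resolve_left hcv

/-- In a connected graph, a set closed under adjacency contains all vertices. -/
lemma Conn.card_le {T : Finset V} (hconn : Conn G Finset.univ) (hT : T.Nonempty)
    (h : ∀ u ∈ T, ∀ v, G.Adj u v → v ∈ T) : Fintype.card V ≤ T.card := by
  by_cases hTu : T = Finset.univ
  · rw [hTu, Finset.card_univ]
  · obtain ⟨u, hu, v, -, hv, huv⟩ := hconn T (Finset.subset_univ T) hT hTu
    exact absurd (h u hu v huv) hv

/-- A connected graph with five vertices of degree two is a cycle. -/
lemma IsPentagon.nonempty_iso (h : IsPentagon G Finset.univ a) (hconn : Conn G Finset.univ) :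
    Nonempty (G ≃g cycleGraph 5) := by
  have hcard : Fintype.card V = 5 := h.1
  have : Nonempty V := Fintype.card_pos_iff.1 (by omega)
  obtain ⟨x⟩ := this
  obtain ⟨b, -, hxb⟩ := hconn.exists_adj (by rw [h.1]; norm_num) (Finset.mem_univ x)
  obtain ⟨y, hyb, hyx, hx⟩ := h.exists_adj_iff hxb
  obtain ⟨c, hcx, hcy, hy⟩ := h.exists_adj_iff ((hx y).2 (Or.inr rfl)).symm
  obtain ⟨d, hdx, hdb, hb⟩ := h.exists_adj_iff hxb.symm
  -- Neighbours are followed along the path `d, b, x, y, c`. An early coincidence would close a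
  -- cycle on three or four vertices, which would be a whole component.
  have hcb : c ≠ b := by
    rintro rfl
    have hdy : y = d := ((hb y).1 ((hy c).2 (Or.inr rfl)).symm).resolve_left hyx
    have := hconn.card_le (T := {x, y, c}) ⟨x, by simp⟩ (by
      subst hdy
      simp [hx, hy, hb])
    have := Finset.card_le_three (a := x) (b := y) (c := c)
    omega
  have hdy : d ≠ y := by
    rintro rfl
    exact hcb (((hy b).1 ((hb d).2 (Or.inr rfl)).symm).resolve_left hxb.ne').symm
  obtain ⟨e, hey, hec, hc⟩ := h.exists_adj_iff ((hy c).2 (Or.inr rfl)).symm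
  have hcd : c ≠ d := by
    rintro rfl
    have heb : b = e := ((hc b).1 ((hb c).2 (Or.inr rfl)).symm).resolve_left hyb.symm
    have := hconn.card_le (T := {x, y, c, b}) ⟨x, by simp⟩ (by
      subst heb
      simp [hx, hy, hb, hc])
    have := Finset.card_le_four (a := x) (b := y) (c := c) (d := b)
    omega
  have hxb' := hxb.ne
  let f : Fin 5 → V := ![x, y, c, d, b]
  have hinj : Function.Injective f := by
    intro i j hij
    fin_cases i <;> fin_cases j <;> simp_all [f, eq_comm]
  have hbij := (Fintype.bijective_iff_injective_and_card f).2 ⟨hinj, by simp [hcard]⟩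
  have hall : ∀ v, v = x ∨ v = y ∨ v = c ∨ v = d ∨ v = b := by
    intro v
    obtain ⟨i, rfl⟩ := hbij.2 v
    fin_cases i <;> simp [f]
  have hed : e = d := by
    have hce := (hc e).2 (Or.inr rfl)
    rcases hall e with rfl | rfl | rfl | rfl | rfl
    · have := (hx c).1 hce.symm
      tauto
    · exact absurd rfl hey
    · exact absurd rfl hec
    · rfl
    · have := (hb c).1 hce.symm
      tauto
  subst hed
  obtain ⟨k, hkb, hkd, hd⟩ := h.exists_adj_iff ((hb e).2 (Or.inr rfl)).symm
  have hkc : c = k := ((hd c).1 ((hc e).2 (Or.inr rfl)).symm).resolve_left hcb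
  subst hkc
  refine ⟨(⟨Equiv.ofBijective f hbij, fun {i j} => ?_⟩ : cycleGraph 5 ≃g G).symm⟩
  rw [cycleGraph_adj, Equiv.ofBijective_apply, Equiv.ofBijective_apply]
  have hyx' := hyx.symm
  have hyb' := hyb.symm
  have hcx' := hcx.symm
  have hcy' := hcy.symm
  have hdx' := hdx.symm
  have hcb' := hcb.symm
  have hdy' := hdy.symm
  have hcd' := hcd.symm
  have hdb' := hdb.symm
  have hbx' := hxb'.symm
  fin_cases i <;> fin_cases j <;> simp [f, *] <;> decide

/-- Each of the five vertices has two non-neighbours and so lies in two independent pairs; every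
pair is counted twice. -/
lemma card_indepSets_of_iso_pentagon (e : G ≃g cycleGraph 5) :
    (indepSets G Finset.univ 2).card = 5 := by
  have hfar : ∀ v, (far G Finset.univ v).card = 2 := by
    intro v
    have h5 : ∀ i : Fin 5,
        (Finset.univ.filter fun j : Fin 5 => j ≠ i ∧ ¬ (i - j = 1 ∨ j - i = 1)).card = 2 := by
      decide
    rw [← h5 (e v)]
    refine Finset.card_bij (fun u _ => e u) ?_ (fun _ _ _ _ h => e.injective h) ?_
    · intro u hu
      obtain ⟨-, h1, h2⟩ := mem_far.1 hu
      rw [← e.map_adj_iff, cycleGraph_adj] at h2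
      exact Finset.mem_filter.2 ⟨Finset.mem_univ _, e.injective.ne h1, h2⟩
    · intro j hj
      obtain ⟨-, h1, h2⟩ := Finset.mem_filter.1 hj
      refine ⟨e.symm j, mem_far.2 ⟨Finset.mem_univ _, ?_, ?_⟩, e.apply_symm_apply j⟩
      · rintro rfl
        exact h1 (e.apply_symm_apply j).symm
      · rwa [← e.map_adj_iff, e.apply_symm_apply, cycleGraph_adj]
  have hsum := sum_card_indepSetsAt G Finset.univ 2
  rw [Finset.sum_congr rfl fun v hv => (card_indepSetsAt (k := 1) hv).trans
    ((card_indepSets_one G _).trans (hfar v)), Finset.sum_const, Finset.card_univ,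
    Fintype.card_congr e.toEquiv, Fintype.card_fin, smul_eq_mul] at hsum
  omega

end Pentagon

/-! ### The extremal family attains the bound, and nothing else does. -/

section Extremal

variable {V : Type*} [Fintype V] [DecidableEq V] {G : SimpleGraph V} {n a : ℕ} {w : V}

lemma card_indepSets_of_iso_linkedCliques (e : G ≃g linkedCliques n a) (ha : 0 < a)
    (han : 2 * a ≤ n) : (indepSets G Finset.univ a).card = connBound n a := by
  have hL := linked_of_iso e ha (by omega)
  have hcard : ∀ i ∈ Finset.range a, (Finset.univ.filter fun v => (e v : ℕ) % a = i).card =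
      n / a + if i < n % a then 1 else 0 := by
    intro i hi
    rw [← card_filter_mod_eq (Finset.mem_range.1 hi)]
    refine Finset.card_bij (fun v _ => e v) (fun v hv => ?_) (fun _ _ _ _ h => e.injective h)
      fun j hj => ⟨e.symm j, ?_, e.apply_symm_apply j⟩
    · simpa using hv
    · simpa using hj
  have hc0 := Finset.mem_range.2 ha
  have hsum : ∑ i ∈ Finset.range a, (n / a + if i < n % a then 1 else 0) = n := by
    rw [← Finset.sum_congr rfl hcard, ← Finset.card_eq_sum_card_fiberwise
      (fun v _ => Finset.mem_coe.2 (hL.mapsTo v (Finset.mem_univ v))), Finset.card_univ,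
      Fintype.card_congr e.toEquiv, Fintype.card_fin]
  have hq : 2 ≤ n / a := (Nat.le_div_iff_mul_le ha).2 han
  have hN := hL.card_indepSets
  rw [Finset.card_range, hcard 0 hc0,
    Finset.prod_congr rfl fun i hi => hcard i (Finset.mem_of_mem_erase hi),
    Finset.prod_congr rfl fun i hi =>
      congrArg (· - 1) (hcard i (Finset.mem_of_mem_erase hi))] at hN
  rw [← Finset.add_sum_erase _ _ hc0] at hsum
  clear hcard
  generalize n / a = q at *
  generalize n % a = r at *
  -- `k + 1` is the order of the residue class of 0, namely `q + 1` if `r > 0` and `q` otherwise. In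
  -- both cases the other orders are `k` or `k + 1`.
  have hS := starProd_eq_connBound (k := q + (if 0 < r then 1 else 0) - 1)
    (m := ((Finset.range a).erase 0).val.map fun i => q + if i < r then 1 else 0) (by
      simp only [Multiset.mem_map]
      rintro x ⟨i, -, rfl⟩
      split_ifs <;> omega)
  rw [hN]
  rw [starProd, Multiset.card_map, Multiset.map_map] at hS
  change _ * ∏ i ∈ (Finset.range a).erase 0, (q + if i < r then 1 else 0) +
    ∏ i ∈ (Finset.range a).erase 0, ((q + if i < r then 1 else 0) - 1) =
      connBound (_ + ∑ i ∈ (Finset.range a).erase 0, (q + if i < r then 1 else 0))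
        (((Finset.range a).erase 0).card + 1) at hS
  rw [hS, Finset.card_erase_add_one hc0, Finset.card_range]
  congr 1
  generalize (∑ i ∈ (Finset.range a).erase 0, (q + if i < r then 1 else 0)) = s at *
  omega

/-- The only vertex of a one-element class is adjacent to the vertex `w` outside the cliques. -/
lemma CliqueUnion.exists_adj_of_card_eq_one {s : Finset ℕ} {p : V → ℕ}
    (hp : CliqueUnion G (Finset.univ.erase w) s p) (hconn : Conn G Finset.univ) {i : ℕ}
    (hi : ((Finset.univ.erase w).filter (p · = i)).card = 1) :
    ∀ v, v ≠ w → p v = i → G.Adj w v := by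
  intro v hv hvi
  obtain ⟨y, -, hvy⟩ := hconn.exists_adj
    (Finset.one_lt_card.2 ⟨v, Finset.mem_univ _, w, Finset.mem_univ _, hv⟩) (Finset.mem_univ v)
  by_cases hyw : y = w
  · exact hyw ▸ hvy.symm
  · have hmem : ∀ {u}, u ≠ w → u ∈ Finset.univ.erase w := fun h =>
      Finset.mem_erase.2 ⟨h, Finset.mem_univ _⟩
    have h1 := (hp.adj_iff v (hmem hv) y (hmem hyw) hvy.ne).1 hvy
    exact absurd (Finset.card_le_one.1 hi.le v (Finset.mem_filter.2 ⟨hmem hv, hvi⟩) y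
      (Finset.mem_filter.2 ⟨hmem hyw, h1 ▸ hvi⟩)) hvy.ne

/-- If two of the cliques have only one vertex, then no maximum independent set contains the
vertex outside the cliques. -/
lemma CliqueUnion.indepSetsAt_eq_empty {s : Finset ℕ} {p : V → ℕ}
    (hp : CliqueUnion G (Finset.univ.erase w) s p) (hconn : Conn G Finset.univ) {i j : ℕ}
    (his : i ∈ s) (hjs : j ∈ s) (hij : i ≠ j)
    (hi : ((Finset.univ.erase w).filter (p · = i)).card = 1)
    (hj : ((Finset.univ.erase w).filter (p · = j)).card = 1) :
    indepSetsAt G Finset.univ s.card w = ∅ := by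
  refine Finset.eq_empty_of_forall_notMem fun I hI => ?_
  obtain ⟨hI, hwI⟩ := mem_indepSetsAt.1 hI
  obtain ⟨-, hc, hI⟩ := mem_indepSets.1 hI
  have hsub : I.erase w ⊆ Finset.univ.erase w := Finset.erase_subset_erase w (Finset.subset_univ I)
  have hinj := hp.injOn hsub fun u hu v hv =>
    hI u (Finset.mem_of_mem_erase hu) v (Finset.mem_of_mem_erase hv)
  -- `I.erase w` has one vertex fewer than there are colours, but it misses both one-vertex classes,
  -- whose vertices are adjacent to `w`.
  have hle := Finset.card_le_card_of_injOn (t := (s.erase i).erase j) p (fun v hv => by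
    obtain ⟨hvw, hvI⟩ := Finset.mem_erase.1 (Finset.mem_coe.1 hv)
    refine Finset.mem_coe.2 (Finset.mem_erase.2 ⟨fun h => ?_, Finset.mem_erase.2 ⟨fun h => ?_,
      hp.mapsTo v (hsub hv)⟩⟩)
    · exact hI w hwI v hvI (hp.exists_adj_of_card_eq_one hconn hj v hvw h)
    · exact hI w hwI v hvI (hp.exists_adj_of_card_eq_one hconn hi v hvw h)) hinj
  have h2 := Finset.one_lt_card.2 ⟨i, his, j, hjs, hij⟩
  rw [Finset.card_erase_of_mem hwI, Finset.card_erase_of_mem (Finset.mem_erase.2 ⟨hij.symm, hjs⟩),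
    Finset.card_erase_of_mem his, hc] at hle
  omega

/-- At least two cliques of `G(n - 1, a)` have only one vertex, so no independent set of `a`
vertices contains the extra vertex, however it is attached in a connected graph. The count is that
of the cliques alone, and `reducedProd` is 0. -/
lemma card_indepSets_of_iso_balancedCliques {H : SimpleGraph (Fin n)} (hconn : Conn G Finset.univ)
    (φ : G ≃g H) {x₀ : Fin n}
    (ψ : H.induce ({x₀}ᶜ : Set (Fin n)) ≃g balancedCliques (n - 1) a) (han : a < n)
    (hna : n < 2 * a) : (indepSets G Finset.univ a).card = connBound n a := by
  have ha : 0 < a := by omega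
  let w := φ.symm x₀
  have hw : ∀ {v}, v ≠ w → φ v ∈ ({x₀}ᶜ : Set (Fin n)) := fun {v} h h' =>
    h (by rw [← φ.symm_apply_apply v, Set.mem_singleton_iff.1 h'])
  let p : V → ℕ := fun v => if h : v = w then 0 else (ψ ⟨φ v, hw h⟩ : ℕ) % a
  have hpv : ∀ {v} (h : v ≠ w), p v = (ψ ⟨φ v, hw h⟩ : ℕ) % a := fun h => dif_neg h
  have hp : CliqueUnion G (Finset.univ.erase w) (Finset.range a) p := by
    refine ⟨fun v hv => ?_, fun u hu v hv huv => ?_⟩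
    · rw [hpv (Finset.ne_of_mem_erase hv)]
      exact Finset.mem_range.2 (Nat.mod_lt _ ha)
    · have hu := Finset.ne_of_mem_erase hu
      have hv := Finset.ne_of_mem_erase hv
      rw [hpv hu, hpv hv, ← φ.map_adj_iff]
      have h1 : H.Adj (φ u) (φ v) ↔
          (H.induce ({x₀}ᶜ : Set (Fin n))).Adj ⟨φ u, hw hu⟩ ⟨φ v, hw hv⟩ := Iff.rfl
      rw [h1, ← ψ.map_adj_iff, balancedCliques_adj, and_iff_right]
      exact ψ.injective.ne fun h => huv (φ.injective (congrArg Subtype.val h))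
  have hcard : ∀ i ∈ Finset.range a, ((Finset.univ.erase w).filter (p · = i)).card =
      (n - 1) / a + if i < (n - 1) % a then 1 else 0 := by
    intro i hi
    rw [← card_filter_mod_eq (Finset.mem_range.1 hi)]
    refine Finset.card_bij
      (fun v hv => ψ ⟨φ v, hw (Finset.ne_of_mem_erase (Finset.mem_filter.1 hv).1)⟩)
      (fun v hv => ?_) (fun u hu v hv h => ?_) fun j hj => ?_
    · obtain ⟨hv, hvi⟩ := Finset.mem_filter.1 hv
      rw [hpv (Finset.ne_of_mem_erase hv)] at hvi
      exact Finset.mem_filter.2 ⟨Finset.mem_univ _, hvi⟩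
    · exact φ.injective (congrArg Subtype.val (ψ.injective h))
    · have hne : φ.symm (ψ.symm j) ≠ w := fun h => (ψ.symm j).2 (φ.symm.injective h)
      have hψ : ψ ⟨φ (φ.symm (ψ.symm j)), hw hne⟩ = j := by
        rw [← ψ.eq_symm_apply]
        exact Subtype.ext (φ.apply_symm_apply _)
      refine ⟨φ.symm (ψ.symm j), Finset.mem_filter.2
        ⟨Finset.mem_erase.2 ⟨hne, Finset.mem_univ _⟩, ?_⟩, hψ⟩
      rw [hpv hne, hψ]
      exact (Finset.mem_filter.1 hj).2
  have hS : (Finset.univ.erase w).card = n - 1 := by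
    rw [Finset.card_erase_of_mem (Finset.mem_univ w), Finset.card_univ,
      Fintype.card_congr φ.toEquiv, Fintype.card_fin]
  have hq : (n - 1) / a = 1 := by
    rw [Nat.div_eq_iff ha]
    omega
  have hr := Nat.div_add_mod (n - 1) a
  rw [hq] at hr hcard
  -- The remainder of `n - 1` is `n - 1 - a ≤ a - 2`, so the classes of `a - 1` and `a - 2` have one
  -- vertex each.
  have h1 : a - 1 ∈ Finset.range a := Finset.mem_range.2 (by omega)
  have h2 : a - 2 ∈ Finset.range a := Finset.mem_range.2 (by omega)
  have hat := hp.indepSetsAt_eq_empty hconn h1 h2 (by omega)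
    (by rw [hcard _ h1, if_neg (by omega)]) (by rw [hcard _ h2, if_neg (by omega)])
  have hN := hp.card_indepSets
  rw [Finset.card_range] at hat hN
  have hprod := prod_eq_balancedProd (k := 1)
    (m := (Finset.range a).val.map fun i => ((Finset.univ.erase w).filter (p · = i)).card) (by
      simp only [Multiset.mem_map]
      rintro x ⟨i, hi, rfl⟩
      rw [hcard i hi]
      split_ifs <;> omega)
  have hsum : ((Finset.range a).val.map
      fun i => ((Finset.univ.erase w).filter (p · = i)).card).sum = n - 1 := hS ▸ hp.sum_card
  rw [hsum, Multiset.card_map] at hprod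
  rw [card_indepSets_eq_add G _ a w, hat, Finset.card_empty, connBound,
    reducedProd_eq_zero han hna, hN]
  exact hprod.trans (by simp)

lemma two_le_div_iff (ha : 0 < a) : (2 : ℚ) ≤ (n : ℚ) / (a : ℚ) ↔ 2 * a ≤ n := by
  rw [le_div_iff₀ (by exact_mod_cast ha)]
  exact_mod_cast Iff.rfl

lemma exists_mem_extremalFamily (hG : G.Connected) (hn : Fintype.card V = n)
    (h : IndepLE G Finset.univ a) (ha : 1 ≤ a) (han : a < n)
    (heq : (indepSets G Finset.univ a).card = connBound n a) :
    ∃ H ∈ extremalFamily n a, Nonempty (G ≃g H) := by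
  have hconn := conn_univ hG
  have hn' : (Finset.univ : Finset V).card = n := hn
  rw [← hn'] at heq
  rcases hasCentre_or_isPentagon hconn h ha (by omega) heq with hcen | hpent
  · rcases hcen.exists hconn h ha heq with ⟨hlt, w, -, p, hp, hw⟩ | ⟨p, z, hL, h2, hbal⟩
    · have hS : (Finset.univ.erase w).card = n - 1 := by
        rw [Finset.card_erase_of_mem (Finset.mem_univ w), hn']
      obtain ⟨ψ⟩ := nonempty_iso_balancedCliques (T := {w}ᶜ) (by simp) hp ha hS (by omega)
        fun i hi j hj => hp.card_eq_of_card_eq (by rw [Finset.card_range]; omega)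
          (by rw [Finset.card_range]; exact hw) (Finset.mem_range.2 hi) (Finset.mem_range.2 hj)
      let e : V ≃ Fin n := Fintype.equivFinOfCardEq hn
      let φ : G ≃g G.comap e.symm := ⟨e, by simp⟩
      let θ : (G.comap e.symm).induce ({e w}ᶜ : Set (Fin n)) ≃g G.induce ({w}ᶜ : Set V) :=
        ⟨e.symm.subtypeEquiv fun v => by simp [Equiv.symm_apply_eq], Iff.rfl⟩
      refine ⟨G.comap e.symm, ?_, ⟨φ⟩⟩
      rw [extremalFamily, if_neg (by rw [two_le_div_iff ha]; omega)]
      exact ⟨φ.connected_iff.1 hG, e w, ⟨θ.trans ψ⟩⟩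
    · have h2n : 2 * a ≤ n := by
        have hsum := Finset.card_eq_sum_card_fiberwise (s := Finset.univ)
          fun v _ => Finset.mem_coe.2 (hL.mapsTo v (Finset.mem_univ v))
        have hle := Finset.sum_le_sum fun i hi => h2 i (Finset.mem_range.1 hi)
        rw [← hsum, Finset.sum_const, Finset.card_range, smul_eq_mul, hn'] at hle
        omega
      refine ⟨linkedCliques n a, ?_, nonempty_iso_linkedCliques hL hn hbal⟩
      rw [extremalFamily, if_pos ((two_le_div_iff ha).2 h2n)]
      split_ifs
      · exact Or.inl rfl
      · rfl
  · obtain ⟨rfl, rfl⟩ : n = 5 ∧ a = 2 := ⟨hn'.symm.trans hpent.1, hpent.2.1⟩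
    refine ⟨cycleGraph 5, ?_, hpent.nonempty_iso hconn⟩
    rw [extremalFamily, if_pos (by norm_num), if_pos ⟨rfl, rfl⟩]
    exact Or.inr rfl

lemma card_indepSets_of_mem_extremalFamily (hconn : Conn G Finset.univ) (ha : 1 ≤ a) (han : a < n)
    {H : SimpleGraph (Fin n)} (hH : H ∈ extremalFamily n a) (φ : G ≃g H) :
    (indepSets G Finset.univ a).card = connBound n a := by
  rw [extremalFamily] at hH
  split_ifs at hH with h2 h5
  · rcases hH with rfl | rfl
    · exact card_indepSets_of_iso_linkedCliques φ ha ((two_le_div_iff ha).1 h2)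
    · obtain ⟨rfl, rfl⟩ := h5
      rw [card_indepSets_of_iso_pentagon φ]
      decide
  · obtain rfl := hH
    exact card_indepSets_of_iso_linkedCliques φ ha ((two_le_div_iff ha).1 h2)
  · obtain ⟨-, x₀, ⟨ψ⟩⟩ := hH
    rw [two_le_div_iff ha, not_le] at h2
    exact card_indepSets_of_iso_balancedCliques hconn φ ψ han h2

end Extremal

theorem theorem2 {V : Type*} [Fintype V] (G : SimpleGraph V) (n α : ℕ)
    (hconn : G.Connected) (hn : Fintype.card V = n) (hα : G.indepNum = α) (hαn : α < n) :
    (numMaxIndepSets G : ℚ) ≤ fCount n α ∧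
      ((numMaxIndepSets G : ℚ) = fCount n α ↔
        ∃ H ∈ extremalFamily n α, Nonempty (G ≃g H)) := by
  classical
  have hind : IndepLE G Finset.univ α := fun I _ hI => hα ▸ hI.card_le_indepNum
  have h1 : 1 ≤ α := by
    obtain ⟨v⟩ := hconn.nonempty
    simpa using hind {v} (Finset.subset_univ _) (by simp)
  have hc := conn_univ hconn
  have hn' : (Finset.univ : Finset V).card = n := hn
  rw [numMaxIndepSets_eq, hα, fCount_eq n α h1 hαn, Nat.cast_le, Nat.cast_inj]
  refine ⟨?_, exists_mem_extremalFamily hconn hn hind h1 hαn, ?_⟩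
  · have := card_indepSets_le_connBound G Finset.univ hc α h1 (by omega) hind
    rwa [hn'] at this
  · rintro ⟨H, hH, ⟨φ⟩⟩
    exact card_indepSets_of_mem_extremalFamily hc h1 hαn hH φ
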